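/- **Theorem.** Let $d\ge 2$ and let $A\subset\mathbb R^d$ be compact with $A=\overline{A^o}$ (every point of $A$ is a limit of interior points) and with $C^2$ boundary: every $x\in\partial A$ has a neighbourhood $U$ such that, after a rotation, $\partial A\cap U$ is the graph of a twice continuously differentiable real-valued function defined on an open subset of $\mathbb R^{d-1}$. Let $\mu$ be a Borel probability measure on $A$ with probability density function $f\ge 0$ with respect to Lebesgue measure, such that $f|_A$ is continuous at $x$ for all $x\in\partial A$. Let $X_1,X_2,\ldots$ be independent random vectors with common distribution $\mu$. For $n,k\in\mathbb N=\{1,2,\ldots\}$ define the $k$-coverage threshold $$R_{n,k}:=\inf\{r>0:\ \text{for all }x\in A,\ \text{at least } k \text{ of } X_1,\ldots,X_n \text{ lie in the closed ball } B(x,r)\}\in[0,\infty],\qquad \inf\emptyset=+\infty .$$ Set $\theta_d:=\pi^{d/2}/\Gamma(1+d/2)$, $f_0:=\operatorname{ess\,inf}_{x\in A}f(x)$ and $f_1:=\inf_{x\in\partial A}f(x)$. Let $H(0):=1$ and $H(t):=1-t+t\log t$ for $t>0$, and for $a,x\ge 0$ let $\hat H_a(x)$ be the unique $y\ge a$ with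 $yH(a/y)=x$ (with $\hat H_0(0):=0$); in particular $\hat H_0(x)=x$. If $f_i=0$ and $b>0$, interpret $b/f_i$ as $+\infty$. Let $\beta\in[0,\infty]$ and $k:\mathbb N\to\mathbb N$ be such that $k(n)/\log n\to\beta$ and $k(n)/n\to 0$ as $n\to\infty$. Then, almost surely as $n\to\infty$, $$\frac{n\theta_d R_{n,k(n)}^d}{k(n)}\to\max\left(\frac1{f_0},\frac2{f_1}\right)\quad\text{if }\beta=\infty,$$ $$\frac{n\theta_d R_{n,k(n)}^d}{\log n}\to\max\left(\frac{\hat H_\beta(1)}{f_0},\frac{2\hat H_\beta(1-1/d)}{f_1}\right)\quad\text{if }\beta<\infty.$$ In particular, for every constant $k\in\mathbb N$, almost surely as $n\to\infty$, $$\frac{n\theta_d R_{n,k}^d}{\log n}\to\max\left(\frac1{f_0},\frac{2-2/d}{f_1}\right).$$ -/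

import Mathlib

open MeasureTheory ProbabilityTheory Filter Topology
open scoped ENNReal

namespace Coverage

noncomputable section

/-- `A` has `C²` boundary: near each boundary point, after an orthogonal change of coordinates
identifying `ℝ^d` with `ℝ^(d-1) × ℝ` (with its Euclidean norm), the boundary is the graph of a
`C²` function on an open subset of `ℝ^(d-1)`. -/
def HasC2Boundary {d : ℕ} (A : Set (EuclideanSpace ℝ (Fin d))) : Prop :=
  ∀ x ∈ frontier A, ∃ U ∈ 𝓝 x,
    ∃ ρ : EuclideanSpace ℝ (Fin d) ≃ₗᵢ[ℝ] WithLp 2 (EuclideanSpace ℝ (Fin (d - 1)) × ℝ),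
    ∃ (V : Set (EuclideanSpace ℝ (Fin (d - 1)))) (g : EuclideanSpace ℝ (Fin (d - 1)) → ℝ),
      IsOpen V ∧ ContDiffOn ℝ 2 g V ∧
        ρ '' (frontier A ∩ U) = {p | p.fst ∈ V ∧ p.snd = g p.fst}

/-- The volume `π^(d/2) / Γ(1 + d/2)` of the unit ball of `ℝ^d`. -/
def ballVol (d : ℕ) : ℝ := Real.pi ^ ((d : ℝ) / 2) / Real.Gamma (1 + (d : ℝ) / 2)

/-- The number of those among the first `n` points of the sequence `x` that lie in `D`. -/
def countIn {E : Type*} (x : ℕ → E) (n : ℕ) (D : Set E) : ℕ :=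
  {i : ℕ | i < n ∧ x i ∈ D}.ncard

/-- The `k`-coverage threshold of `B` by the first `n` points of the sequence `x`: the infimum
(in `[0, ∞]`, equal to `∞` if there is no such radius) of all real `r > 0` such that every closed
ball of radius `r` with centre in `B` contains at least `k` of these points. -/
def coverThreshold {E : Type*} [PseudoMetricSpace E] (B : Set E) (x : ℕ → E) (n k : ℕ) : ℝ≥0∞ :=
  sInf {s | ∃ r : ℝ, 0 < r ∧ (∀ y ∈ B, k ≤ countIn x n (Metric.closedBall y r)) ∧
    s = ENNReal.ofReal r}

/-- The essential infimum of `f ≥ 0` over `B` with respect to Lebesgue measure. -/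
def essInfOn {d : ℕ} (f : EuclideanSpace ℝ (Fin d) → ℝ) (B : Set (EuclideanSpace ℝ (Fin d))) :
    ℝ≥0∞ :=
  essInf (fun x => ENNReal.ofReal (f x)) (volume.restrict B)

/-- The (pointwise) infimum of `f ≥ 0` over the boundary of `A`. -/
def infBoundary {d : ℕ} (f : EuclideanSpace ℝ (Fin d) → ℝ)
    (A : Set (EuclideanSpace ℝ (Fin d))) : ℝ≥0∞ :=
  ⨅ x ∈ frontier A, ENNReal.ofReal (f x)

/-- `H(t) = 1 - t + t log t` for `t > 0`, and `H(0) = 1`. -/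
def chernoffH (t : ℝ) : ℝ := if 0 < t then 1 - t + t * Real.log t else 1

/-- For `a, x ≥ 0`, the unique `y ≥ a` with `y H(a / y) = x` (see `hatH_eq_iff`). -/
def hatH (a x : ℝ) : ℝ := sInf {y : ℝ | a ≤ y ∧ y * chernoffH (a / y) = x}

theorem existsUnique_hatH {a x : ℝ} (ha : 0 ≤ a) (hx : 0 ≤ x) :
    ∃! y : ℝ, a ≤ y ∧ y * chernoffH (a / y) = x := by
  rcases ha.eq_or_lt with rfl | ha
  · refine ⟨x, by simp [chernoffH, hx], ?_⟩
    rintro y ⟨-, hy⟩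
    simpa [chernoffH] using hy
  have key : ∀ y, a ≤ y →
      y * chernoffH (a / y) = y - a + a * Real.log a - a * Real.log y := by
    intro y hy
    have hy0 : 0 < y := ha.trans_le hy
    rw [chernoffH, if_pos (div_pos ha hy0), Real.log_div ha.ne' hy0.ne']
    field_simp
    ring
  have hmono : ∀ y z, a ≤ y → y < z →
      y - a + a * Real.log a - a * Real.log y < z - a + a * Real.log a - a * Real.log z := by
    intro y z hy hz
    have hy0 : 0 < y := ha.trans_le hy
    have hz0 : 0 < z := hy0.trans hz
    have h1 : Real.log (z / y) < z / y - 1 :=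
      Real.log_lt_sub_one_of_pos (div_pos hz0 hy0) (by rw [Ne, div_eq_one_iff_eq hy0.ne']; exact hz.ne')
    rw [Real.log_div hz0.ne' hy0.ne'] at h1
    have h2 : a * (z / y - 1) ≤ z - y := by
      have h3 : a * (z / y - 1) = (a / y) * (z - y) := by field_simp
      rw [h3]
      have h4 : a / y ≤ 1 := (div_le_one hy0).2 hy
      nlinarith
    nlinarith [mul_lt_mul_of_pos_left h1 ha]
  have hex : ∃ y, a ≤ y ∧ y - a + a * Real.log a - a * Real.log y = x := by
    have hcont : ContinuousOn (fun y => y - a + a * Real.log a - a * Real.log y)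
        (Set.Icc a (2 * (x + a))) := by
      refine ContinuousOn.sub (by fun_prop) (ContinuousOn.mul continuousOn_const ?_)
      exact Real.continuousOn_log.mono fun y hy => (ha.trans_le hy.1).ne'
    have hle : a ≤ 2 * (x + a) := by linarith
    have hmem : x ∈ Set.Icc (a - a + a * Real.log a - a * Real.log a)
        (2 * (x + a) - a + a * Real.log a - a * Real.log (2 * (x + a))) := by
      refine ⟨by linarith, ?_⟩
      have hq : 0 < (x + a) / a := by positivity
      have h1 := Real.log_le_sub_one_of_pos hq
      rw [Real.log_div (by positivity) ha.ne'] at h1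
      rw [Real.log_mul (by norm_num) (by positivity)]
      have h2 : a * ((x + a) / a - 1) = x := by field_simp; ring
      have h3 := mul_le_mul_of_nonneg_left h1 ha.le
      have h4 : Real.log 2 < 1 := by linarith [Real.log_two_lt_d9]
      nlinarith
    obtain ⟨y, hy, hyx⟩ := intermediate_value_Icc hle hcont hmem
    exact ⟨y, hy.1, hyx⟩
  obtain ⟨y, hy, hyx⟩ := hex
  refine ⟨y, ⟨hy, (key y hy).trans hyx⟩, ?_⟩
  rintro z ⟨hz, hzx⟩
  rw [key z hz] at hzx
  rcases lt_trichotomy z y with h | h | h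
  · linarith [hmono z y hz h]
  · exact h
  · linarith [hmono y z hy h]

theorem hatH_eq_iff {a x y : ℝ} (ha : 0 ≤ a) (hx : 0 ≤ x) :
    y = hatH a x ↔ y * chernoffH (a / y) = x ∧ a ≤ y := by
  obtain ⟨z, hz, huniq⟩ := existsUnique_hatH ha hx
  have hset : {y : ℝ | a ≤ y ∧ y * chernoffH (a / y) = x} = {z} :=
    Set.eq_singleton_iff_unique_mem.2 ⟨hz, huniq⟩
  rw [hatH, hset, csInf_singleton]
  exact ⟨fun h => h ▸ ⟨hz.2, hz.1⟩, fun h => huniq y ⟨h.2, h.1⟩⟩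

end

end Coverage

/-! Fix `t` and choose `r` by `n θ r^d = t L`, where `L = log n` if `β < ∞` and `L = k(n)` if `β =
∞`. A ball of radius `r` centred deep inside `A` has mass about `f θ r^d`, so it receives about `t f
L` sample points. At the boundary `A` looks like a half-space and the mean is halved. When the mean
is `b log n` with `b > β`, and `k ~ β log n`, the binomial lower tail is `P(Bin < k) = n^{-b H(β/b)
+ o(1)}`. What competes with it is the number of essentially disjoint balls: of order `r^{-d} =
n^{1+o(1)}` in the bulk and `r^{-(d-1)} = n^{1-1/d+o(1)}` along the boundary. Deficient balls
therefore vanish once `b H(β/b)` exceeds `1` in the bulk, where `b = t f₀`, and `1 - 1/d` at the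
boundary, where `b = t f₁/2`. Solving for `t` gives the two terms of the maximum. If `k ≫ log n`, a
deviation by a constant factor costs more than any power of `n`, and only the comparison of the mean
with `k` matters.

Coverage (`hasHeavyCovers`): every ball of radius `r` centred in `A` contains a slightly smaller
ball centred in a finite net. The net splits into a bulk part and a boundary part with the right
cardinalities and masses. The Chernoff bound `measureReal_countIn_lt_le` and a union bound give a
probability `O(n^{-γ})`, and monotonicity in `n` permits Borel–Cantelli along a geometric
subsequence.

Non-coverage (`hasLightBalls_of_essInfOn_lt`, `hasLightBalls_of_infBoundary_lt`): there are many
disjoint balls of small mass, found by differentiation of measures in the bulk and by flatness at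
the boundary. Counts in disjoint sets are negatively dependent (`measureReal_forall_le_countIn_le`),
so the probability that all these balls are full is at most a product of binomial tails. Stirling's
formula bounds the tails away from `1` well enough to make the product summable. -/

namespace Coverage

/-! ### Binomial tails and counts of sample points -/

/-- The upper tail `ℙ(Bin(n, p) ≥ k)` of the binomial distribution, by recursion on `n`. -/
noncomputable def binTail (p : ℝ) : ℕ → ℕ → ℝ
  | _, 0 => 1
  | 0, _ + 1 => 0
  | n + 1, k + 1 => p * binTail p n k + (1 - p) * binTail p n (k + 1)

@[simp] theorem binTail_zero_right (p : ℝ) (n : ℕ) : binTail p n 0 = 1 := by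
  cases n <;> rfl

@[simp] theorem binTail_zero_succ (p : ℝ) (k : ℕ) : binTail p 0 (k + 1) = 0 := rfl

theorem binTail_succ_succ (p : ℝ) (n k : ℕ) :
    binTail p (n + 1) (k + 1) = p * binTail p n k + (1 - p) * binTail p n (k + 1) := rfl

theorem binTail_succ (p : ℝ) (n k : ℕ) :
    binTail p (n + 1) k = p * binTail p n (k - 1) + (1 - p) * binTail p n k := by
  cases k with
  | zero => simp
  | succ k => rfl

theorem binTail_nonneg {p : ℝ} (h0 : 0 ≤ p) (h1 : p ≤ 1) (n k : ℕ) : 0 ≤ binTail p n k := by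
  induction n generalizing k with
  | zero => cases k <;> simp
  | succ n ih =>
    rw [binTail_succ]
    have := ih (k - 1)
    have := ih k
    have : 0 ≤ 1 - p := by linarith
    positivity

theorem binTail_succ_le {p : ℝ} (h0 : 0 ≤ p) (h1 : p ≤ 1) (n k : ℕ) :
    binTail p n (k + 1) ≤ binTail p n k := by
  induction n generalizing k with
  | zero => cases k <;> simp
  | succ n ih =>
    have h2 : 0 ≤ 1 - p := by linarith
    cases k with
    | zero =>
      have h3 := ih 0
      simp only [binTail_succ_succ, binTail_zero_right, zero_add] at h3 ⊢
      nlinarith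
    | succ k =>
      rw [binTail_succ_succ, binTail_succ_succ]
      exact add_le_add (mul_le_mul_of_nonneg_left (ih k) h0)
        (mul_le_mul_of_nonneg_left (ih (k + 1)) h2)

theorem binTail_antitone {p : ℝ} (h0 : 0 ≤ p) (h1 : p ≤ 1) (n : ℕ) : Antitone (binTail p n) :=
  antitone_nat_of_succ_le (binTail_succ_le h0 h1 n)

/-- The recursion is a weighted mean of two tails, and raising `p` shifts weight to the larger one.
This lets balls of different masses be compared with a single `p`. -/
theorem binTail_mono {p p' : ℝ} (h0 : 0 ≤ p) (hp : p ≤ p') (h1 : p' ≤ 1) (n k : ℕ) :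
    binTail p n k ≤ binTail p' n k := by
  induction n generalizing k with
  | zero => cases k <;> simp
  | succ n ih =>
    have h2 : binTail p n k ≤ binTail p n (k - 1) :=
      binTail_antitone h0 (hp.trans h1) n (Nat.sub_le k 1)
    rw [binTail_succ, binTail_succ]
    have h3 := ih k
    have h4 := ih (k - 1)
    nlinarith [mul_le_mul_of_nonneg_left h4 (h0.trans hp),
      mul_le_mul_of_nonneg_left h3 (sub_nonneg.2 h1),
      mul_le_mul_of_nonneg_left h2 (sub_nonneg.2 hp)]

/-- Chernoff bound for the upper tail. -/
theorem binTail_le_exp {p s : ℝ} (h0 : 0 ≤ p) (h1 : p ≤ 1) (hs : 1 ≤ s) (n k : ℕ) :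
    binTail p n k ≤ Real.exp (n * p * (s - 1)) * (s⁻¹) ^ k := by
  have hs0 : 0 < s := by linarith
  induction n generalizing k with
  | zero => cases k <;> simp; positivity
  | succ n ih =>
    cases k with
    | zero =>
      simp only [binTail_zero_right, pow_zero, mul_one]
      apply Real.one_le_exp
      have : 0 ≤ s - 1 := by linarith
      positivity
    | succ k =>
      rw [binTail_succ_succ]
      have h2 : 0 ≤ 1 - p := by linarith
      have h3 := mul_le_mul_of_nonneg_left (ih k) h0
      have h4 := mul_le_mul_of_nonneg_left (ih (k + 1)) h2
      -- Markov's inequality for `s ^ Bin`: each trial multiplies the bound by the generating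
      -- function `1 + p (s - 1)`.
      have h5 : 1 + p * (s - 1) ≤ Real.exp (p * (s - 1)) := by
        rw [add_comm]; exact Real.add_one_le_exp _
      have h6 : Real.exp ((n + 1 : ℕ) * p * (s - 1)) =
          Real.exp (n * p * (s - 1)) * Real.exp (p * (s - 1)) := by
        rw [← Real.exp_add]; push_cast; ring_nf
      rw [h6]
      calc _ ≤ _ := add_le_add h3 h4
        _ = Real.exp (n * p * (s - 1)) * (1 + p * (s - 1)) * (s⁻¹) ^ (k + 1) := by
          rw [pow_succ]; field_simp; ring
        _ ≤ _ := by gcongr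

/-- `P(Bin ≤ j) ≥ P(Bin = j)`, weakened by replacing `(1 - p)^(n - j)` with `(1 - p)^n`. The loss
`(1 - p)^j` is negligible for `p` of order `log n / n` and `j` of order `log n`, and Pascal's rule
then gives a clean induction. -/
theorem choose_mul_le_one_sub_binTail {p : ℝ} (h0 : 0 ≤ p) (h1 : p ≤ 1) (n j : ℕ) :
    n.choose j * p ^ j * (1 - p) ^ n ≤ 1 - binTail p n (j + 1) := by
  have h2 : 0 ≤ 1 - p := by linarith
  induction n generalizing j with
  | zero => cases j <;> simp
  | succ n ih =>
    rw [binTail_succ_succ]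
    cases j with
    | zero =>
      have h3 := mul_le_mul_of_nonneg_left (ih 0) h2
      simp only [Nat.choose_zero_right, Nat.cast_one, pow_zero, one_mul, zero_add,
        binTail_zero_right, mul_one] at h3 ⊢
      rw [pow_succ]
      linarith
    | succ j =>
      have h3 := mul_le_mul_of_nonneg_left (ih j) h0
      have h4 := mul_le_mul_of_nonneg_left (ih (j + 1)) h2
      have h5 : 0 ≤ p * (n.choose j * p ^ j * (1 - p) ^ n) := by positivity
      rw [Nat.choose_succ_succ]
      push_cast
      have h6 : ((n.choose j : ℝ) + n.choose (j + 1)) * p ^ (j + 1) * (1 - p) ^ (n + 1) =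
        (1 - p) * (p * (n.choose j * p ^ j * (1 - p) ^ n)) +
          (1 - p) * (n.choose (j + 1) * p ^ (j + 1) * (1 - p) ^ n) := by ring
      nlinarith [mul_nonneg h0 h5]

/-- The left side collects the terms of degree at most one in `x` from the expanded product; the
omitted terms are nonnegative. This is where negative dependence comes from: one sample point can
fall in at most one of several disjoint sets. -/
theorem prod_add_sum_erase_le {ι : Type*} [DecidableEq ι] (s : Finset ι) {a x : ι → ℝ}
    (ha : ∀ i, 0 ≤ a i) (hx : ∀ i, 0 ≤ x i) :
    ∏ i ∈ s, a i + ∑ j ∈ s, x j * ∏ i ∈ s.erase j, a i ≤ ∏ i ∈ s, (a i + x i) := by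
  induction s using Finset.induction_on with
  | empty => simp
  | insert k s hk ih =>
    rw [Finset.prod_insert hk, Finset.sum_insert hk, Finset.prod_insert hk,
      Finset.erase_insert hk]
    have h1 : ∀ j ∈ s, x j * ∏ i ∈ (insert k s).erase j, a i =
        a k * (x j * ∏ i ∈ s.erase j, a i) := by
      intro j hj
      have hjk : k ≠ j := fun h => hk (h ▸ hj)
      rw [Finset.erase_insert_of_ne hjk, Finset.prod_insert (fun h => hk (Finset.mem_of_mem_erase h))]
      ring
    rw [Finset.sum_congr rfl h1, ← Finset.mul_sum]
    have h2 : 0 ≤ ∑ j ∈ s, x j * ∏ i ∈ s.erase j, a i :=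
      Finset.sum_nonneg fun j _ => mul_nonneg (hx j) (Finset.prod_nonneg fun i _ => ha i)
    have h3 := mul_le_mul_of_nonneg_left ih (add_nonneg (ha k) (hx k))
    nlinarith [mul_nonneg (hx k) h2]

section Count

theorem countIn_eq_sum {E : Type*} (x : ℕ → E) (n : ℕ) (D : Set E) :
    countIn x n D = ∑ i ∈ Finset.range n, D.indicator (fun _ => 1) (x i) := by
  classical
  have h : {i : ℕ | i < n ∧ x i ∈ D} = ((Finset.range n).filter fun i => x i ∈ D : Finset ℕ) := by
    ext i; simp
  rw [countIn, h, Set.ncard_coe_finset, Finset.card_filter]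
  simp [Set.indicator_apply]

@[simp] theorem countIn_zero {E : Type*} (x : ℕ → E) (D : Set E) : countIn x 0 D = 0 := by
  simp [countIn_eq_sum]

theorem countIn_succ {E : Type*} (x : ℕ → E) (n : ℕ) (D : Set E) :
    countIn x (n + 1) D = countIn x n D + D.indicator (fun _ => 1) (x n) := by
  simp [countIn_eq_sum, Finset.sum_range_succ]

theorem countIn_mono {E : Type*} (x : ℕ → E) {m n : ℕ} (hmn : m ≤ n) {D D' : Set E}
    (hD : D ⊆ D') : countIn x m D ≤ countIn x n D' := by
  refine Set.ncard_le_ncard (fun i hi => ⟨hi.1.trans_le hmn, hD hi.2⟩) ?_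
  exact (Set.finite_lt_nat n).subset fun i hi => hi.1

variable {Ω E ι : Type*} [MeasurableSpace Ω] [MeasurableSpace E] {P : Measure Ω}
  {X : ℕ → Ω → E}

/-- The next point is independent of the counts among the preceding points. -/
theorem measureReal_mem_inter_countIn [Finite ι] (hXm : ∀ i, Measurable (X i))
    (hXind : iIndepFun X P) (n : ℕ) {D : ι → Set E} (hD : ∀ i, MeasurableSet (D i))
    {D' : Set E} (hD' : MeasurableSet D') (B : Set (ι → ℕ)) :
    P.real ({ω | X n ω ∈ D'} ∩ {ω | (fun i => countIn (fun l => X l ω) n (D i)) ∈ B}) =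
      P.real {ω | X n ω ∈ D'} *
        P.real {ω | (fun i => countIn (fun l => X l ω) n (D i)) ∈ B} := by
  have h := hXind.indepFun_finset {n} (Finset.range n) (by simp) hXm
  let F : (Finset.range n → E) → ι → ℕ := fun x i => ∑ l, (D i).indicator (fun _ => 1) (x l)
  have hF : Measurable F := by
    refine measurable_pi_iff.2 fun i => Finset.measurable_sum _ fun l _ => ?_
    exact (measurable_const.indicator (hD i)).comp (measurable_pi_apply l)
  -- Since `ι` is finite, `ι → ℕ` is countable and every `B` is measurable.
  have hB : MeasurableSet (F ⁻¹' B) := hF (Set.to_countable B).measurableSet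
  let G : (({n} : Finset ℕ) → E) → E := fun x => x ⟨n, by simp⟩
  have hG : Measurable G := measurable_pi_apply _
  have h1 := h.measure_inter_preimage_eq_mul _ _ (hG hD') hB
  have e1 : (fun ω (i : ({n} : Finset ℕ)) => X i ω) ⁻¹' (G ⁻¹' D') = {ω | X n ω ∈ D'} := rfl
  have e2 : (fun ω (i : Finset.range n) => X i ω) ⁻¹' (F ⁻¹' B) =
      {ω | (fun i => countIn (fun l => X l ω) n (D i)) ∈ B} := by
    ext ω
    have : (fun i => countIn (fun l => X l ω) n (D i)) = F fun i : Finset.range n => X i ω := by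
      ext i
      rw [countIn_eq_sum]
      exact (Finset.sum_coe_sort (Finset.range n)
        (fun l => (D i).indicator (fun _ => 1) (X l ω))).symm
    simp [this]
  rw [e1, e2] at h1
  simp only [measureReal_def, h1, ENNReal.toReal_mul]

theorem measureReal_mem_eq {μ : Measure E} (hXm : ∀ i, Measurable (X i))
    (hXlaw : ∀ i, P.map (X i) = μ) (n : ℕ) {D : Set E} (hD : MeasurableSet D) :
    P.real {ω | X n ω ∈ D} = μ.real D := by
  rw [← hXlaw n, map_measureReal_apply (hXm n) hD]; rfl

/-- Counts in disjoint sets are negatively dependent. -/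
theorem measureReal_forall_le_countIn_le [IsProbabilityMeasure P] [Fintype ι] {μ : Measure E}
    [IsProbabilityMeasure μ] (hXm : ∀ i, Measurable (X i))
    (hXind : iIndepFun X P) (hXlaw : ∀ i, P.map (X i) = μ) {D : ι → Set E}
    (hD : ∀ i, MeasurableSet (D i)) (hdisj : Pairwise (Function.onFun Disjoint D))
    (n : ℕ) (c : ι → ℕ) :
    P.real {ω | ∀ i, c i ≤ countIn (fun l => X l ω) n (D i)} ≤
      ∏ i, binTail (μ.real (D i)) n (c i) := by
  classical
  have hq : ∀ i n k, 0 ≤ binTail (μ.real (D i)) n k := fun i n k =>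
    binTail_nonneg measureReal_nonneg measureReal_le_one n k
  induction n generalizing c with
  | zero =>
    by_cases hc : ∀ i, c i = 0
    · simp only [hc, binTail_zero_right, Finset.prod_const_one]
      exact measureReal_le_one
    · push Not at hc
      obtain ⟨i, hi⟩ := hc
      have : {ω | ∀ i, c i ≤ countIn (fun l => X l ω) 0 (D i)} = ∅ := by
        ext ω
        simp only [countIn_zero, Set.mem_ofPred_eq, Set.mem_empty_iff_false, iff_false, not_forall]
        exact ⟨i, by omega⟩
      rw [this, measureReal_empty]
      exact Finset.prod_nonneg fun i _ => hq _ _ _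
  | succ n ih =>
    set p : ι → ℝ := fun i => μ.real (D i) with hp
    set Q : (ι → ℕ) → Set Ω := fun c => {ω | ∀ i, c i ≤ countIn (fun l => X l ω) n (D i)} with hQ
    -- Condition on the last point. By disjointness it serves at most one `D j`, whose requirement
    -- then drops by one; the truncated subtraction is right when `c j = 0`.
    have hsub : {ω | ∀ i, c i ≤ countIn (fun l => X l ω) (n + 1) (D i)} ⊆
        (⋃ j, {ω | X n ω ∈ D j} ∩ Q (Function.update c j (c j - 1))) ∪
          ({ω | X n ω ∈ (⋃ j, D j)ᶜ} ∩ Q c) := by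
      intro ω hω
      simp only [Set.mem_ofPred_eq, countIn_succ] at hω
      by_cases hj : ∃ j, X n ω ∈ D j
      · obtain ⟨j, hj⟩ := hj
        refine Or.inl (Set.mem_iUnion.2 ⟨j, hj, fun i => ?_⟩)
        rcases eq_or_ne i j with rfl | hij
        · have := hω i
          rw [Set.indicator_of_mem hj] at this
          simp only [Function.update_self]
          omega
        · have := hω i
          rw [Set.indicator_of_notMem (Set.disjoint_right.1 (hdisj hij) hj)] at this
          simpa [Function.update_of_ne hij] using this
      · push Not at hj
        refine Or.inr ⟨by simpa using hj, fun i => ?_⟩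
        have := hω i
        rwa [Set.indicator_of_notMem (hj i), add_zero] at this
    have hind : ∀ (D' : Set E), MeasurableSet D' → ∀ c, P.real ({ω | X n ω ∈ D'} ∩ Q c) =
        μ.real D' * P.real (Q c) := by
      intro D' hD' c
      rw [← measureReal_mem_eq hXm hXlaw n hD']
      exact measureReal_mem_inter_countIn hXm hXind n hD hD' {v | ∀ i, c i ≤ v i}
    have hU : μ.real (⋃ j, D j)ᶜ = 1 - ∑ j, p j := by
      rw [probReal_compl_eq_one_sub (MeasurableSet.iUnion hD)]
      congr 1
      exact measureReal_iUnion_fintype hdisj hD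
    have hU0 : 0 ≤ 1 - ∑ j, p j := hU ▸ measureReal_nonneg
    set a : ι → ℝ := fun i => binTail (p i) n (c i) with ha
    set b : ι → ℝ := fun i => binTail (p i) n (c i - 1) with hb
    have hab : ∀ i, a i ≤ b i := fun i =>
      binTail_antitone measureReal_nonneg measureReal_le_one n (Nat.sub_le _ _)
    have hprod : ∀ j, ∏ i, binTail (p i) n (Function.update c j (c j - 1) i) =
        b j * ∏ i ∈ Finset.univ.erase j, a i := by
      intro j
      rw [← Finset.mul_prod_erase _ _ (Finset.mem_univ j), Function.update_self]
      congr 1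
      refine Finset.prod_congr rfl fun i hi => ?_
      rw [Function.update_of_ne (Finset.ne_of_mem_erase hi)]
    calc P.real {ω | ∀ i, c i ≤ countIn (fun l => X l ω) (n + 1) (D i)}
        ≤ P.real (⋃ j, {ω | X n ω ∈ D j} ∩ Q (Function.update c j (c j - 1))) +
          P.real ({ω | X n ω ∈ (⋃ j, D j)ᶜ} ∩ Q c) :=
          (measureReal_mono hsub).trans (measureReal_union_le _ _)
      _ ≤ ∑ j, p j * (b j * ∏ i ∈ Finset.univ.erase j, a i) + (1 - ∑ j, p j) * ∏ i, a i := by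
          refine add_le_add ((measureReal_iUnion_fintype_le _).trans
            (Finset.sum_le_sum fun j _ => ?_)) ?_
          · rw [hind _ (hD j), ← hprod]
            exact mul_le_mul_of_nonneg_left (ih _) measureReal_nonneg
          · rw [hind _ (MeasurableSet.iUnion hD).compl, hU]
            exact mul_le_mul_of_nonneg_left (ih _) hU0
      _ = ∏ i, a i + ∑ j, p j * (b j - a j) * ∏ i ∈ Finset.univ.erase j, a i := by
          have : ∀ j, a j * ∏ i ∈ Finset.univ.erase j, a i = ∏ i, a i := fun j =>
            Finset.mul_prod_erase _ _ (Finset.mem_univ j)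
          have h2 : ∀ j, p j * (b j - a j) * ∏ i ∈ Finset.univ.erase j, a i =
              p j * (b j * ∏ i ∈ Finset.univ.erase j, a i) - p j * ∏ i, a i := by
            intro j; rw [← this j]; ring
          simp only [h2, Finset.sum_sub_distrib, ← Finset.sum_mul]
          ring
      -- With independent counts this product would be exact; a single point contributes only the
      -- terms of degree at most one.
      _ ≤ ∏ i, (a i + p i * (b i - a i)) :=
          prod_add_sum_erase_le _ (fun i => hq _ _ _)
            fun i => mul_nonneg measureReal_nonneg (sub_nonneg.2 (hab i))
      _ = ∏ i, binTail (p i) (n + 1) (c i) := by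
          refine Finset.prod_congr rfl fun i _ => ?_
          rw [binTail_succ]
          ring

/-- Chernoff bound for the lower tail of a count. -/
theorem measureReal_countIn_lt_le [IsProbabilityMeasure P] {μ : Measure E}
    [IsProbabilityMeasure μ] (hXm : ∀ i, Measurable (X i))
    (hXind : iIndepFun X P) (hXlaw : ∀ i, P.map (X i) = μ) {D : Set E}
    (hD : MeasurableSet D) {p s : ℝ} (hp : p ≤ μ.real D) (hs0 : 0 < s) (hs1 : s ≤ 1)
    (n k : ℕ) :
    P.real {ω | countIn (fun l => X l ω) n D < k} ≤
      Real.exp (-(n * p * (1 - s))) * (s⁻¹) ^ k := by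
  induction n generalizing k with
  | zero =>
    simp only [Nat.cast_zero, zero_mul, neg_zero, Real.exp_zero, one_mul]
    exact measureReal_le_one.trans (one_le_pow₀ ((one_le_inv₀ hs0).2 hs1))
  | succ n ih =>
    cases k with
    | zero => simp; positivity
    | succ k =>
      have hind : ∀ (D' : Set E), MeasurableSet D' → ∀ k : ℕ,
          P.real ({ω | X n ω ∈ D'} ∩ {ω | countIn (fun l => X l ω) n D < k}) =
          μ.real D' * P.real {ω | countIn (fun l => X l ω) n D < k} := by
        intro D' hD' k
        rw [← measureReal_mem_eq hXm hXlaw n hD']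
        exact measureReal_mem_inter_countIn (ι := Unit) hXm hXind n (fun _ => hD) hD'
          {v | v () < k}
      have hsub : {ω | countIn (fun l => X l ω) (n + 1) D < k + 1} ⊆
          ({ω | X n ω ∈ D} ∩ {ω | countIn (fun l => X l ω) n D < k}) ∪
          ({ω | X n ω ∈ Dᶜ} ∩ {ω | countIn (fun l => X l ω) n D < k + 1}) := by
        intro ω hω
        simp only [Set.mem_ofPred_eq, countIn_succ] at hω
        by_cases h : X n ω ∈ D
        · rw [Set.indicator_of_mem h] at hω
          exact Or.inl ⟨h, by simpa using hω⟩
        · rw [Set.indicator_of_notMem h] at hω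
          exact Or.inr ⟨h, by simpa using hω⟩
      have hc : μ.real Dᶜ = 1 - μ.real D := probReal_compl_eq_one_sub hD
      have hc0 : 0 ≤ 1 - μ.real D := hc ▸ measureReal_nonneg
      -- Markov's inequality for `s ^ count` with `s ≤ 1`: the new point contributes the factor `1 -
      -- μ(D) (1 - s) ≤ exp (-p (1 - s))`.
      calc _ ≤ μ.real D * (Real.exp (-(n * p * (1 - s))) * (s⁻¹) ^ k) +
            (1 - μ.real D) * (Real.exp (-(n * p * (1 - s))) * (s⁻¹) ^ (k + 1)) := by
            refine (measureReal_mono hsub).trans ((measureReal_union_le _ _).trans ?_)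
            rw [hind _ hD, hind _ hD.compl (k + 1), hc]
            exact add_le_add (mul_le_mul_of_nonneg_left (ih k) measureReal_nonneg)
              (mul_le_mul_of_nonneg_left (ih (k + 1)) hc0)
        _ = Real.exp (-(n * p * (1 - s))) * (1 - μ.real D * (1 - s)) * (s⁻¹) ^ (k + 1) := by
            rw [pow_succ]; field_simp; ring
        _ ≤ Real.exp (-(n * p * (1 - s))) * Real.exp (-(p * (1 - s))) * (s⁻¹) ^ (k + 1) := by
            have h1 := Real.add_one_le_exp (-(p * (1 - s)))
            have h2 := mul_le_mul_of_nonneg_right hp (sub_nonneg.2 hs1)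
            gcongr
            linarith
        _ = _ := by
            rw [← Real.exp_add]; push_cast; ring_nf

end Count

/-! ### Local shape of the set at its boundary -/

theorem subset_interior_or_subset_compl {T : Type*} [TopologicalSpace T] {S A : Set T}
    (hS : IsPreconnected S) (h : ∀ x ∈ S, x ∉ frontier A) : S ⊆ interior A ∨ S ⊆ Aᶜ := by
  have := hS.subset_or_subset (u := interior A) (v := (closure A)ᶜ) isOpen_interior
    isClosed_closure.isOpen_compl
    (Set.disjoint_left.2 fun x hx hx' => hx' (subset_closure (interior_subset hx)))
    (fun x hx => by
      by_contra hcon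
      simp only [Set.mem_union, Set.mem_compl_iff, not_or, not_not] at hcon
      exact h x hx ⟨hcon.2, hcon.1⟩)
  exact this.imp_right fun h' => h'.trans (Set.compl_subset_compl.2 subset_closure)

section Chart

/-- Near a boundary point, in suitable coordinates, a regular closed set `A` whose boundary is a
graph is the region on one side of the graph. -/
theorem exists_side_of_graph {E F : Type*} [NormedAddCommGroup E] [NormedSpace ℝ E]
    [NormedAddCommGroup F] [NormedSpace ℝ F] {A : Set E} {x₀ : E} (hA : IsClosed A)
    (hAreg : A ⊆ closure (interior A)) (hx₀ : x₀ ∈ frontier A) {U : Set E} (hU : U ∈ 𝓝 x₀)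
    (ρ : E ≃ₗᵢ[ℝ] WithLp 2 (F × ℝ)) {V : Set F} {g : F → ℝ} (hV : IsOpen V)
    (hg : ContDiffOn ℝ 2 g V)
    (hgraph : ρ '' (frontier A ∩ U) = {p | p.fst ∈ V ∧ p.snd = g p.fst}) :
    ∃ σ : ℝ, σ ≠ 0 ∧ ContDiffAt ℝ 2 g (ρ x₀).fst ∧
      (∀ᶠ u in 𝓝 (ρ x₀).fst, ρ.symm (WithLp.toLp 2 (u, g u)) ∈ frontier A) ∧
      ∀ᶠ z in 𝓝 x₀, (z ∈ frontier A → (ρ z).snd = g (ρ z).fst) ∧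
        (0 < σ * ((ρ z).snd - g (ρ z).fst) → z ∈ A) ∧
        (σ * ((ρ z).snd - g (ρ z).fst) < 0 → z ∉ A) := by
  set u₀ := (ρ x₀).fst with hu₀
  have hmem : ρ x₀ ∈ {p : WithLp 2 (F × ℝ) |
      p.fst ∈ V ∧ p.snd = g p.fst} := hgraph ▸ ⟨x₀, ⟨hx₀, mem_of_mem_nhds hU⟩, rfl⟩
  have hVu : V ∈ 𝓝 u₀ := hV.mem_nhds hmem.1
  have hgA : ContDiffAt ℝ 2 g u₀ := hg.contDiffAt hVu
  -- Straightening of the boundary: `Ψ (u, t)` is the graph point over `u` moved by `t` along the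
  -- last coordinate, so near `x₀` the frontier is `t = 0`.
  let Ψ : F × ℝ → E :=
    fun p => ρ.symm (WithLp.toLp 2 (p.1, g p.1 + p.2))
  have hΨc : ContinuousOn Ψ (V ×ˢ Set.univ) := by
    refine ρ.symm.continuous.comp_continuousOn
      ((WithLp.prod_continuous_toLp 2 _ _).comp_continuousOn ?_)
    exact continuousOn_fst.prodMk ((hg.continuousOn.comp continuousOn_fst fun p hp => hp.1).add
      continuousOn_snd)
  have hVn : V ×ˢ (Set.univ : Set ℝ) ∈ 𝓝 (u₀, (0 : ℝ)) := prod_mem_nhds hVu univ_mem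
  have hΨ0 : Ψ (u₀, 0) = x₀ := by
    have : WithLp.toLp 2 (u₀, g u₀ + 0) = ρ x₀ := by
      rw [add_zero, ← hmem.2]; rfl
    simp only [Ψ, this]
    simp
  have hΨat : Tendsto Ψ (𝓝 (u₀, 0)) (𝓝 x₀) := hΨ0 ▸ hΨc.continuousAt hVn
  obtain ⟨δ, hδ, hball⟩ := Metric.mem_nhds_iff.1 (inter_mem (hΨat hU) hVn)
  rw [← ball_prod_same] at hball
  have hfr : ∀ u ∈ Metric.ball u₀ δ, ∀ t ∈ Metric.ball (0 : ℝ) δ,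
      (Ψ (u, t) ∈ frontier A ↔ t = 0) := by
    intro u hu t ht
    have h1 := hball (Set.mk_mem_prod hu ht)
    constructor
    · intro h
      have : ρ (Ψ (u, t)) ∈ ρ '' (frontier A ∩ U) := ⟨_, ⟨h, h1.1⟩, rfl⟩
      rw [hgraph] at this
      simpa [Ψ] using this.2
    · rintro rfl
      have : WithLp.toLp 2 (u, g u + 0) ∈ {p : WithLp 2 (F × ℝ) |
        p.fst ∈ V ∧ p.snd = g p.fst} := ⟨h1.2.1, by simp⟩
      rw [← hgraph] at this
      obtain ⟨z, hz, hz'⟩ := this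
      simp only [Ψ, ← hz', LinearIsometryEquiv.symm_apply_apply]
      exact hz.1
  have hcoord : ∀ z, Ψ ((ρ z).fst, (ρ z).snd - g (ρ z).fst) = z := by
    intro z
    have : WithLp.toLp 2 ((ρ z).fst, g (ρ z).fst + ((ρ z).snd - g (ρ z).fst)) = ρ z := by
      rw [add_sub_cancel]; rfl
    simp only [Ψ, this]
    simp
  have hbox : ∀ᶠ z in 𝓝 x₀, (ρ z).fst ∈ Metric.ball u₀ δ ∧
      (ρ z).snd - g (ρ z).fst ∈ Metric.ball (0 : ℝ) δ := by
    have c1 : ContinuousAt (fun z => (ρ z).fst) x₀ :=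
      ((WithLp.continuous_fst 2 _ _).comp ρ.continuous).continuousAt
    have c2 : ContinuousAt (fun z => (ρ z).snd - g (ρ z).fst) x₀ := by
      refine ((WithLp.continuous_snd 2 _ _).comp ρ.continuous).continuousAt.sub ?_
      exact ContinuousAt.comp (f := fun z => (ρ z).fst) hgA.continuousAt c1
    have e2 : (ρ x₀).snd - g (ρ x₀).fst = 0 := by rw [hmem.2]; simp
    refine (c1.eventually_mem (Metric.ball_mem_nhds _ hδ)).and (c2.eventually_mem ?_)
    rw [e2]
    exact Metric.ball_mem_nhds _ hδ
  -- Each open half of the box has a connected image that avoids the frontier, so it lies entirely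
  -- inside or entirely outside `A`.
  have hside : ∀ I : Set ℝ, Convex ℝ I → I ⊆ Metric.ball 0 δ → (0 : ℝ) ∉ I →
      Ψ '' (Metric.ball u₀ δ ×ˢ I) ⊆ interior A ∨ Ψ '' (Metric.ball u₀ δ ×ˢ I) ⊆ Aᶜ := by
    intro I hI hIδ h0
    apply subset_interior_or_subset_compl
    · refine ((convex_ball u₀ δ).prod hI).isPreconnected.image _ (hΨc.mono fun p hp => ?_)
      exact (hball ⟨hp.1, hIδ hp.2⟩).2
    · rintro _ ⟨⟨u, t⟩, ⟨hu, ht⟩, rfl⟩ h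
      exact h0 (((hfr u hu t (hIδ ht)).1 h) ▸ ht)
  have hpos := hside (Set.Ioo 0 δ) (convex_Ioo _ _)
    (fun t ht => by rw [Metric.mem_ball, dist_zero_right, Real.norm_eq_abs, abs_lt]; constructor <;> linarith [ht.1, ht.2])
    (by simp)
  have hneg := hside (Set.Ioo (-δ) 0) (convex_Ioo _ _)
    (fun t ht => by rw [Metric.mem_ball, dist_zero_right, Real.norm_eq_abs, abs_lt]; constructor <;> linarith [ht.1, ht.2])
    (by simp)
  have hcases : ∀ z, (ρ z).fst ∈ Metric.ball u₀ δ →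
      (ρ z).snd - g (ρ z).fst ∈ Metric.ball (0 : ℝ) δ →
      (z ∈ frontier A ↔ (ρ z).snd - g (ρ z).fst = 0) ∧
      (0 < (ρ z).snd - g (ρ z).fst → z ∈ Ψ '' (Metric.ball u₀ δ ×ˢ Set.Ioo 0 δ)) ∧
      ((ρ z).snd - g (ρ z).fst < 0 → z ∈ Ψ '' (Metric.ball u₀ δ ×ˢ Set.Ioo (-δ) 0)) := by
    intro z h1 h2
    have h3 := hfr _ h1 _ h2
    rw [hcoord] at h3
    rw [Metric.mem_ball, dist_zero_right, Real.norm_eq_abs, abs_lt] at h2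
    exact ⟨h3, fun h => ⟨_, Set.mk_mem_prod h1 ⟨h, h2.2⟩, hcoord z⟩,
      fun h => ⟨_, Set.mk_mem_prod h1 ⟨h2.1, h⟩, hcoord z⟩⟩
  have hx₀A : x₀ ∈ A := hA.frontier_subset hx₀
  -- If both sides were in `A`, then `x₀` would be an interior point.
  have hnotboth : ¬ (Ψ '' (Metric.ball u₀ δ ×ˢ Set.Ioo 0 δ) ⊆ interior A ∧
      Ψ '' (Metric.ball u₀ δ ×ˢ Set.Ioo (-δ) 0) ⊆ interior A) := by
    rintro ⟨h1, h2⟩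
    apply hx₀.2
    rw [mem_interior_iff_mem_nhds]
    filter_upwards [hbox] with z hz
    obtain ⟨h3, h4, h5⟩ := hcases z hz.1 hz.2
    rcases lt_trichotomy ((ρ z).snd - g (ρ z).fst) 0 with h | h | h
    · exact interior_subset (h2 (h5 h))
    · exact hA.frontier_subset (h3.2 h)
    · exact interior_subset (h1 (h4 h))
  -- If neither side were in `A`, then near `x₀` the set would reduce to its frontier, although
  -- interior points accumulate at `x₀`.
  have hnotnone : ¬ (Ψ '' (Metric.ball u₀ δ ×ˢ Set.Ioo 0 δ) ⊆ Aᶜ ∧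
      Ψ '' (Metric.ball u₀ δ ×ˢ Set.Ioo (-δ) 0) ⊆ Aᶜ) := by
    rintro ⟨h1, h2⟩
    obtain ⟨z, hz, hzA⟩ := mem_closure_iff_nhds.1 (hAreg hx₀A) _ hbox
    obtain ⟨h3, h4, h5⟩ := hcases z hz.1 hz.2
    rcases lt_trichotomy ((ρ z).snd - g (ρ z).fst) 0 with h | h | h
    · exact h2 (h5 h) (interior_subset hzA)
    · exact (h3.2 h).2 hzA
    · exact h1 (h4 h) (interior_subset hzA)
  have hgr : ∀ᶠ u in 𝓝 u₀, ρ.symm (WithLp.toLp 2 (u, g u)) ∈ frontier A := by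
    filter_upwards [Metric.ball_mem_nhds u₀ hδ] with u hu
    have := (hfr u hu 0 (Metric.mem_ball_self hδ)).2 rfl
    simpa [Ψ] using this
  rcases hpos with hpos | hpos
  · rcases hneg with hneg | hneg
    · exact absurd ⟨hpos, hneg⟩ hnotboth
    refine ⟨1, one_ne_zero, hgA, hgr, ?_⟩
    filter_upwards [hbox] with z hz
    obtain ⟨h3, h4, h5⟩ := hcases z hz.1 hz.2
    exact ⟨fun h => sub_eq_zero.1 (h3.1 h), fun h => interior_subset (hpos (h4 (by simpa using h))),
      fun h => hneg (h5 (by simpa using h))⟩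
  · rcases hneg with hneg | hneg
    · refine ⟨-1, by norm_num, hgA, hgr, ?_⟩
      filter_upwards [hbox] with z hz
      obtain ⟨h3, h4, h5⟩ := hcases z hz.1 hz.2
      exact ⟨fun h => sub_eq_zero.1 (h3.1 h), fun h => interior_subset (hneg (h5 (by linarith))),
        fun h => hpos (h4 (by linarith))⟩
    · exact absurd ⟨hpos, hneg⟩ hnotnone

variable {d : ℕ} {A : Set (EuclideanSpace ℝ (Fin d))} {x₀ : EuclideanSpace ℝ (Fin d)}

/-- Near a boundary point, in suitable orthonormal coordinates, `A` is the region on one side of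
the graph of a `C²` function. -/
theorem exists_chart (hA : IsClosed A) (hAreg : A ⊆ closure (interior A))
    (hC2 : HasC2Boundary A) (hx₀ : x₀ ∈ frontier A) :
    ∃ (ρ : EuclideanSpace ℝ (Fin d) ≃ₗᵢ[ℝ] WithLp 2 (EuclideanSpace ℝ (Fin (d - 1)) × ℝ))
      (g : EuclideanSpace ℝ (Fin (d - 1)) → ℝ) (σ : ℝ), σ ≠ 0 ∧
      ContDiffAt ℝ 2 g (ρ x₀).fst ∧
      (∀ᶠ u in 𝓝 (ρ x₀).fst, ρ.symm (WithLp.toLp 2 (u, g u)) ∈ frontier A) ∧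
      ∀ᶠ z in 𝓝 x₀, (z ∈ frontier A → (ρ z).snd = g (ρ z).fst) ∧
        (0 < σ * ((ρ z).snd - g (ρ z).fst) → z ∈ A) ∧
        (σ * ((ρ z).snd - g (ρ z).fst) < 0 → z ∉ A) := by
  obtain ⟨U, hU, ρ, V, g, hV, hg, hgraph⟩ := hC2 x₀ hx₀
  exact ⟨ρ, g, exists_side_of_graph hA hAreg hx₀ hU ρ hV hg hgraph⟩

/-- Near a boundary point, `A` is close to a half-space: the cone `{w | η ‖w‖ < ℓ w}` with vertex
at a nearby point of `A` lies in `A`, and the opposite cone with vertex at a nearby boundary point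
lies outside `A`. -/
theorem exists_flat (hA : IsClosed A) (hAreg : A ⊆ closure (interior A))
    (hC2 : HasC2Boundary A) (hx₀ : x₀ ∈ frontier A) :
    ∃ ℓ : EuclideanSpace ℝ (Fin d) →L[ℝ] ℝ, ℓ ≠ 0 ∧ ∀ η : ℝ, 0 < η → ∃ δ > 0,
      ∀ y ∈ Metric.ball x₀ δ, ∀ z ∈ Metric.ball x₀ δ,
        (y ∈ A → η * ‖z - y‖ < ℓ (z - y) → z ∈ A) ∧
        (y ∈ frontier A → ℓ (z - y) < -(η * ‖z - y‖) → z ∉ A) := by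
  obtain ⟨ρ, g, σ, hσ, hg, -, hloc⟩ := exists_chart hA hAreg hC2 hx₀
  set u₀ := (ρ x₀).fst with hu₀
  set L := fderiv ℝ g u₀
  -- Strict differentiability controls `g` at pairs of points near `u₀`, so one functional `ℓ`
  -- serves all vertices `y` near `x₀`.
  have hstrict : HasStrictFDerivAt g L u₀ := hg.hasStrictFDerivAt (by norm_num)
  let ρc : EuclideanSpace ℝ (Fin d) →L[ℝ] WithLp 2 (EuclideanSpace ℝ (Fin (d - 1)) × ℝ) :=
    (ρ.toContinuousLinearEquiv : _ →L[ℝ] _)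
  -- The differential at `x₀` of `σ (snd - g ∘ fst)`, which points into `A`.
  let ℓ : EuclideanSpace ℝ (Fin d) →L[ℝ] ℝ :=
    σ • ((WithLp.sndL 2 ℝ _ _).comp ρc - (L.comp (WithLp.fstL 2 ℝ _ _)).comp ρc)
  have hℓ : ∀ w, ℓ w = σ * ((ρ w).snd - L (ρ w).fst) := fun w => rfl
  refine ⟨ℓ, fun h0 => hσ ?_, fun η hη => ?_⟩
  · have h1 := hℓ (ρ.symm (WithLp.toLp 2 (0, 1)))
    rw [h0] at h1
    simpa using h1.symm
  have hη' : 0 < η / |σ| := by positivity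
  have hlin := hstrict.isLittleO.def hη'
  have c1 : Tendsto (fun p : EuclideanSpace ℝ (Fin d) × EuclideanSpace ℝ (Fin d) =>
      ((ρ p.1).fst, (ρ p.2).fst)) (𝓝 (x₀, x₀)) (𝓝 (u₀, u₀)) := by
    have : Continuous (fun p : EuclideanSpace ℝ (Fin d) × EuclideanSpace ℝ (Fin d) =>
      ((ρ p.1).fst, (ρ p.2).fst)) := by
      have := (WithLp.continuous_fst 2 (EuclideanSpace ℝ (Fin (d - 1))) ℝ).comp ρ.continuous
      exact (this.comp continuous_fst).prodMk (this.comp continuous_snd)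
    exact this.tendsto _
  have hlin' := c1.eventually hlin
  have hloc1 : ∀ᶠ p : EuclideanSpace ℝ (Fin d) × EuclideanSpace ℝ (Fin d) in 𝓝 (x₀, x₀), _ :=
    (continuous_fst.tendsto (x₀, x₀)).eventually hloc
  have hloc2 : ∀ᶠ p : EuclideanSpace ℝ (Fin d) × EuclideanSpace ℝ (Fin d) in 𝓝 (x₀, x₀), _ :=
    (continuous_snd.tendsto (x₀, x₀)).eventually hloc
  obtain ⟨δ, hδ, hball⟩ := Metric.eventually_nhds_iff_ball.1 (hlin'.and (hloc1.and hloc2))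
  have key : ∀ y ∈ Metric.ball x₀ δ, ∀ z ∈ Metric.ball x₀ δ, y ∈ frontier A →
      (η * ‖z - y‖ < ℓ (z - y) → z ∈ A) ∧ (ℓ (z - y) < -(η * ‖z - y‖) → z ∉ A) := by
    intro y hy z hz hyf
    have h0 : (z, y) ∈ Metric.ball (x₀, x₀) δ := by
      rw [← ball_prod_same]; exact ⟨hz, hy⟩
    obtain ⟨h1, h2, h3⟩ := hball _ h0
    dsimp only at h1 h2 h3
    have hy1 := h3.1 hyf
    have h4 : |σ * (g (ρ z).fst - g (ρ y).fst - L ((ρ z).fst - (ρ y).fst))| ≤ η * ‖z - y‖ := by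
      rw [abs_mul]
      have h5 : ‖(ρ z).fst - (ρ y).fst‖ ≤ ‖z - y‖ := by
        have := WithLp.norm_fst_le _ (ρ (z - y))
        rwa [ρ.norm_map, map_sub, WithLp.sub_fst] at this
      have h6 := h1.trans (mul_le_mul_of_nonneg_left h5 hη'.le)
      rw [Real.norm_eq_abs] at h6
      calc _ ≤ |σ| * (η / |σ| * ‖z - y‖) := mul_le_mul_of_nonneg_left h6 (abs_nonneg _)
        _ = _ := by field_simp
    have h7 : ℓ (z - y) = σ * ((ρ z).snd - g (ρ z).fst) +
        σ * (g (ρ z).fst - g (ρ y).fst - L ((ρ z).fst - (ρ y).fst)) := by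
      rw [hℓ, map_sub, WithLp.sub_fst, WithLp.sub_snd, hy1]; ring
    have h8 := abs_le.1 h4
    exact ⟨fun h => h2.2.1 (by linarith), fun h => h2.2.2 (by linarith)⟩
  refine ⟨δ, hδ, fun y hy z hz => ⟨fun hyA hlt => ?_, fun hyf => (key y hy z hz hyf).2⟩⟩
  -- For a vertex `y ∈ A` off the frontier: if `z ∉ A`, the segment from `y` to `z` meets the
  -- frontier at some `w`. As `z - w` is a nonnegative multiple of `z - y`, the cone condition
  -- passes to `w`, to which `key` applies.
  by_contra hzA
  have hseg : ∃ w ∈ segment ℝ y z, w ∈ frontier A := by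
    by_contra hcon
    push Not at hcon
    rcases subset_interior_or_subset_compl (convex_segment y z).isPreconnected hcon with h | h
    · exact hzA (interior_subset (h (right_mem_segment ℝ y z)))
    · exact h (left_mem_segment ℝ y z) hyA
  obtain ⟨w, hw, hwf⟩ := hseg
  have hwb : w ∈ Metric.ball x₀ δ := (convex_ball x₀ δ).segment_subset hy hz hw
  obtain ⟨a, b, ha, hb, hab, rfl⟩ := hw
  have hzw : z - (a • y + b • z) = a • (z - y) := by
    have : b = 1 - a := by linarith
    rw [this, sub_smul, one_smul, smul_sub]; abel
  have ha0 : 0 < a := by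
    rcases ha.eq_or_lt with h | h
    · exfalso
      rw [← h, zero_smul ℝ (z - y), sub_eq_zero, h] at hzw
      exact hzA (hzw ▸ hA.frontier_subset hwf)
    · exact h
  apply hzA
  refine (key _ hwb z hz hwf).1 ?_
  rw [hzw, norm_smul, map_smul, smul_eq_mul, Real.norm_of_nonneg ha]
  nlinarith

end Chart

/-! ### Ball volumes and separated nets -/

theorem ballVol_pos (d : ℕ) : 0 < ballVol d := by
  unfold ballVol
  have : 0 < Real.Gamma (1 + (d : ℝ) / 2) := Real.Gamma_pos_of_pos (by positivity)
  positivity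

theorem volume_closedBall_eq {d : ℕ} (x : EuclideanSpace ℝ (Fin d)) {r : ℝ} (hr : 0 ≤ r) :
    volume (Metric.closedBall x r) = ENNReal.ofReal (ballVol d * r ^ d) := by
  have h : √Real.pi ^ d / Real.Gamma (d / 2 + 1) = ballVol d := by
    rw [ballVol, add_comm (1 : ℝ), Real.sqrt_eq_rpow, ← Real.rpow_natCast, ← Real.rpow_mul
      Real.pi_pos.le]
    congr 2
    ring
  -- Dimension `0` is included because the formula is also applied to the parameter space of
  -- dimension `d - 1`.
  rcases Nat.eq_zero_or_pos d with rfl | hd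
  · have e1 : Metric.closedBall x r = {x} := by
      ext y; simp [Subsingleton.elim y x, hr]
    have e2 : (volume : Measure (EuclideanSpace ℝ (Fin 0))) {x} = 1 := by
      rw [← (PiLp.volume_preserving_toLp (Fin 0)).measure_preimage
        (measurableSet_singleton _).nullMeasurableSet]
      have : (WithLp.toLp 2 : (Fin 0 → ℝ) → EuclideanSpace ℝ (Fin 0)) ⁻¹' {x} = Set.univ := by
        ext y; simp [Subsingleton.elim _ x]
      rw [this, volume_pi, Measure.pi_univ]
      simp
    rw [e1, e2]
    simp [ballVol, Real.Gamma_one]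
  · have : Nonempty (Fin d) := ⟨⟨0, hd⟩⟩
    rw [EuclideanSpace.volume_closedBall, Fintype.card_fin, h, ← ENNReal.ofReal_pow hr,
      ← ENNReal.ofReal_mul (by positivity), mul_comm]

theorem measureReal_closedBall_eq {d : ℕ} (x : EuclideanSpace ℝ (Fin d)) {r : ℝ} (hr : 0 ≤ r) :
    volume.real (Metric.closedBall x r) = ballVol d * r ^ d := by
  have := ballVol_pos d
  rw [measureReal_def, volume_closedBall_eq x hr, ENNReal.toReal_ofReal (by positivity)]

/-- A maximal `r`-separated subset of a bounded set. -/
theorem exists_separated_net {T : Type*} [MetricSpace T] [ProperSpace T] {S : Set T}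
    (hS : Bornology.IsBounded S) {r : ℝ} (hr : 0 < r) :
    ∃ N : Finset T, ↑N ⊆ S ∧ (∀ x ∈ N, ∀ y ∈ N, x ≠ y → r < dist x y) ∧
      ∀ x ∈ S, ∃ y ∈ N, dist x y ≤ r := by
  lift r to NNReal using hr.le
  have hr' : r / 2 ≠ 0 := by
    have : r ≠ 0 := by exact_mod_cast hr.ne'
    positivity
  obtain ⟨N₀, -, hfin, hcov⟩ := Metric.exists_finite_isCover_of_isCompact_closure hr'
    hS.isCompact_closure
  -- A packing at scale `r` is no larger than a cover at scale `r / 2`, which is finite because the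
  -- closure is compact.
  have hpack : Metric.packingNumber r S ≠ ⊤ := by
    have h1 := Metric.packingNumber_two_mul_le_externalCoveringNumber (r / 2) S
    rw [mul_div_cancel₀ _ two_ne_zero] at h1
    exact ((h1.trans hcov.externalCoveringNumber_le_encard).trans_lt
      (Set.encard_lt_top_iff.2 hfin)).ne
  have hNfin : (Metric.maximalSeparatedSet r S).Finite := by
    rw [← Set.encard_ne_top_iff, Metric.encard_maximalSeparatedSet hpack]
    exact hpack
  have hsep := Metric.isSeparated_maximalSeparatedSet (ε := r) (A := S)
  have hcov := Metric.isCover_maximalSeparatedSet hpack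
  refine ⟨hNfin.toFinset, by simpa using Metric.maximalSeparatedSet_subset, ?_, ?_⟩
  · intro x hx y hy hxy
    have h1 : (r : ℝ≥0∞) < edist x y := hsep (hNfin.mem_toFinset.1 hx) (hNfin.mem_toFinset.1 hy) hxy
    rw [edist_nndist] at h1
    rw [← coe_nndist]
    exact_mod_cast h1
  · intro x hx
    obtain ⟨y, hy, hxy⟩ := hcov hx
    refine ⟨y, hNfin.mem_toFinset.2 hy, ?_⟩
    have h1 : edist x y ≤ r := hxy
    rw [edist_nndist] at h1
    rw [← coe_nndist]
    exact_mod_cast h1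

/-- Volume packing: the balls of radius `r / 2` about the points are disjoint and lie in a ball of
radius `R + r / 2`. The constant `3` comes from `2 R + r ≤ 3 R`. -/
theorem card_mul_pow_le_of_separated {m : ℕ} {x₀ : EuclideanSpace ℝ (Fin m)} {R r : ℝ}
    (hr : 0 < r) (hrR : r ≤ R) {N : Finset (EuclideanSpace ℝ (Fin m))}
    (hN : ↑N ⊆ Metric.closedBall x₀ R) (hsep : ∀ x ∈ N, ∀ y ∈ N, x ≠ y → r < dist x y) :
    N.card * r ^ m ≤ (3 * R) ^ m := by
  have hsub : (⋃ x ∈ N, Metric.closedBall x (r / 2)) ⊆ Metric.closedBall x₀ (R + r / 2) := by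
    refine Set.iUnion₂_subset fun x hx => Metric.closedBall_subset_closedBall' ?_
    have := Metric.mem_closedBall.1 (hN hx)
    linarith
  have hdisj : (N : Set (EuclideanSpace ℝ (Fin m))).PairwiseDisjoint fun x => Metric.closedBall x (r / 2) := by
    intro x hx y hy hxy
    exact Metric.closedBall_disjoint_closedBall (by linarith [hsep x hx y hy hxy])
  have h1 := measureReal_mono (μ := volume) hsub (measure_closedBall_lt_top.ne)
  rw [measureReal_biUnion_finset hdisj (fun x _ => measurableSet_closedBall)
      (fun x _ => measure_closedBall_lt_top.ne),
    measureReal_closedBall_eq _ (by linarith)] at h1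
  simp only [measureReal_closedBall_eq _ (half_pos hr).le, Finset.sum_const, nsmul_eq_mul] at h1
  have h2 : (N.card : ℝ) * (r / 2) ^ m ≤ (R + r / 2) ^ m := by
    have := ballVol_pos m
    refine le_of_mul_le_mul_left ?_ this
    linarith
  calc N.card * r ^ m = 2 ^ m * (N.card * (r / 2) ^ m) := by rw [div_pow]; field_simp
    _ ≤ 2 ^ m * (R + r / 2) ^ m := by gcongr
    _ = (2 * R + r) ^ m := by rw [← mul_pow]; ring
    _ ≤ _ := by gcongr <;> linarith

/-- The balls about the net cover `S`. Read backwards, this bounds the cardinality of a net from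
below by the volume of `S`, which need not be measurable. -/
theorem measure_le_of_net {m : ℕ} {S : Set (EuclideanSpace ℝ (Fin m))} {r : ℝ} (hr : 0 ≤ r)
    {N : Finset (EuclideanSpace ℝ (Fin m))} (hN : ∀ x ∈ S, ∃ y ∈ N, dist x y ≤ r) :
    volume S ≤ ENNReal.ofReal (N.card * (ballVol m * r ^ m)) := by
  have hsub : S ⊆ ⋃ x ∈ N, Metric.closedBall x r := by
    intro x hx
    obtain ⟨y, hy, hxy⟩ := hN x hx
    exact Set.mem_biUnion hy (Metric.mem_closedBall.2 hxy)
  refine (measure_mono hsub).trans ((measure_biUnion_finset_le _ _).trans ?_)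
  simp only [volume_closedBall_eq _ hr, Finset.sum_const, nsmul_eq_mul]
  rw [ENNReal.ofReal_mul (Nat.cast_nonneg _), ENNReal.ofReal_natCast]

/-! ### Cones filling almost half of a ball -/

section Cone

variable {d : ℕ}

/-- The part of the ball `B(x, r)` inside the cone `{η ‖w‖ < ℓ w}` with vertex `x`. -/
def cone (ℓ : EuclideanSpace ℝ (Fin d) →L[ℝ] ℝ) (η : ℝ) (x : EuclideanSpace ℝ (Fin d)) (r : ℝ) :
    Set (EuclideanSpace ℝ (Fin d)) :=
  {z | z ∈ Metric.closedBall x r ∧ η * ‖z - x‖ < ℓ (z - x)}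

variable (ℓ : EuclideanSpace ℝ (Fin d) →L[ℝ] ℝ)

theorem measurableSet_cone (η : ℝ) (x : EuclideanSpace ℝ (Fin d)) (r : ℝ) :
    MeasurableSet (cone ℓ η x r) :=
  measurableSet_closedBall.inter (measurableSet_lt (f := fun z => η * ‖z - x‖)
    (g := fun z => ℓ (z - x)) (by fun_prop) (by fun_prop))

theorem cone_antitone {η η' : ℝ} (h : η ≤ η') (x : EuclideanSpace ℝ (Fin d)) (r : ℝ) :
    cone ℓ η' x r ⊆ cone ℓ η x r := fun _ hz =>
  ⟨hz.1, (mul_le_mul_of_nonneg_right h (norm_nonneg _)).trans_lt hz.2⟩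

theorem volume_cone (η : ℝ) (x : EuclideanSpace ℝ (Fin d)) {r : ℝ} (hr : 0 < r) :
    volume (cone ℓ η x r) = ENNReal.ofReal (r ^ d) * volume (cone ℓ η 0 1) := by
  have h : cone ℓ η x r = (fun z => z - x) ⁻¹' ((r⁻¹ • ·) ⁻¹' cone ℓ η 0 1) := by
    ext z
    have e1 : η * (r⁻¹ * ‖z - x‖) < r⁻¹ * (ℓ z - ℓ x) ↔ η * ‖z - x‖ < ℓ z - ℓ x := by
      rw [mul_left_comm]
      exact mul_lt_mul_iff_of_pos_left (by positivity)
    simp only [cone, Metric.mem_closedBall, dist_eq_norm, Set.preimage_ofPred_eq, sub_zero, norm_smul,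
      map_smul, smul_eq_mul, Real.norm_eq_abs, abs_inv, abs_of_pos hr, Set.mem_ofPred_eq, map_sub,
      e1, inv_mul_le_one₀ hr]
  rw [h]
  simp only [sub_eq_add_neg]
  rw [measure_preimage_add_right, Measure.addHaar_preimage_smul _ (inv_ne_zero hr.ne'),
    finrank_euclideanSpace_fin, inv_pow, inv_inv, abs_of_pos (by positivity)]

/-- As `η ↓ 0` the cones increase to an open half-ball, which has half the volume. Translation and
scaling carry the choice of `η` from the unit ball at `0` to all `x` and `r`. -/
theorem exists_le_volume_cone (hℓ : ℓ ≠ 0) {ε : ℝ} (hε : 0 < ε) (hε1 : ε < 1) :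
    ∃ η > 0, ∀ x : EuclideanSpace ℝ (Fin d), ∀ r > 0,
      (1 - ε) / 2 * (ballVol d * r ^ d) ≤ volume.real (cone ℓ η x r) := by
  have hθ := ballVol_pos d
  -- The ball consists of the half-ball, its reflection, and part of a hyperplane of measure zero.
  have hcover : Metric.closedBall (0 : EuclideanSpace ℝ (Fin d)) 1 ⊆
      cone ℓ 0 0 1 ∪ (fun z => -z) ⁻¹' cone ℓ 0 0 1 ∪ (LinearMap.ker ℓ.toLinearMap : Set _) := by
    intro z hz
    have hz' : ‖z‖ ≤ 1 := by simpa using hz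
    simp only [cone, Set.mem_union, Set.mem_ofPred_eq, Set.mem_preimage, sub_zero, zero_mul, map_neg,
      Metric.mem_closedBall, dist_zero_right, norm_neg, hz', true_and, SetLike.mem_coe,
      LinearMap.mem_ker, Left.neg_pos_iff]
    rcases lt_trichotomy (ℓ z) 0 with h | h | h
    · exact Or.inl (Or.inr h)
    · exact Or.inr h
    · exact Or.inl (Or.inl h)
  have hker : volume (LinearMap.ker ℓ.toLinearMap : Set (EuclideanSpace ℝ (Fin d))) = 0 := by
    refine Measure.addHaar_submodule _ _ fun h => hℓ ?_
    rw [LinearMap.ker_eq_top] at h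
    ext z
    exact congrArg (fun f => f z) h
  have hhalf : ENNReal.ofReal (ballVol d) ≤ 2 * volume (cone ℓ 0 0 1) := by
    have h1 := measure_mono (μ := volume) hcover
    rw [volume_closedBall_eq _ zero_le_one, one_pow, mul_one] at h1
    refine h1.trans ((measure_union_le _ _).trans ?_)
    rw [hker, add_zero]
    refine (measure_union_le _ _).trans ?_
    have : volume ((fun z => -z) ⁻¹' cone ℓ 0 0 1) = volume (cone ℓ 0 0 1) :=
      Measure.measure_preimage_neg _ _
    rw [this, two_mul]
  have hlt : ENNReal.ofReal ((1 - ε) / 2 * ballVol d) < volume (cone ℓ 0 0 1) := by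
    by_contra hcon
    push Not at hcon
    have h1 : ENNReal.ofReal (ballVol d) ≤ ENNReal.ofReal ((1 - ε) * ballVol d) := by
      refine hhalf.trans ((mul_le_mul_right hcon 2).trans (le_of_eq ?_))
      rw [← ENNReal.ofReal_ofNat 2, ← ENNReal.ofReal_mul (by norm_num)]
      congr 1; ring
    have h2 : 0 < 1 - ε := by linarith
    rw [ENNReal.ofReal_le_ofReal_iff (by positivity)] at h1
    nlinarith
  have hmono : Monotone fun n : ℕ => cone ℓ (1 / ((n : ℝ) + 1)) 0 1 := fun m n hmn =>
    cone_antitone ℓ (Nat.one_div_le_one_div hmn) 0 1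
  have hUnion : ⋃ n : ℕ, cone ℓ (1 / ((n : ℝ) + 1)) 0 1 = cone ℓ 0 0 1 := by
    refine Set.Subset.antisymm (Set.iUnion_subset fun n => cone_antitone ℓ (by positivity) 0 1) ?_
    rintro z ⟨hz, hz'⟩
    simp only [sub_zero, zero_mul] at hz'
    obtain ⟨n, hn⟩ := exists_nat_one_div_lt hz'
    refine Set.mem_iUnion.2 ⟨n, hz, ?_⟩
    have : ‖z‖ ≤ 1 := by simpa using hz
    rw [sub_zero]
    refine lt_of_le_of_lt (mul_le_of_le_one_right (by positivity) this) hn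
  have htend := tendsto_measure_iUnion_atTop (μ := volume) hmono
  rw [hUnion] at htend
  obtain ⟨n, hn⟩ := (htend.eventually (lt_mem_nhds hlt)).exists
  refine ⟨1 / ((n : ℝ) + 1), by positivity, fun x r hr => ?_⟩
  have hn' : (1 - ε) / 2 * ballVol d ≤ volume.real (cone ℓ (1 / ((n : ℝ) + 1)) 0 1) := by
    rw [measureReal_def, ← ENNReal.ofReal_le_iff_le_toReal]
    · exact hn.le
    · exact ((measure_mono fun z hz => hz.1).trans_lt
        (measure_closedBall_lt_top (x := (0 : EuclideanSpace ℝ (Fin d))) (r := 1))).ne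
  rw [measureReal_def, volume_cone ℓ _ x hr, ENNReal.toReal_mul,
    ENNReal.toReal_ofReal (by positivity)]
  have := mul_le_mul_of_nonneg_left hn' (pow_nonneg hr.le d)
  rw [measureReal_def] at this
  linarith

end Cone

/-! ### Masses from bounds on the density -/

section Density

variable {d : ℕ} {A : Set (EuclideanSpace ℝ (Fin d))} {f : EuclideanSpace ℝ (Fin d) → ℝ}
  {μ : Measure (EuclideanSpace ℝ (Fin d))}

/-- The density bound is only almost everywhere because `f₀` is an essential infimum. -/
theorem mul_volume_le_measure
    (hμ : μ = (volume.restrict A).withDensity fun x => ENNReal.ofReal (f x))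
    {D : Set (EuclideanSpace ℝ (Fin d))} (hD : MeasurableSet D) (hDA : D ⊆ A) {a : ℝ≥0∞}
    (h : ∀ᵐ x ∂volume.restrict A, x ∈ D → a ≤ ENNReal.ofReal (f x)) :
    a * volume D ≤ μ D := by
  rw [hμ, withDensity_apply _ hD]
  have h1 : ∀ᵐ x ∂(volume.restrict A).restrict D, a ≤ ENNReal.ofReal (f x) :=
    (ae_restrict_iff' hD).2 h
  calc a * volume D = ∫⁻ _ in D, a ∂volume.restrict A := by
        rw [setLIntegral_const, Measure.restrict_apply hD, Set.inter_eq_left.2 hDA]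
    _ ≤ _ := lintegral_mono_ae h1

/-- The volume of `D ∩ A`, not of `D`, is kept: at the boundary it supplies the factor `1/2`. -/
theorem measure_le_mul_volume (hA : MeasurableSet A)
    (hμ : μ = (volume.restrict A).withDensity fun x => ENNReal.ofReal (f x))
    {D : Set (EuclideanSpace ℝ (Fin d))} (hD : MeasurableSet D) {a : ℝ}
    (h : ∀ x ∈ D, x ∈ A → f x ≤ a) :
    μ D ≤ ENNReal.ofReal a * volume (D ∩ A) := by
  rw [hμ, withDensity_apply _ hD, Measure.restrict_restrict hD, ← setLIntegral_const]
  exact setLIntegral_mono' (hD.inter hA) fun x hx => ENNReal.ofReal_le_ofReal (h x hx.1 hx.2)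

end Density

/-! ### Disjoint balls of small mass -/

/-- For small `r`, the set `A` contains the centres of `c r⁻ᵐ` disjoint balls of radius `r` of
`μ`-measure at most `a` times their volume. -/
def HasLightBalls {d : ℕ} (μ : Measure (EuclideanSpace ℝ (Fin d)))
    (A : Set (EuclideanSpace ℝ (Fin d))) (a : ℝ) (m : ℕ) : Prop :=
  ∃ c > 0, ∃ r₀ > 0, ∀ r : ℝ, 0 < r → r < r₀ →
    ∃ T : Finset (EuclideanSpace ℝ (Fin d)), ↑T ⊆ A ∧ c ≤ T.card * r ^ m ∧
      (∀ x ∈ T, ∀ y ∈ T, x ≠ y → Disjoint (Metric.closedBall x r) (Metric.closedBall y r)) ∧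
      ∀ x ∈ T, μ.real (Metric.closedBall x r) ≤ a * (ballVol d * r ^ d)

section LightBalls

variable {d : ℕ} {A : Set (EuclideanSpace ℝ (Fin d))} {f : EuclideanSpace ℝ (Fin d) → ℝ}
  {μ : Measure (EuclideanSpace ℝ (Fin d))}

/-- Besicovitch differentiation for closed balls, applied to the density extended by zero outside
`A`. -/
theorem ae_tendsto_measure_div [IsProbabilityMeasure μ] (hA : MeasurableSet A)
    (hfm : Measurable f)
    (hμ : μ = (volume.restrict A).withDensity fun x => ENNReal.ofReal (f x)) :
    ∀ᵐ x ∂(volume : Measure (EuclideanSpace ℝ (Fin d))), x ∈ A →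
      Tendsto (fun r => μ (Metric.closedBall x r) / volume (Metric.closedBall x r)) (𝓝[>] 0)
        (𝓝 (ENNReal.ofReal (f x))) := by
  have h1 := Besicovitch.ae_tendsto_rnDeriv μ (volume : Measure (EuclideanSpace ℝ (Fin d)))
  have hμ' : μ = volume.withDensity (A.indicator fun x => ENNReal.ofReal (f x)) := by
    rw [hμ, withDensity_indicator hA]
  have h2 : μ.rnDeriv volume =ᵐ[volume] A.indicator fun x => ENNReal.ofReal (f x) := by
    rw [hμ']
    exact Measure.rnDeriv_withDensity _ (hfm.ennreal_ofReal.indicator hA)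
  filter_upwards [h1, h2] with x hx1 hx2 hxA
  rwa [hx2, Set.indicator_of_mem hxA] at hx1

/-- At almost every point of `A` with `f < a`, small balls have mass at most `a θ r^d`, but how
small depends on the point. The sets `G n`, on which radii below `1/(n+1)` work, exhaust these
points up to a null set. Hence some `G n` has positive volume, and a `2r`-separated net in it has of
order `r^{-d}` points. -/
theorem hasLightBalls_of_essInfOn_lt [IsProbabilityMeasure μ] (hA : IsCompact A)
    (hfm : Measurable f)
    (hμ : μ = (volume.restrict A).withDensity fun x => ENNReal.ofReal (f x)) {a : ℝ}
    (ha : essInfOn f A < ENNReal.ofReal a) : HasLightBalls μ A a d := by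
  have ha0 : 0 < a := ENNReal.ofReal_pos.1 (ha.trans_le' zero_le)
  have hθ := ballVol_pos d
  set G : ℕ → Set (EuclideanSpace ℝ (Fin d)) := fun n => {x | x ∈ A ∧ ∀ r : ℝ, 0 < r →
    r < 1 / ((n : ℝ) + 1) → μ (Metric.closedBall x r) ≤ ENNReal.ofReal (a * (ballVol d * r ^ d))}
    with hG
  have hex : ∃ n, volume (G n) ≠ 0 := by
    by_contra hcon
    push Not at hcon
    have h0 : volume (⋃ n, G n) = 0 := measure_iUnion_null hcon
    refine absurd ha (not_lt.2 ?_)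
    refine le_essInf_of_ae_le _ ?_
    have hG0 : ∀ᵐ x ∂(volume : Measure (EuclideanSpace ℝ (Fin d))), x ∉ ⋃ n, G n :=
      measure_eq_zero_iff_ae_notMem.1 h0
    refine (ae_restrict_iff' hA.measurableSet).2 ?_
    filter_upwards [hG0, ae_tendsto_measure_div hA.measurableSet hfm hμ] with x hx1 hx2 hxA
    by_contra hlt
    push Not at hlt
    have h3 := (hx2 hxA).eventually (gt_mem_nhds hlt)
    rw [eventually_nhdsWithin_iff, Metric.eventually_nhds_iff] at h3
    obtain ⟨δ, hδ, h3⟩ := h3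
    obtain ⟨n, hn⟩ := exists_nat_one_div_lt hδ
    refine hx1 (Set.mem_iUnion.2 ⟨n, hxA, fun r hr hrn => ?_⟩)
    have h4 := h3 (y := r) (by rw [dist_zero_right, Real.norm_of_nonneg hr.le]; linarith) hr
    rw [volume_closedBall_eq x hr.le] at h4
    rw [ENNReal.ofReal_mul ha0.le]
    refine (ENNReal.div_le_iff ?_ ENNReal.ofReal_ne_top).1 h4.le
    exact (ENNReal.ofReal_pos.2 (by positivity)).ne'
  obtain ⟨n, hn⟩ := hex
  have hGA : G n ⊆ A := fun x hx => hx.1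
  have hfin : volume (G n) ≠ ⊤ := ((measure_mono hGA).trans_lt hA.measure_lt_top).ne
  have hpos : 0 < volume.real (G n) := ENNReal.toReal_pos hn hfin
  -- The constant comes from covering `G n` by balls of radius `2 r` about the net.
  refine ⟨volume.real (G n) / (ballVol d * 2 ^ d), by positivity, 1 / ((n : ℝ) + 1), by positivity,
    fun r hr hrn => ?_⟩
  obtain ⟨T, hTG, hsep, hcov⟩ := exists_separated_net (hA.isBounded.subset hGA)
    (by positivity : 0 < 2 * r)
  refine ⟨T, hTG.trans hGA, ?_, fun x hx y hy hxy => ?_, fun x hx => ?_⟩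
  · have h1 := measure_le_of_net (by positivity) hcov
    have h2 := ENNReal.toReal_le_of_le_ofReal (by positivity) h1
    rw [div_le_iff₀ (by positivity)]
    rw [mul_pow] at h2
    calc _ ≤ _ := h2
      _ = _ := by ring
  · exact Metric.closedBall_disjoint_closedBall (by linarith [hsep x hx y hy hxy])
  · exact ENNReal.toReal_le_of_le_ofReal (by positivity) ((hTG hx).2 r hr hrn)

theorem dist_fst_le_dist {F : Type*} [NormedAddCommGroup F] [NormedSpace ℝ F]
    (ρ : EuclideanSpace ℝ (Fin d) ≃ₗᵢ[ℝ] WithLp 2 (F × ℝ)) (y z : EuclideanSpace ℝ (Fin d)) :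
    dist (ρ y).fst (ρ z).fst ≤ dist y z := by
  have := WithLp.norm_fst_le _ (ρ (y - z))
  rwa [ρ.norm_map, map_sub, WithLp.sub_fst, ← dist_eq_norm, ← dist_eq_norm] at this

theorem exists_ball_forall_le {x₀ : EuclideanSpace ℝ (Fin d)}
    (hfc : ContinuousWithinAt f A x₀) {a : ℝ} :
    (f x₀ < a → ∃ δ > 0, ∀ z ∈ Metric.ball x₀ δ, z ∈ A → f z ≤ a) ∧
    (a < f x₀ → ∃ δ > 0, ∀ z ∈ Metric.ball x₀ δ, z ∈ A → a ≤ f z) := by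
  constructor <;> intro h
  · have := hfc.eventually (gt_mem_nhds h)
    obtain ⟨δ, hδ, h1⟩ := Metric.eventually_nhds_iff_ball.1 (eventually_nhdsWithin_iff.1 this)
    exact ⟨δ, hδ, fun z hz hzA => (h1 z hz hzA).le⟩
  · have := hfc.eventually (lt_mem_nhds h)
    obtain ⟨δ, hδ, h1⟩ := Metric.eventually_nhds_iff_ball.1 (eventually_nhdsWithin_iff.1 this)
    exact ⟨δ, hδ, fun z hz hzA => (h1 z hz hzA).le⟩

/-- Many separated boundary points near a given boundary point. -/
theorem exists_separated_frontier (hA : IsClosed A) (hAreg : A ⊆ closure (interior A))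
    (hC2 : HasC2Boundary A) {x₀ : EuclideanSpace ℝ (Fin d)} (hx₀ : x₀ ∈ frontier A)
    {δ : ℝ} (hδ : 0 < δ) :
    ∃ c > 0, ∀ r : ℝ, 0 < r → ∃ T : Finset (EuclideanSpace ℝ (Fin d)),
      ↑T ⊆ frontier A ∩ Metric.ball x₀ δ ∧ c ≤ T.card * r ^ (d - 1) ∧
      ∀ x ∈ T, ∀ y ∈ T, x ≠ y → 2 * r < dist x y := by
  classical
  obtain ⟨ρ, g, σ, hσ, hg, hfr, hloc⟩ := exists_chart hA hAreg hC2 hx₀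
  set u₀ := (ρ x₀).fst with hu₀
  -- A separated set in the parameter ball is lifted to the graph. The projection back does not
  -- increase distances, so the lifted points stay separated.
  let Φ : EuclideanSpace ℝ (Fin (d - 1)) → EuclideanSpace ℝ (Fin d) :=
    fun u => ρ.symm (WithLp.toLp 2 (u, g u))
  have hfst : ∀ u, (ρ (Φ u)).fst = u := fun u => by simp [Φ]
  have hΦ0 : Φ u₀ = x₀ := by
    have h1 := hloc.self_of_nhds.1 hx₀
    have : WithLp.toLp 2 (u₀, g u₀) = ρ x₀ := by rw [← h1]; rfl
    simp only [Φ, this]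
    simp
  have hΦc : ContinuousAt Φ u₀ := by
    refine ρ.symm.continuous.continuousAt.comp
      ((WithLp.prod_continuous_toLp 2 _ _).continuousAt.comp ?_)
    exact continuousAt_id.prodMk hg.continuousAt
  have hball : ∀ᶠ u in 𝓝 u₀, Φ u ∈ Metric.ball x₀ δ :=
    hΦc.eventually_mem (hΦ0.symm ▸ Metric.ball_mem_nhds x₀ hδ)
  obtain ⟨R, hR, hRsub⟩ := Metric.nhds_basis_closedBall.eventually_iff.1 (hfr.and hball)
  refine ⟨(R / 2) ^ (d - 1), by positivity, fun r hr => ?_⟩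
  obtain ⟨N, hNS, hsep, hcov⟩ := exists_separated_net
    (Metric.isBounded_closedBall (x := u₀) (r := R)) (by positivity : 0 < 2 * r)
  have hinj : Function.Injective Φ := fun u u' h => by rw [← hfst u, h, hfst]
  refine ⟨N.image Φ, ?_, ?_, ?_⟩
  · rintro _ hz
    obtain ⟨u, hu, rfl⟩ := Finset.mem_image.1 hz
    exact hRsub (hNS hu)
  · rw [Finset.card_image_of_injective _ hinj]
    have h1 := measure_le_of_net (by positivity) hcov
    have h2 := ENNReal.toReal_le_of_le_ofReal (by have := ballVol_pos (d - 1); positivity) h1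
    rw [← measureReal_def, measureReal_closedBall_eq _ hR.le] at h2
    have hθ := ballVol_pos (d - 1)
    have h3 : R ^ (d - 1) ≤ N.card * (2 * r) ^ (d - 1) := by
      refine le_of_mul_le_mul_left ?_ hθ
      linarith
    rw [div_pow, div_le_iff₀ (by positivity)]
    rw [mul_pow] at h3
    linarith
  · intro x hx y hy hxy
    obtain ⟨u, hu, rfl⟩ := Finset.mem_image.1 hx
    obtain ⟨v, hv, rfl⟩ := Finset.mem_image.1 hy
    refine (hsep u hu v hv fun h => hxy (h ▸ rfl)).trans_le ?_
    have := dist_fst_le_dist ρ (Φ u) (Φ v)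
    rwa [hfst, hfst] at this

/-- Near a boundary point with `f x₀ < a`, continuity bounds `f` on `A`, and a ball centred on the
frontier loses the outward cone, almost half its volume. The frontier supplies of order `r^{-(d-1)}`
disjoint balls of this kind. -/
theorem hasLightBalls_of_infBoundary_lt [IsProbabilityMeasure μ] (hA : IsCompact A)
    (hAreg : A ⊆ closure (interior A)) (hC2 : HasC2Boundary A)
    (hf0 : ∀ x ∈ A, 0 ≤ f x) (hfc : ∀ x ∈ frontier A, ContinuousWithinAt f A x)
    (hμ : μ = (volume.restrict A).withDensity fun x => ENNReal.ofReal (f x)) {a : ℝ}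
    (ha : infBoundary f A < ENNReal.ofReal a) : HasLightBalls μ A (a / 2) (d - 1) := by
  have ha0 : 0 < a := ENNReal.ofReal_pos.1 (ha.trans_le' zero_le)
  have hθ := ballVol_pos d
  simp only [infBoundary, iInf_lt_iff] at ha
  obtain ⟨x₀, hx₀, hfx⟩ := ha
  have hfx : f x₀ < a := (ENNReal.ofReal_lt_ofReal_iff ha0).1 hfx
  have hfx0 := hf0 x₀ (hA.isClosed.frontier_subset hx₀)
  obtain ⟨a', ha'1, ha'2⟩ := exists_between hfx
  have ha'0 : 0 < a' := hfx0.trans_lt ha'1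
  -- The gap between `a'` and `a` absorbs the factor `1 + ε` left by a cone slightly smaller than a
  -- half-ball.
  set ε := min (1 / 2) ((a - a') / a') with hε
  have hε0 : 0 < ε := lt_min (by norm_num) (div_pos (by linarith) ha'0)
  have hε1 : ε < 1 := (min_le_left _ _).trans_lt (by norm_num)
  have hεa : a' * (1 + ε) ≤ a := by
    have : ε ≤ (a - a') / a' := min_le_right _ _
    rw [le_div_iff₀ ha'0] at this
    linarith
  obtain ⟨ℓ, hℓ, hflat⟩ := exists_flat hA.isClosed hAreg hC2 hx₀
  obtain ⟨η, hη, hcone⟩ := exists_le_volume_cone (-ℓ) (neg_ne_zero.2 hℓ) hε0 hε1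
  obtain ⟨δ₁, hδ₁, hflat⟩ := hflat η hη
  obtain ⟨δ₂, hδ₂, hf⟩ := (exists_ball_forall_le (hfc x₀ hx₀)).1 ha'1
  set δ := min δ₁ δ₂ with hδ
  have hδ0 : 0 < δ := lt_min hδ₁ hδ₂
  obtain ⟨c, hc, hsepf⟩ := exists_separated_frontier hA.isClosed hAreg hC2 hx₀ (half_pos hδ0)
  refine ⟨c, hc, δ / 2, half_pos hδ0, fun r hr hrδ => ?_⟩
  obtain ⟨T, hT, hcard, hsep⟩ := hsepf r hr
  refine ⟨T, fun x hx => hA.isClosed.frontier_subset (hT hx).1, hcard, fun x hx y hy hxy =>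
    Metric.closedBall_disjoint_closedBall (by linarith [hsep x hx y hy hxy]), fun y hy => ?_⟩
  have hyf := (hT hy).1
  have hyb : dist y x₀ < δ / 2 := (hT hy).2
  have hsub : Metric.closedBall y r ⊆ Metric.ball x₀ δ := fun z hz => by
    have h1 := Metric.mem_closedBall.1 hz
    have h2 := dist_triangle z y x₀
    exact Metric.mem_ball.2 (by linarith)
  have hyδ : y ∈ Metric.ball x₀ δ := hsub (Metric.mem_closedBall_self hr.le)
  have hd1 : Metric.ball x₀ δ ⊆ Metric.ball x₀ δ₁ := Metric.ball_subset_ball (min_le_left _ _)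
  have hd2 : Metric.ball x₀ δ ⊆ Metric.ball x₀ δ₂ := Metric.ball_subset_ball (min_le_right _ _)
  have hin : Metric.closedBall y r ∩ A ⊆ Metric.closedBall y r \ cone (-ℓ) η y r := by
    rintro z ⟨hz, hzA⟩
    refine ⟨hz, fun hzc => ?_⟩
    refine (hflat y (hd1 hyδ) z (hd1 (hsub hz))).2 hyf ?_ hzA
    have := hzc.2
    rw [neg_apply] at this
    linarith
  have hvol : volume (Metric.closedBall y r ∩ A) ≤
      ENNReal.ofReal ((1 + ε) / 2 * (ballVol d * r ^ d)) := by
    refine (measure_mono hin).trans ?_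
    rw [← ENNReal.toReal_le_toReal (measure_ne_top_of_subset Set.sdiff_subset
      measure_closedBall_lt_top.ne) ENNReal.ofReal_ne_top, ENNReal.toReal_ofReal (by positivity),
      ← measureReal_def, measureReal_sdiff (fun z hz => hz.1) (measurableSet_cone _ _ _ _)
      measure_closedBall_lt_top.ne, measureReal_closedBall_eq _ hr.le]
    have := hcone y r hr
    linarith
  have hm := measure_le_mul_volume hA.measurableSet hμ (measurableSet_closedBall (x := y) (ε := r))
    (a := a') fun z hz hzA => hf z (hd2 (hsub hz)) hzA
  refine ENNReal.toReal_le_of_le_ofReal (by positivity) (hm.trans ?_)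
  refine (mul_le_mul_right hvol _).trans ?_
  rw [← ENNReal.ofReal_mul ha'0.le]
  refine ENNReal.ofReal_le_ofReal ?_
  have : 0 ≤ ballVol d * r ^ d := by positivity
  nlinarith

end LightBalls

/-! ### Nets of balls of large mass -/

/-- For small `r`, all balls of radius `r` centred in `A` contain one of `O(r⁻ᵈ)` balls of mass
at least `a₀ θ rᵈ` or one of `O(r^{-(d-1)})` balls of mass at least `a₁ θ rᵈ`. -/
def HasHeavyCovers {d : ℕ} (μ : Measure (EuclideanSpace ℝ (Fin d)))
    (A : Set (EuclideanSpace ℝ (Fin d))) (a₀ a₁ : ℝ) : Prop :=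
  ∃ C > 0, ∃ r₀ > 0, ∀ r : ℝ, 0 < r → r < r₀ →
    ∃ (s : ℝ) (T₀ T₁ : Finset (EuclideanSpace ℝ (Fin d))),
      T₀.card * r ^ d ≤ C ∧ T₁.card * r ^ (d - 1) ≤ C ∧
      (∀ x ∈ T₀, a₀ * (ballVol d * r ^ d) ≤ μ.real (Metric.closedBall x s)) ∧
      (∀ x ∈ T₁, a₁ * (ballVol d * r ^ d) ≤ μ.real (Metric.closedBall x s)) ∧
      ∀ y ∈ A, ∃ x, (x ∈ T₀ ∨ x ∈ T₁) ∧ Metric.closedBall x s ⊆ Metric.closedBall y r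

section Upper

variable {d : ℕ} {A : Set (EuclideanSpace ℝ (Fin d))} {f : EuclideanSpace ℝ (Fin d) → ℝ}
  {μ : Measure (EuclideanSpace ℝ (Fin d))}

/-- Small balls centred in `A` near the boundary have mass at least about half of
`a` times their volume. -/
theorem exists_le_measureReal_closedBall_near_frontier [IsProbabilityMeasure μ] (hA : IsCompact A)
    (hAreg : A ⊆ closure (interior A)) (hC2 : HasC2Boundary A)
    (hfc : ∀ x ∈ frontier A, ContinuousWithinAt f A x)
    (hμ : μ = (volume.restrict A).withDensity fun x => ENNReal.ofReal (f x)) {a ε : ℝ}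
    (ha0 : 0 < a) (ha : ∀ x ∈ frontier A, a < f x) (hε : 0 < ε) (hε1 : ε < 1) :
    ∃ r₁ > 0, ∀ x ∈ A, ∀ y ∈ frontier A, dist x y < r₁ → ∀ r : ℝ, 0 < r → r < r₁ →
      a * ((1 - ε) / 2 * (ballVol d * r ^ d)) ≤ μ.real (Metric.closedBall x r) := by
  have hcomp : IsCompact (frontier A) := hA.of_isClosed_subset isClosed_frontier
    hA.isClosed.frontier_subset
  -- The property passes to subsets and finite unions, so by compactness it suffices to treat a
  -- neighbourhood of each boundary point.
  refine hcomp.induction_on (p := fun S => ∃ r₁ > 0, ∀ x ∈ A, ∀ y ∈ S, dist x y < r₁ →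
    ∀ r : ℝ, 0 < r → r < r₁ →
      a * ((1 - ε) / 2 * (ballVol d * r ^ d)) ≤ μ.real (Metric.closedBall x r)) ?_ ?_ ?_ ?_
  · exact ⟨1, one_pos, by simp⟩
  · rintro S S' hSS ⟨r₁, hr₁, h⟩
    exact ⟨r₁, hr₁, fun x hx y hy => h x hx y (hSS hy)⟩
  · rintro S S' ⟨r₁, hr₁, h⟩ ⟨r₂, hr₂, h'⟩
    refine ⟨min r₁ r₂, lt_min hr₁ hr₂, ?_⟩
    rintro x hx y (hy | hy) hxy r hr hrr
    · exact h x hx y hy (hxy.trans_le (min_le_left _ _)) r hr (hrr.trans_le (min_le_left _ _))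
    · exact h' x hx y hy (hxy.trans_le (min_le_right _ _)) r hr (hrr.trans_le (min_le_right _ _))
  · intro x₀ hx₀
    obtain ⟨ℓ, hℓ, hflat⟩ := exists_flat hA.isClosed hAreg hC2 hx₀
    obtain ⟨η, hη, hcone⟩ := exists_le_volume_cone ℓ hℓ hε hε1
    obtain ⟨δ₁, hδ₁, hflat⟩ := hflat η hη
    obtain ⟨δ₂, hδ₂, hf⟩ := (exists_ball_forall_le (hfc x₀ hx₀)).2 (ha x₀ hx₀)
    set δ := min δ₁ δ₂ with hδ
    have hδ0 : 0 < δ := lt_min hδ₁ hδ₂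
    -- Three distances below `δ / 3` (from `x₀` to `y`, to `x`, to a point of the ball) keep
    -- everything within `δ` of `x₀`.
    refine ⟨Metric.ball x₀ (δ / 3), mem_nhdsWithin_of_mem_nhds
      (Metric.ball_mem_nhds _ (by positivity)), δ / 3, by positivity, ?_⟩
    intro x hx y hy hxy r hr hrδ
    have hy' := Metric.mem_ball.1 hy
    have hsub : Metric.closedBall x r ⊆ Metric.ball x₀ δ := fun z hz => by
      have h1 := Metric.mem_closedBall.1 hz
      have h2 := dist_triangle z x x₀
      have h3 := dist_triangle x y x₀
      exact Metric.mem_ball.2 (by linarith)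
    have hxδ : x ∈ Metric.ball x₀ δ := hsub (Metric.mem_closedBall_self hr.le)
    have hd1 : Metric.ball x₀ δ ⊆ Metric.ball x₀ δ₁ := Metric.ball_subset_ball (min_le_left _ _)
    have hd2 : Metric.ball x₀ δ ⊆ Metric.ball x₀ δ₂ := Metric.ball_subset_ball (min_le_right _ _)
    have hconeA : cone ℓ η x r ⊆ A := fun z hz =>
      (hflat x (hd1 hxδ) z (hd1 (hsub hz.1))).1 hx hz.2
    have hm := mul_volume_le_measure hμ (measurableSet_cone ℓ η x r) hconeA
      (a := ENNReal.ofReal a) (Eventually.of_forall fun z hz =>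
        ENNReal.ofReal_le_ofReal (hf z (hd2 (hsub hz.1)) (hconeA hz)))
    have hm' := hm.trans (measure_mono (fun z hz => hz.1 :
      cone ℓ η x r ⊆ Metric.closedBall x r))
    have hm2 := ENNReal.toReal_mono (measure_ne_top μ _) hm'
    rw [ENNReal.toReal_mul, ENNReal.toReal_ofReal ha0.le] at hm2
    exact (mul_le_mul_of_nonneg_left (hcone x r hr) ha0.le).trans hm2

/-- A separated set near the boundary has `O(r^{-(d-1)})` points. -/
theorem exists_card_near_frontier_le (hA : IsCompact A)
    (hAreg : A ⊆ closure (interior A)) (hC2 : HasC2Boundary A) {ε : ℝ} (hε : 0 < ε)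
    (hε1 : ε < 1) :
    ∃ C > 0, ∃ r₁ > 0, ∀ r : ℝ, 0 < r → r < r₁ → ∀ N : Finset (EuclideanSpace ℝ (Fin d)),
      (∀ x ∈ N, ∃ y ∈ frontier A, dist x y ≤ r) →
      (∀ x ∈ N, ∀ y ∈ N, x ≠ y → ε * r < dist x y) → N.card * r ^ (d - 1) ≤ C := by
  classical
  have hcomp : IsCompact (frontier A) := hA.of_isClosed_subset isClosed_frontier
    hA.isClosed.frontier_subset
  refine hcomp.induction_on (p := fun S => ∃ C > 0, ∃ r₁ > 0, ∀ r : ℝ, 0 < r → r < r₁ →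
    ∀ N : Finset (EuclideanSpace ℝ (Fin d)), (∀ x ∈ N, ∃ y ∈ S, dist x y ≤ r) →
      (∀ x ∈ N, ∀ y ∈ N, x ≠ y → ε * r < dist x y) → N.card * r ^ (d - 1) ≤ C) ?_ ?_ ?_ ?_
  · refine ⟨1, one_pos, 1, one_pos, fun r hr _ N hN _ => ?_⟩
    have : N = ∅ := Finset.eq_empty_of_forall_notMem fun x hx => by simpa using hN x hx
    simp [this]
  · rintro S S' hSS ⟨C, hC, r₁, hr₁, h⟩
    exact ⟨C, hC, r₁, hr₁, fun r hr hrr N hN hsep => h r hr hrr N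
      (fun x hx => (hN x hx).imp fun y hy => ⟨hSS hy.1, hy.2⟩) hsep⟩
  · rintro S S' ⟨C, hC, r₁, hr₁, h⟩ ⟨C', hC', r₂, hr₂, h'⟩
    refine ⟨C + C', by positivity, min r₁ r₂, lt_min hr₁ hr₂, fun r hr hrr N hN hsep => ?_⟩
    have h1 := h r hr (hrr.trans_le (min_le_left _ _)) (N.filter fun x => ∃ y ∈ S, dist x y ≤ r)
      (fun x hx => (Finset.mem_filter.1 hx).2)
      (fun x hx y hy => hsep x (Finset.mem_filter.1 hx).1 y (Finset.mem_filter.1 hy).1)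
    have h2 := h' r hr (hrr.trans_le (min_le_right _ _))
      (N.filter fun x => ∃ y ∈ S', dist x y ≤ r)
      (fun x hx => (Finset.mem_filter.1 hx).2)
      (fun x hx y hy => hsep x (Finset.mem_filter.1 hx).1 y (Finset.mem_filter.1 hy).1)
    have h3 : N ⊆ (N.filter fun x => ∃ y ∈ S, dist x y ≤ r) ∪
        (N.filter fun x => ∃ y ∈ S', dist x y ≤ r) := by
      intro x hx
      obtain ⟨y, hy | hy, hxy⟩ := hN x hx
      · exact Finset.mem_union_left _ (Finset.mem_filter.2 ⟨hx, y, hy, hxy⟩)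
      · exact Finset.mem_union_right _ (Finset.mem_filter.2 ⟨hx, y, hy, hxy⟩)
    have h4 : (N.card : ℝ) ≤ (N.filter fun x => ∃ y ∈ S, dist x y ≤ r).card +
        (N.filter fun x => ∃ y ∈ S', dist x y ≤ r).card := by
      exact_mod_cast (Finset.card_le_card h3).trans (Finset.card_union_le _ _)
    have := mul_le_mul_of_nonneg_right h4 (pow_nonneg hr.le (d - 1))
    linarith
  · intro x₀ hx₀
    obtain ⟨ρ, g, σ, hσ, hg, hfr, hloc⟩ := exists_chart hA.isClosed hAreg hC2 hx₀
    set u₀ := (ρ x₀).fst with hu₀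
    let Φ : EuclideanSpace ℝ (Fin (d - 1)) → EuclideanSpace ℝ (Fin d) :=
      fun u => ρ.symm (WithLp.toLp 2 (u, g u))
    obtain ⟨K, s, hs, hK⟩ := (hg.hasStrictFDerivAt (by norm_num)).exists_lipschitzOnWith
    obtain ⟨δ₁, hδ₁, hs⟩ := Metric.nhds_basis_closedBall.mem_iff.1 hs
    obtain ⟨δ₂, hδ₂, hloc⟩ := Metric.eventually_nhds_iff_ball.1 hloc
    set δ := min δ₁ δ₂ with hδ
    have hδ0 : 0 < δ := lt_min hδ₁ hδ₂
    have hs' : Metric.closedBall u₀ δ ⊆ s :=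
      (Metric.closedBall_subset_closedBall (min_le_left _ _)).trans hs
    have hΦ : ∀ y ∈ frontier A ∩ Metric.ball x₀ δ, Φ (ρ y).fst = y := by
      intro y hy
      have h1 := (hloc y (Metric.ball_subset_ball (min_le_right _ _) hy.2)).1 hy.1
      have : WithLp.toLp 2 ((ρ y).fst, g (ρ y).fst) = ρ y := by rw [← h1]; rfl
      simp only [Φ, this]
      simp
    have hΦL : ∀ u ∈ Metric.closedBall u₀ δ, ∀ v ∈ Metric.closedBall u₀ δ,
        dist (Φ u) (Φ v) ≤ (1 + K) * dist u v := by
      intro u hu v hv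
      have h1 := hK.dist_le_mul u (hs' hu) v (hs' hv)
      simp only [Φ, LinearIsometryEquiv.dist_map]
      rw [WithLp.prod_dist_eq_of_L2]
      have h2 : 0 ≤ dist u v := dist_nonneg
      have h3 : 0 ≤ dist (g u) (g v) := dist_nonneg
      have h4 : (0 : ℝ) ≤ K := K.2
      rw [Real.sqrt_le_left (by positivity)]
      change dist u v ^ 2 + dist (g u) (g v) ^ 2 ≤ _
      nlinarith [mul_nonneg h4 h2, mul_nonneg (mul_nonneg h4 h2) h2,
        pow_le_pow_left₀ h3 h1 2]
    -- Let `M` be an `r`-net of the parameter ball, of size `O(r^{-(d-1)})`. A point of `N` is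
    -- within `r` of the frontier and then within `(1 + K) r` of a lifted point of `M`. Volume
    -- packing allows at most `B` points of `N` in a ball of radius `(2 + K) r`.
    set B : ℝ := (3 * (2 + K) / ε) ^ d with hB
    have hB0 : 0 < B := by have : (0 : ℝ) ≤ K := K.2; positivity
    refine ⟨frontier A ∩ Metric.ball x₀ δ, inter_mem self_mem_nhdsWithin
      (mem_nhdsWithin_of_mem_nhds (Metric.ball_mem_nhds _ hδ0)), (3 * δ) ^ (d - 1) * B,
      by positivity, δ, hδ0, fun r hr hrδ N hN hsep => ?_⟩
    obtain ⟨M, hMS, hMsep, hMcov⟩ := exists_separated_net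
      (Metric.isBounded_closedBall (x := u₀) (r := δ)) hr
    have hMcard := card_mul_pow_le_of_separated hr hrδ.le hMS hMsep
    have hNsub : N ⊆ M.biUnion fun u =>
        N.filter fun x => x ∈ Metric.closedBall (Φ u) ((2 + K) * r) := by
      intro x hx
      obtain ⟨y, hy, hxy⟩ := hN x hx
      have hyu : (ρ y).fst ∈ Metric.closedBall u₀ δ :=
        (dist_fst_le_dist ρ y x₀).trans (Metric.mem_ball.1 hy.2).le
      obtain ⟨u, hu, huy⟩ := hMcov _ hyu
      refine Finset.mem_biUnion.2 ⟨u, hu, Finset.mem_filter.2 ⟨hx, ?_⟩⟩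
      have h1 := hΦL _ hyu u (hMS hu)
      rw [hΦ y hy] at h1
      have h2 := dist_triangle x y (Φ u)
      have h3 : (1 + (K : ℝ)) * dist (ρ y).fst u ≤ (1 + K) * r := by
        have : (0 : ℝ) ≤ K := K.2
        gcongr
      exact Metric.mem_closedBall.2 (by linarith)
    have hloc : ∀ u ∈ M, ((N.filter fun x => x ∈ Metric.closedBall (Φ u) ((2 + K) * r)).card : ℝ)
        ≤ B := by
      intro u _
      have hK0 : (0 : ℝ) ≤ K := K.2
      have h1 := card_mul_pow_le_of_separated (x₀ := Φ u) (R := (2 + K) * r) (r := ε * r)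
        (N := N.filter fun x => x ∈ Metric.closedBall (Φ u) ((2 + K) * r)) (by positivity)
        (by nlinarith) (fun x hx => (Finset.mem_filter.1 hx).2)
        (fun x hx y hy => hsep x (Finset.mem_filter.1 hx).1 y (Finset.mem_filter.1 hy).1)
      rw [← le_div_iff₀ (by positivity), ← div_pow] at h1
      refine h1.trans (le_of_eq ?_)
      rw [hB]
      congr 1
      field_simp
    have hcard : (N.card : ℝ) ≤ M.card * B := by
      have h1 : N.card ≤ ∑ u ∈ M,
          (N.filter fun x => x ∈ Metric.closedBall (Φ u) ((2 + K) * r)).card :=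
        (Finset.card_le_card hNsub).trans Finset.card_biUnion_le
      have h2 : (N.card : ℝ) ≤ ∑ u ∈ M,
          ((N.filter fun x => x ∈ Metric.closedBall (Φ u) ((2 + K) * r)).card : ℝ) := by
        exact_mod_cast h1
      refine h2.trans ((Finset.sum_le_sum hloc).trans ?_)
      simp
    calc N.card * r ^ (d - 1) ≤ M.card * B * r ^ (d - 1) := by gcongr
      _ = M.card * r ^ (d - 1) * B := by ring
      _ ≤ _ := by gcongr

/-- Take `ε r`-nets of the points of `A` farther than `r` from the frontier and of the remaining
ones, with balls of radius `s = (1 - ε) r`. A ball of the first kind avoids the frontier, so by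
connectedness it lies in `A`. One of the second kind contains almost a half-ball of `A`. -/
theorem hasHeavyCovers [IsProbabilityMeasure μ] (hA : IsCompact A)
    (hAreg : A ⊆ closure (interior A)) (hC2 : HasC2Boundary A)
    (hfc : ∀ x ∈ frontier A, ContinuousWithinAt f A x)
    (hμ : μ = (volume.restrict A).withDensity fun x => ENNReal.ofReal (f x)) {a₀ a₁ : ℝ}
    (ha₀ : 0 < a₀) (ha₁ : 0 < a₁) (ha₀f : ENNReal.ofReal a₀ < essInfOn f A)
    (ha₁f : ENNReal.ofReal a₁ < infBoundary f A) :
    HasHeavyCovers μ A a₀ (a₁ / 2) := by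
  classical
  have hθ := ballVol_pos d
  obtain ⟨b₀, hb₀, hb₀f⟩ := ENNReal.lt_iff_exists_real_btwn.1 ha₀f |>.imp fun b h => h.2
  obtain ⟨b₁, hb₁, hb₁f⟩ := ENNReal.lt_iff_exists_real_btwn.1 ha₁f |>.imp fun b h => h.2
  have hab₀ : a₀ < b₀ := (ENNReal.ofReal_lt_ofReal_iff_of_nonneg ha₀.le).1 hb₀
  have hab₁ : a₁ < b₁ := (ENNReal.ofReal_lt_ofReal_iff_of_nonneg ha₁.le).1 hb₁
  have hb₁f' : ∀ x ∈ frontier A, b₁ < f x := by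
    intro x hx
    have h1 : ENNReal.ofReal b₁ < ENNReal.ofReal (f x) :=
      hb₁f.trans_le (iInf₂_le x hx)
    exact (ENNReal.ofReal_lt_ofReal_iff_of_nonneg (ha₁.trans hab₁).le).1 h1
  -- The gaps `a₀ < b₀` and `a₁ < b₁` pay for the factor `(1 - ε)^d` from shrinking the radius and,
  -- at the boundary, for another `1 - ε` from the cone.
  have hexε : ∃ ε : ℝ, 0 < ε ∧ ε < 1 ∧ a₀ ≤ b₀ * (1 - ε) ^ d ∧
      a₁ ≤ b₁ * (1 - ε) * (1 - ε) ^ d := by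
    have c1 : Tendsto (fun ε : ℝ => b₀ * (1 - ε) ^ d) (𝓝[>] 0) (𝓝 b₀) := by
      have : Continuous fun ε : ℝ => b₀ * (1 - ε) ^ d := by fun_prop
      simpa using (this.tendsto 0).mono_left nhdsWithin_le_nhds
    have c2 : Tendsto (fun ε : ℝ => b₁ * (1 - ε) * (1 - ε) ^ d) (𝓝[>] 0) (𝓝 b₁) := by
      have : Continuous fun ε : ℝ => b₁ * (1 - ε) * (1 - ε) ^ d := by fun_prop
      simpa using (this.tendsto 0).mono_left nhdsWithin_le_nhds
    have c3 : ∀ᶠ ε : ℝ in 𝓝[>] 0, ε < 1 :=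
      nhdsWithin_le_nhds (gt_mem_nhds one_pos)
    obtain ⟨ε, h1, h2, h3, h4⟩ := ((eventually_mem_nhdsWithin (a := (0 : ℝ)) (s := Set.Ioi 0)).and (c3.and
      ((c1.eventually (lt_mem_nhds hab₀)).and (c2.eventually (lt_mem_nhds hab₁))))).exists
    exact ⟨ε, h1, h2, h3.le, h4.le⟩
  obtain ⟨ε, hε, hε1, hε₀, hε₁⟩ := hexε
  have hε' : 0 < 1 - ε := by linarith
  obtain ⟨r₁, hr₁, hmass⟩ := exists_le_measureReal_closedBall_near_frontier hA hAreg hC2 hfc hμ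
    (ha₁.trans hab₁) hb₁f' hε hε1
  obtain ⟨C, hC, r₂, hr₂, hcard⟩ := exists_card_near_frontier_le hA hAreg hC2 hε hε1
  obtain ⟨R, hR⟩ := hA.isBounded.subset_closedBall (0 : EuclideanSpace ℝ (Fin d))
  set R' := max R 1 with hR'
  have hRA : A ⊆ Metric.closedBall 0 R' :=
    hR.trans (Metric.closedBall_subset_closedBall (le_max_left _ _))
  have hR'1 : 1 ≤ R' := le_max_right _ _
  have hR'0 : 0 < R' := by linarith
  refine ⟨max C ((3 * R' / ε) ^ d), lt_max_of_lt_left hC, min 1 (min r₁ r₂),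
    lt_min one_pos (lt_min hr₁ hr₂), fun r hr hrr => ?_⟩
  have hr1 : r < 1 := hrr.trans_le (min_le_left _ _)
  have hrr₁ : r < r₁ := hrr.trans_le ((min_le_right _ _).trans (min_le_left _ _))
  have hrr₂ : r < r₂ := hrr.trans_le ((min_le_right _ _).trans (min_le_right _ _))
  set S₁ := {y | y ∈ A ∧ ∃ z ∈ frontier A, dist y z ≤ r} with hS₁
  set S₀ := {y | y ∈ A ∧ ∀ z ∈ frontier A, r < dist y z} with hS₀
  obtain ⟨T₀, hT₀, hsep₀, hcov₀⟩ := exists_separated_net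
    (hA.isBounded.subset (fun y hy => hy.1 : S₀ ⊆ A)) (by positivity : 0 < ε * r)
  obtain ⟨T₁, hT₁, hsep₁, hcov₁⟩ := exists_separated_net
    (hA.isBounded.subset (fun y hy => hy.1 : S₁ ⊆ A)) (by positivity : 0 < ε * r)
  have hs : 0 < (1 - ε) * r := by positivity
  have hsr : (1 - ε) * r < r := by nlinarith
  refine ⟨(1 - ε) * r, T₀, T₁, ?_, ?_, ?_, ?_, ?_⟩
  · refine le_trans ?_ (le_max_right _ _)
    have h1 := card_mul_pow_le_of_separated (x₀ := 0) (R := R') (by positivity : 0 < ε * r)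
      (by nlinarith) (fun x hx => hRA (hT₀ hx).1) hsep₀
    rw [div_pow, le_div_iff₀ (by positivity)]
    rw [mul_pow ε] at h1
    linarith
  · exact (hcard r hr hrr₂ T₁ (fun x hx => (hT₁ hx).2) hsep₁).trans (le_max_left _ _)
  · intro x hx
    have hxS := hT₀ hx
    have hsubA : Metric.closedBall x ((1 - ε) * r) ⊆ A := by
      rcases subset_interior_or_subset_compl (A := A)
        (convex_closedBall x ((1 - ε) * r)).isPreconnected (fun z hz hzf => by
          have := hxS.2 z hzf
          rw [Metric.mem_closedBall, dist_comm] at hz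
          linarith) with h | h
      · exact h.trans interior_subset
      · exact absurd hxS.1 (h (Metric.mem_closedBall_self hs.le))
    have hm := mul_volume_le_measure hμ measurableSet_closedBall hsubA (a := ENNReal.ofReal b₀) (by
      filter_upwards [ae_essInf_le (μ := volume.restrict A)
        (f := fun x => ENNReal.ofReal (f x))] with z hz _
      exact hb₀f.le.trans hz)
    have hm2 := ENNReal.toReal_mono (measure_ne_top μ _) hm
    rw [ENNReal.toReal_mul, ENNReal.toReal_ofReal (ha₀.trans hab₀).le, ← measureReal_def,
      measureReal_closedBall_eq _ hs.le] at hm2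
    refine le_trans ?_ hm2
    rw [mul_pow]
    have : 0 ≤ ballVol d * r ^ d := by positivity
    nlinarith
  · intro x hx
    obtain ⟨hxA, y, hy, hxy⟩ := hT₁ hx
    refine le_trans ?_ (hmass x hxA y hy (hxy.trans_lt hrr₁) _ hs (hsr.trans hrr₁))
    rw [mul_pow]
    have : 0 ≤ ballVol d * r ^ d := by positivity
    nlinarith
  · intro y hy
    have hclose : ∃ x, (x ∈ T₀ ∨ x ∈ T₁) ∧ dist y x ≤ ε * r := by
      by_cases h : ∃ z ∈ frontier A, dist y z ≤ r
      · obtain ⟨x, hx, hxy⟩ := hcov₁ y ⟨hy, h⟩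
        exact ⟨x, Or.inr hx, hxy⟩
      · push Not at h
        obtain ⟨x, hx, hxy⟩ := hcov₀ y ⟨hy, h⟩
        exact ⟨x, Or.inl hx, hxy⟩
    obtain ⟨x, hx, hxy⟩ := hclose
    refine ⟨x, hx, Metric.closedBall_subset_closedBall' ?_⟩
    rw [dist_comm] at hxy
    linarith

end Upper

/-! ### Rate function and exponents -/

section HatH

theorem hatH_zero_left {x : ℝ} (hx : 0 ≤ x) : hatH 0 x = x :=
  ((hatH_eq_iff le_rfl hx).2 ⟨by simp [chernoffH], hx⟩).symm

theorem hatH_one_zero : hatH 1 0 = 1 :=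
  ((hatH_eq_iff zero_le_one le_rfl).2 ⟨by simp [chernoffH], le_rfl⟩).symm

/-- The rate in the form used below. For `β = 0`, the factor `β` removes the logarithmic term. -/
theorem mul_chernoffH_div {β y : ℝ} (hβ : 0 ≤ β) (hy : 0 < y) :
    y * chernoffH (β / y) = y - β - β * Real.log (y / β) := by
  rcases hβ.eq_or_lt with rfl | hβ
  · simp [chernoffH]
  rw [chernoffH, if_pos (div_pos hβ hy), Real.log_div hβ.ne' hy.ne', Real.log_div hy.ne' hβ.ne']
  field_simp
  ring

/-- The rate increases strictly in the mean beyond `β`, by `log u < u - 1` at `u = y / b`.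
Inequalities against `hatH` thus become inequalities between exponents. -/
theorem sub_mul_log_div_lt {β b y : ℝ} (hβ : 0 ≤ β) (hb : 0 < b) (hβb : β ≤ b) (hby : b < y) :
    b - β - β * Real.log (b / β) < y - β - β * Real.log (y / β) := by
  rcases hβ.eq_or_lt with rfl | hβ
  · simpa using hby
  have hy : 0 < y := hb.trans hby
  have h1 : Real.log (y / b) < y / b - 1 :=
    Real.log_lt_sub_one_of_pos (div_pos hy hb) (by rw [Ne, div_eq_one_iff_eq hb.ne']; exact hby.ne')
  rw [Real.log_div hy.ne' hb.ne'] at h1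
  rw [Real.log_div hb.ne' hβ.ne', Real.log_div hy.ne' hβ.ne']
  have h2 : β * (y / b - 1) ≤ y - b := by
    have h3 : β * (y / b - 1) = (β / b) * (y - b) := by field_simp
    have h4 : β / b ≤ 1 := (div_le_one hb).2 hβb
    rw [h3]
    nlinarith
  nlinarith [mul_lt_mul_of_pos_left h1 hβ]

theorem hatH_spec {β x : ℝ} (hβ : 0 ≤ β) (hx : 0 ≤ x) (h : 0 < hatH β x) :
    hatH β x - β - β * Real.log (hatH β x / β) = x := by
  rw [← mul_chernoffH_div hβ h]
  exact ((hatH_eq_iff hβ hx).1 rfl).1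

theorem le_hatH {β x : ℝ} (hβ : 0 ≤ β) (hx : 0 ≤ x) : β ≤ hatH β x :=
  ((hatH_eq_iff hβ hx).1 rfl).2

theorem hatH_pos {β x : ℝ} (hβ : 0 ≤ β) (hx : 0 < x) : 0 < hatH β x := by
  have h1 := ((hatH_eq_iff hβ hx.le).1 rfl).1
  have h2 := hβ.trans (le_hatH hβ hx.le)
  refine h2.lt_of_ne fun h => ?_
  rw [← h, zero_mul] at h1
  exact hx.ne h1

theorem lt_hatH {β x : ℝ} (hβ : 0 ≤ β) (hx : 0 < x) : β < hatH β x := by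
  refine (le_hatH hβ hx.le).lt_of_ne fun h => ?_
  have h1 := hatH_spec hβ hx.le (hatH_pos hβ hx)
  rw [← h] at h1
  rcases hβ.eq_or_lt with rfl | hβ
  · simp at h1; exact hx.ne h1
  · rw [div_self hβ.ne'] at h1
    simp at h1
    exact hx.ne h1

/-- The optimal Chernoff parameter `s = β / b` turns the exponent into the rate. For `β = 0` that
would be `s = 0`, so a small positive `s` is taken, with exponent `(b + x) / 2`. -/
theorem exists_exponent_gt {β x b : ℝ} (hβ : 0 ≤ β) (hx : 0 ≤ x) (hb : hatH β x < b) :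
    ∃ s : ℝ, 0 < s ∧ s < 1 ∧ x < b * (1 - s) + β * Real.log s := by
  have hle := le_hatH hβ hx
  have hb0 : 0 < b := (hβ.trans hle).trans_lt hb
  rcases hβ.eq_or_lt with rfl | hβ0
  · rw [hatH_zero_left hx] at hb
    refine ⟨(b - x) / (2 * b), by apply div_pos <;> linarith, ?_, ?_⟩
    · rw [div_lt_one (by positivity)]; linarith
    · have : b * (1 - (b - x) / (2 * b)) = (b + x) / 2 := by field_simp; ring
      rw [this]
      linarith
  · have hy := hβ0.trans_le hle
    have h1 := sub_mul_log_div_lt hβ hy hle hb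
    rw [hatH_spec hβ hx hy] at h1
    refine ⟨β / b, div_pos hβ0 hb0, (div_lt_one hb0).2 (hle.trans_lt hb), ?_⟩
    have h2 : b * (1 - β / b) = b - β := by field_simp
    rw [h2, Real.log_div hβ0.ne' hb0.ne']
    rw [Real.log_div hb0.ne' hβ0.ne'] at h1
    linarith

/-- The mean `b` may lie below `β`, where the rate is not monotone. It is raised above `β` but kept
below `hatH β x`; this only weakens an upper bound on the probability of having enough points. -/
theorem exists_exponent_lt {β x b : ℝ} (hβ : 0 ≤ β) (hx : 0 < x) (hb : b < hatH β x) :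
    ∃ b' : ℝ, b ≤ b' ∧ β < b' ∧ b' - β - β * Real.log (b' / β) < x := by
  have h1 := lt_hatH hβ hx
  have h2 : max b β < hatH β x := max_lt hb h1
  have h3 := le_max_left b β
  have h4 := le_max_right b β
  refine ⟨(max b β + hatH β x) / 2, by linarith, by linarith, ?_⟩
  have h5 := sub_mul_log_div_lt hβ (b := (max b β + hatH β x) / 2) (by linarith) (by linarith)
    (by linarith : _ < hatH β x)
  rwa [hatH_spec hβ hx.le (hatH_pos hβ hx)] at h5

end HatH

/-! ### Lower bounds for the binomial lower tail -/

section BinomialLower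

theorem exp_neg_le_one_sub_pow {p : ℝ} (hp1 : p < 1) (n : ℕ) :
    Real.exp (-(n * p / (1 - p))) ≤ (1 - p) ^ n := by
  have h0 : 0 < 1 - p := by linarith
  have h1 := Real.one_sub_inv_le_log_of_pos h0
  have h2 : 1 - (1 - p)⁻¹ = -(p / (1 - p)) := by field_simp; ring
  rw [h2] at h1
  rw [← Real.exp_log (pow_pos h0 n), Real.log_pow]
  refine Real.exp_le_exp.2 ?_
  have := mul_le_mul_of_nonneg_left h1 (Nat.cast_nonneg (α := ℝ) n)
  calc -(n * p / (1 - p)) = n * -(p / (1 - p)) := by ring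
    _ ≤ _ := this

/-- The Stirling sequence decreases. The error `1 + log j` is `o(log n)` for `j` of order `log n`.
-/
theorem log_factorial_le {j : ℕ} (hj : 1 ≤ j) :
    Real.log (j.factorial) ≤ 1 + Real.log j + j * Real.log j - j := by
  obtain ⟨n, rfl⟩ := Nat.exists_eq_add_of_le' hj
  have h1 : Stirling.stirlingSeq (n + 1) ≤ Stirling.stirlingSeq 1 :=
    Stirling.stirlingSeq'_antitone (Nat.zero_le n)
  have hpos := Stirling.stirlingSeq'_pos n
  have h2 := Real.log_le_log hpos h1
  rw [Stirling.log_stirlingSeq_formula, Stirling.stirlingSeq_one,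
    Real.log_div (Real.exp_pos 1).ne' (by positivity), Real.log_exp, Real.log_sqrt (by norm_num),
    Real.log_div (by positivity) (Real.exp_pos 1).ne', Real.log_exp,
    Real.log_mul (by norm_num) (by positivity)] at h2
  have h3 : 0 ≤ Real.log ((n + 1 : ℕ) : ℝ) := Real.log_natCast_nonneg _
  linarith

theorem tendsto_log_div_natCast : Tendsto (fun n : ℕ => Real.log n / n) atTop (𝓝 0) := by
  have := (Real.isLittleO_log_id_atTop.tendsto_div_nhds_zero).comp tendsto_natCast_atTop_atTop
  exact this

theorem tendsto_log_natCast : Tendsto (fun n : ℕ => Real.log n) atTop atTop :=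
  Real.tendsto_log_atTop.comp tendsto_natCast_atTop_atTop

/-- Lower bound for the lower tail of `Bin(n, b log n / n)` at `j ~ β log n`, `β > 0`. -/
theorem eventually_rpow_le_choose_mul {β b γ : ℝ} (hβ : 0 < β) (hb : 0 < b)
    (hγ : b - β - β * Real.log (b / β) < γ) {j : ℕ → ℕ}
    (hj : Tendsto (fun n : ℕ => (j n : ℝ) / Real.log n) atTop (𝓝 β)) :
    ∀ᶠ n : ℕ in atTop, (n : ℝ) ^ (-γ) ≤ n.choose (j n) * (b * Real.log n / n) ^ j n *
      (1 - b * Real.log n / n) ^ n := by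
  have hp : Tendsto (fun n : ℕ => b * Real.log n / n) atTop (𝓝 0) := by
    simpa [mul_div_assoc] using tendsto_log_div_natCast.const_mul b
  have hjn : Tendsto (fun n : ℕ => (j n : ℝ) / n) atTop (𝓝 0) := by
    have h1 := hj.mul tendsto_log_div_natCast
    rw [mul_zero] at h1
    refine h1.congr' ?_
    filter_upwards [tendsto_log_natCast.eventually_gt_atTop 0] with n hn
    field_simp
  have hjtop : Tendsto (fun n => (j n : ℝ)) atTop atTop := by
    refine (hj.pos_mul_atTop hβ tendsto_log_natCast).congr' ?_
    filter_upwards [tendsto_log_natCast.eventually_gt_atTop 0] with n hn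
    field_simp
  have hlogj : Tendsto (fun n : ℕ => (1 + Real.log (j n)) / Real.log n) atTop (𝓝 0) := by
    have h1 : Tendsto (fun n : ℕ => (1 + Real.log (j n)) / (j n : ℝ)) atTop (𝓝 0) := by
      have h2 := (Real.isLittleO_log_id_atTop.tendsto_div_nhds_zero).comp hjtop
      have h3 := tendsto_inv_atTop_zero.comp hjtop
      have := h3.add h2
      rw [add_zero] at this
      refine this.congr fun n => ?_
      simp only [Function.comp_apply, id_eq, add_div, one_div]
    have h2 := h1.mul hj
    rw [zero_mul] at h2
    refine h2.congr' ?_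
    filter_upwards [hjtop.eventually_gt_atTop 0] with n hn
    field_simp
  -- A lower bound for the logarithm of the right side, divided by `log n`; its limit is minus the
  -- rate at mean `b`.
  have hlim : Tendsto (fun n : ℕ => (j n : ℝ) / Real.log n *
      (Real.log ((1 - (j n : ℝ) / n) * b * ((j n : ℝ) / Real.log n)⁻¹) + 1) -
      (1 + Real.log (j n)) / Real.log n - b / (1 - b * Real.log n / n)) atTop
      (𝓝 (β * (Real.log ((1 - 0) * b * β⁻¹) + 1) - 0 - b / (1 - 0))) := by
    refine ((hj.mul (Tendsto.add_const 1 (Tendsto.log ?_ ?_))).sub hlogj).sub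
      (tendsto_const_nhds.div (tendsto_const_nhds.sub hp) (by norm_num))
    · exact ((tendsto_const_nhds.sub hjn).mul_const b).mul (hj.inv₀ hβ.ne')
    · simp only [sub_zero, one_mul]; positivity
  have hlt : -γ < β * (Real.log ((1 - 0) * b * β⁻¹) + 1) - 0 - b / (1 - 0) := by
    simp only [sub_zero, one_mul, div_one, ← div_eq_mul_inv]
    linarith
  filter_upwards [hlim.eventually (lt_mem_nhds hlt), tendsto_log_natCast.eventually_gt_atTop 0,
    hp.eventually (gt_mem_nhds (one_pos : (0 : ℝ) < 1)),
    hjn.eventually (gt_mem_nhds (one_pos : (0 : ℝ) < 1)), hjtop.eventually_ge_atTop 1,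
    eventually_gt_atTop 0] with n h1 hℓ hp1 hjn1 hj1 hn
  have hn0 : (0 : ℝ) < n := by exact_mod_cast hn
  have hj0 : (0 : ℝ) < j n := by linarith
  have hj1' : 1 ≤ j n := by exact_mod_cast hj1
  set ℓ := Real.log n with hℓdef
  set p := b * ℓ / n with hpdef
  have hp0 : 0 < p := by positivity
  have hjltn : (j n : ℝ) < n := (div_lt_one hn0).1 hjn1
  have hjlen : j n ≤ n := by exact_mod_cast hjltn.le
  have hnj : (0 : ℝ) < n - j n := by linarith
  have hchoose : ((n : ℝ) - j n) ^ j n / (j n).factorial ≤ n.choose (j n) := by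
    rw [div_le_iff₀ (by positivity)]
    have h2 := Nat.pow_sub_le_descFactorial n (j n)
    rw [Nat.descFactorial_eq_factorial_mul_choose] at h2
    have h3 : (n - j n) ^ j n ≤ (j n).factorial * n.choose (j n) :=
      (Nat.pow_le_pow_left (by omega) _).trans h2
    have h4 : ((n - j n : ℕ) : ℝ) ^ j n ≤ (j n).factorial * n.choose (j n) := by exact_mod_cast h3
    rw [Nat.cast_sub hjlen] at h4
    linarith
  have hkey : (n : ℝ) ^ (-γ) ≤ ((n : ℝ) - j n) ^ j n / (j n).factorial * p ^ j n *
      Real.exp (-(n * p / (1 - p))) := by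
    rw [Real.rpow_def_of_pos hn0, ← Real.exp_log (by positivity : 0 <
      ((n : ℝ) - j n) ^ j n / (j n).factorial * p ^ j n), ← Real.exp_add]
    refine Real.exp_le_exp.2 ?_
    rw [Real.log_mul (by positivity) (by positivity), Real.log_div (by positivity) (by positivity),
      Real.log_pow, Real.log_pow]
    have hfac := log_factorial_le hj1'
    have e1 : Real.log ((1 - (j n : ℝ) / n) * b * ((j n : ℝ) / ℓ)⁻¹) =
        Real.log ((n : ℝ) - j n) + Real.log p - Real.log (j n) := by
      rw [← Real.log_mul hnj.ne' hp0.ne', ← Real.log_div (by positivity) hj0.ne']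
      congr 1
      rw [hpdef]
      field_simp
    rw [e1] at h1
    have h5 := mul_lt_mul_of_pos_left h1 hℓ
    have e2 : n * p / (1 - p) = ℓ * (b / (1 - p)) := by
      rw [hpdef]; field_simp
    rw [e2]
    have e3 : ℓ * ((j n : ℝ) / ℓ * (Real.log ((n : ℝ) - j n) + Real.log p - Real.log (j n) + 1) -
        (1 + Real.log (j n)) / ℓ - b / (1 - p)) =
        j n * (Real.log ((n : ℝ) - j n) + Real.log p - Real.log (j n) + 1) -
        (1 + Real.log (j n)) - ℓ * (b / (1 - p)) := by
      have e4 : 1 - p ≠ 0 := by linarith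
      field_simp
    rw [e3] at h5
    linarith
  refine hkey.trans ?_
  have := exp_neg_le_one_sub_pow hp1 n
  gcongr

/-- Lower bound for the lower tail of `Bin(n, b log n / n)` at `k ~ β log n`, `β ≥ 0`. -/
theorem eventually_rpow_le_one_sub_binTail {β b γ : ℝ} (hβ : 0 ≤ β) (hβb : β < b)
    (hγ : b - β - β * Real.log (b / β) < γ) {k : ℕ → ℕ} (hk1 : ∀ᶠ n in atTop, 1 ≤ k n)
    (hk : Tendsto (fun n : ℕ => (k n : ℝ) / Real.log n) atTop (𝓝 β)) :
    ∀ᶠ n : ℕ in atTop, (n : ℝ) ^ (-γ) ≤ 1 - binTail (b * Real.log n / n) n (k n) := by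
  have hb : 0 < b := hβ.trans_lt hβb
  have hp : Tendsto (fun n : ℕ => b * Real.log n / n) atTop (𝓝 0) := by
    simpa [mul_div_assoc] using tendsto_log_div_natCast.const_mul b
  rcases hβ.eq_or_lt with rfl | hβ0
  -- For `β = 0` the probability `(1 - p)^n` of no success already has the right exponent, whatever
  -- the size of `k n ≥ 1`.
  · have hlim : Tendsto (fun n : ℕ => b / (1 - b * Real.log n / n)) atTop (𝓝 (b / (1 - 0))) :=
      tendsto_const_nhds.div (tendsto_const_nhds.sub hp) (by norm_num)
    have hlt : b / (1 - 0) < γ := by simpa using hγ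
    filter_upwards [hk1, hp.eventually (gt_mem_nhds (one_pos : (0 : ℝ) < 1)),
      hlim.eventually (gt_mem_nhds hlt), eventually_gt_atTop 0,
      tendsto_log_natCast.eventually_gt_atTop 0] with n h1 hp1 h2 hn hℓ
    have hn0 : (0 : ℝ) < n := by exact_mod_cast hn
    set p := b * Real.log n / n with hpdef
    have hp0 : 0 ≤ p := by positivity
    have h3 := choose_mul_le_one_sub_binTail hp0 hp1.le n 0
    have h4 := binTail_antitone hp0 hp1.le n h1
    have h5 := exp_neg_le_one_sub_pow hp1 n
    have h6 : (n : ℝ) ^ (-γ) ≤ Real.exp (-(n * p / (1 - p))) := by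
      rw [Real.rpow_def_of_pos hn0]
      refine Real.exp_le_exp.2 ?_
      have e2 : n * p / (1 - p) = Real.log n * (b / (1 - p)) := by
        rw [hpdef]; field_simp
      rw [e2]
      nlinarith
    simp only [Nat.choose_zero_right, Nat.cast_one, pow_zero, one_mul, zero_add] at h3
    linarith
  · have hj : Tendsto (fun n : ℕ => ((k n - 1 : ℕ) : ℝ) / Real.log n) atTop (𝓝 β) := by
      have h1 : Tendsto (fun n : ℕ => (k n : ℝ) / Real.log n - (Real.log n)⁻¹) atTop
          (𝓝 (β - 0)) := hk.sub (tendsto_inv_atTop_zero.comp tendsto_log_natCast)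
      rw [sub_zero] at h1
      refine h1.congr' ?_
      filter_upwards [hk1] with n hn
      rw [Nat.cast_sub hn, Nat.cast_one, sub_div, one_div]
    filter_upwards [hk1, eventually_rpow_le_choose_mul hβ0 hb hγ hj,
      hp.eventually (gt_mem_nhds (one_pos : (0 : ℝ) < 1)),
      tendsto_log_natCast.eventually_gt_atTop 0] with n h1 h2 hp1 hℓ
    have h3 := choose_mul_le_one_sub_binTail (by positivity) hp1.le n (k n - 1)
    rw [Nat.sub_add_cancel h1] at h3
    exact h2.trans h3

end BinomialLower

/-! ### Borel–Cantelli arguments -/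

section BorelCantelli

variable {Ω : Type*} [MeasurableSpace Ω] {P : Measure Ω} [IsProbabilityMeasure P]

theorem ae_eventually_notMem_of_summable {s : ℕ → Set Ω} {u : ℕ → ℝ} (hu : Summable u)
    (h : ∀ᶠ n in atTop, P.real (s n) ≤ u n) : ∀ᵐ ω ∂P, ∀ᶠ n in atTop, ω ∉ s n := by
  have hs : Summable fun n => P.real (s n) := by
    refine Summable.of_norm_bounded_eventually_nat hu ?_
    filter_upwards [h] with n hn
    rwa [Real.norm_of_nonneg measureReal_nonneg]
  refine ae_eventually_notMem ?_
  have h1 : ∀ n, P (s n) = ENNReal.ofReal (P.real (s n)) := fun n =>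
    (ofReal_measureReal (measure_ne_top _ _)).symm
  simp only [h1]
  rw [← ENNReal.ofReal_tsum_of_nonneg (fun n => measureReal_nonneg) hs]
  exact ENNReal.ofReal_ne_top

/-- Borel–Cantelli along a geometric subsequence. -/
theorem ae_eventually_exists_notMem_of_le_rpow {s : ℕ → Set Ω} {C γ c : ℝ} (hC : 0 ≤ C)
    (hγ : 0 < γ) (h : ∀ᶠ n : ℕ in atTop, P.real (s n) ≤ C * (n : ℝ) ^ (-γ)) (hc : 1 < c) :
    ∀ᵐ ω ∂P, ∀ᶠ n : ℕ in atTop, ∃ N : ℕ, N ≤ n ∧ (n : ℝ) ≤ c * N ∧ ω ∉ s N := by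
  have hc0 : 0 < c := by linarith
  -- Along `N m ≈ c^m` the bound `n^{-γ}` becomes geometric, hence summable for every `γ > 0`.
  set N : ℕ → ℕ := fun m => ⌈c ^ m⌉₊ with hN
  have hNle : ∀ m, c ^ m ≤ (N m : ℝ) := fun m => Nat.le_ceil _
  have hNtop : Tendsto N atTop atTop :=
    tendsto_nat_ceil_atTop.comp (tendsto_pow_atTop_atTop_of_one_lt hc)
  have hgeo : Summable fun m : ℕ => C * (c ^ (-γ)) ^ m := by
    refine (summable_geometric_of_lt_one (by positivity) ?_).mul_left C
    exact Real.rpow_lt_one_of_one_lt_of_neg hc (by linarith)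
  have hBC := ae_eventually_notMem_of_summable (P := P) (s := fun m => s (N m)) hgeo (by
    filter_upwards [hNtop.eventually h] with m hm
    refine hm.trans (mul_le_mul_of_nonneg_left ?_ hC)
    rw [← Real.rpow_natCast, ← Real.rpow_mul hc0.le, mul_comm, Real.rpow_mul hc0.le,
      Real.rpow_natCast]
    exact Real.rpow_le_rpow_of_nonpos (by positivity) (hNle m) (by linarith))
  have hlogc : 0 < Real.log c := Real.log_pos hc
  -- This `m` satisfies `c^m ≤ n < c^(m+1)`, and rounding `c^m` up keeps it at most the integer `n`.
  have hm : Tendsto (fun n : ℕ => ⌊Real.log n / Real.log c⌋₊) atTop atTop :=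
    tendsto_nat_floor_atTop.comp (tendsto_log_natCast.atTop_div_const hlogc)
  filter_upwards [hBC] with ω hω
  filter_upwards [hm.eventually hω, eventually_ge_atTop 1] with n h1 hn
  have hn0 : (0 : ℝ) < n := by exact_mod_cast hn
  have hq : 0 ≤ Real.log n / Real.log c := div_nonneg (Real.log_natCast_nonneg n) hlogc.le
  set m := ⌊Real.log n / Real.log c⌋₊ with hmdef
  have h2 : (m : ℝ) * Real.log c ≤ Real.log n := by
    rw [← le_div_iff₀ hlogc]; exact Nat.floor_le hq
  have h3 : Real.log n < (m + 1) * Real.log c := by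
    rw [← div_lt_iff₀ hlogc]; exact Nat.lt_floor_add_one _
  refine ⟨N m, ?_, ?_, h1⟩
  · refine Nat.ceil_le.2 ?_
    rw [← Real.log_le_log_iff (by positivity) hn0, Real.log_pow]
    exact h2
  · have h4 : (n : ℝ) < c ^ (m + 1) := by
      rw [← Real.log_lt_log_iff hn0 (by positivity), Real.log_pow]
      push_cast
      exact h3
    rw [pow_succ] at h4
    nlinarith [hNle m]

end BorelCantelli

/-! ### Radii with a prescribed mean count -/

/-- The radius `r` with `n θ rᵈ = t L`. -/
noncomputable def scaledRadius (d : ℕ) (t L : ℝ) (n : ℕ) : ℝ :=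
  (t * L / (n * ballVol d)) ^ ((1 : ℝ) / d)

section ScaledRadius

variable {d : ℕ} {t L : ℝ} {n : ℕ}

theorem scaledRadius_pos (ht : 0 < t) (hL : 0 < L) (hn : 1 ≤ n) : 0 < scaledRadius d t L n := by
  have hn0 : (0 : ℝ) < n := by exact_mod_cast hn
  have := ballVol_pos d
  unfold scaledRadius
  positivity

theorem scaledRadius_pow (ht : 0 < t) (hL : 0 < L) (m : ℕ) :
    scaledRadius d t L n ^ m = (t * L / (n * ballVol d)) ^ ((m : ℝ) / d) := by
  have := ballVol_pos d
  rw [scaledRadius, ← Real.rpow_natCast, ← Real.rpow_mul (by positivity)]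
  congr 1
  ring

theorem ballVol_mul_scaledRadius_pow (hd : 0 < d) (ht : 0 < t) (hL : 0 < L) (hn : 1 ≤ n) :
    ballVol d * scaledRadius d t L n ^ d = t * L / n := by
  have hn0 : (0 : ℝ) < n := by exact_mod_cast hn
  have hd0 : (d : ℝ) ≠ 0 := by exact_mod_cast hd.ne'
  have := ballVol_pos d
  rw [scaledRadius_pow ht hL, div_self hd0, Real.rpow_one]
  field_simp

theorem tendsto_scaledRadius (hd : 0 < d) {L : ℕ → ℝ}
    (hL : Tendsto (fun n : ℕ => L n / n) atTop (𝓝 0)) :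
    Tendsto (fun n => scaledRadius d t (L n) n) atTop (𝓝 0) := by
  have h1 : Tendsto (fun n : ℕ => t * L n / (n * ballVol d)) atTop (𝓝 0) := by
    have h2 := hL.const_mul (t / ballVol d)
    rw [mul_zero] at h2
    refine h2.congr fun n => ?_
    rw [div_mul_div_comm, mul_comm (ballVol d)]
  have hd0 : (0 : ℝ) < 1 / d := by positivity
  have h3 := h1.rpow_const (p := (1 : ℝ) / d) (Or.inr hd0.le)
  rwa [Real.zero_rpow hd0.ne'] at h3

end ScaledRadius

/-! ### Almost sure coverage and non-coverage -/

section Probability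

variable {d : ℕ} {A : Set (EuclideanSpace ℝ (Fin d))} {μ : Measure (EuclideanSpace ℝ (Fin d))}
  [IsProbabilityMeasure μ] {Ω : Type*} [MeasurableSpace Ω] {P : Measure Ω}
  [IsProbabilityMeasure P] {X : ℕ → Ω → EuclideanSpace ℝ (Fin d)}

theorem measureReal_exists_countIn_lt_le (hXm : ∀ i, Measurable (X i)) (hXind : iIndepFun X P)
    (hXlaw : ∀ i, P.map (X i) = μ) {r s p₀ p₁ s₀ s₁ : ℝ}
    {T₀ T₁ : Finset (EuclideanSpace ℝ (Fin d))}
    (hT₀ : ∀ x ∈ T₀, p₀ ≤ μ.real (Metric.closedBall x s))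
    (hT₁ : ∀ x ∈ T₁, p₁ ≤ μ.real (Metric.closedBall x s))
    (hT : ∀ y ∈ A, ∃ x, (x ∈ T₀ ∨ x ∈ T₁) ∧ Metric.closedBall x s ⊆ Metric.closedBall y r)
    (hs₀ : 0 < s₀) (hs₀1 : s₀ ≤ 1) (hs₁ : 0 < s₁) (hs₁1 : s₁ ≤ 1) (n k : ℕ) :
    P.real {ω | ∃ y ∈ A, countIn (fun l => X l ω) n (Metric.closedBall y r) < k} ≤
      T₀.card * (Real.exp (-(n * p₀ * (1 - s₀))) * s₀⁻¹ ^ k) +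
      T₁.card * (Real.exp (-(n * p₁ * (1 - s₁))) * s₁⁻¹ ^ k) := by
  set F : EuclideanSpace ℝ (Fin d) → Set Ω := fun x =>
    {ω | countIn (fun l => X l ω) n (Metric.closedBall x s) < k} with hF
  have hsub : {ω | ∃ y ∈ A, countIn (fun l => X l ω) n (Metric.closedBall y r) < k} ⊆
      (⋃ x ∈ T₀, F x) ∪ ⋃ x ∈ T₁, F x := by
    rintro ω ⟨y, hy, hlt⟩
    obtain ⟨x, hx, hsub⟩ := hT y hy
    have hω : ω ∈ F x := (countIn_mono _ le_rfl hsub).trans_lt hlt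
    rcases hx with hx | hx
    · exact Or.inl (Set.mem_biUnion hx hω)
    · exact Or.inr (Set.mem_biUnion hx hω)
  have hbound : ∀ (T : Finset (EuclideanSpace ℝ (Fin d))) (p s' : ℝ),
      (∀ x ∈ T, p ≤ μ.real (Metric.closedBall x s)) → 0 < s' → s' ≤ 1 →
      P.real (⋃ x ∈ T, F x) ≤ T.card * (Real.exp (-(n * p * (1 - s'))) * s'⁻¹ ^ k) := by
    intro T p s' hp hs' hs'1
    refine (measureReal_biUnion_finset_le _ _).trans ?_
    rw [← nsmul_eq_mul]
    exact Finset.sum_le_card_nsmul _ _ _ fun x hx => measureReal_countIn_lt_le hXm hXind hXlaw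
      measurableSet_closedBall (hp x hx) hs' hs'1 n k
  exact (measureReal_mono hsub).trans ((measureReal_union_le _ _).trans
    (add_le_add (hbound T₀ p₀ s₀ hT₀ hs₀ hs₀1) (hbound T₁ p₁ s₁ hT₁ hs₁ hs₁1)))

theorem measureReal_forall_le_countIn_le_pow (hXm : ∀ i, Measurable (X i)) (hXind : iIndepFun X P)
    (hXlaw : ∀ i, P.map (X i) = μ) {r p : ℝ} {T : Finset (EuclideanSpace ℝ (Fin d))}
    (hTA : ↑T ⊆ A)
    (hdisj : ∀ x ∈ T, ∀ y ∈ T, x ≠ y → Disjoint (Metric.closedBall x r) (Metric.closedBall y r))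
    (hp : ∀ x ∈ T, μ.real (Metric.closedBall x r) ≤ p) (hp1 : p ≤ 1) (n k : ℕ) :
    P.real {ω | ∀ y ∈ A, k ≤ countIn (fun l => X l ω) n (Metric.closedBall y r)} ≤
      binTail p n k ^ T.card := by
  have hsub : {ω | ∀ y ∈ A, k ≤ countIn (fun l => X l ω) n (Metric.closedBall y r)} ⊆
      {ω | ∀ x : T, k ≤ countIn (fun l => X l ω) n (Metric.closedBall x r)} :=
    fun ω hω x => hω x (hTA x.2)
  refine (measureReal_mono hsub).trans ((measureReal_forall_le_countIn_le hXm hXind hXlaw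
    (D := fun x : T => Metric.closedBall (x : EuclideanSpace ℝ (Fin d)) r)
    (fun _ => measurableSet_closedBall)
    (fun (x y : T) hxy => hdisj x x.2 y y.2 fun h => hxy (Subtype.ext h)) n fun _ => k).trans ?_)
  refine (Finset.prod_le_prod (fun x _ => binTail_nonneg measureReal_nonneg measureReal_le_one n k)
    fun (x : T) _ => binTail_mono measureReal_nonneg (hp x x.2) hp1 n k).trans (le_of_eq ?_)
  simp

/-- As `L ≥ 1`, the radius is at least of order `n^{-1/d}`, so `O(r^{-m})` balls number
`O(n^{m/d})`. Keeping `L` general serves both regimes. -/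
theorem card_mul_chernoff_le {K C t a s β L r : ℝ} {n k m : ℕ} (hd : 0 < d) (ht : 0 < t)
    (hC : 0 ≤ C) (hL : 1 ≤ L) (hn : 1 ≤ n) (hr : r = scaledRadius d t L n) (hK : K * r ^ m ≤ C)
    (hs0 : 0 < s) (hs1 : s ≤ 1) (hk : (k : ℝ) ≤ β * L) :
    K * (Real.exp (-(n * (a * (ballVol d * r ^ d)) * (1 - s))) * s⁻¹ ^ k) ≤
      C * (ballVol d / t) ^ ((m : ℝ) / d) *
        ((n : ℝ) ^ ((m : ℝ) / d) * Real.exp (-((t * a * (1 - s) + β * Real.log s) * L))) := by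
  have hn0 : (0 : ℝ) < n := by exact_mod_cast hn
  have hθ := ballVol_pos d
  have hL0 : 0 < L := by linarith
  have hr0 : 0 < r := hr ▸ scaledRadius_pos ht hL0 hn
  have e1 : ballVol d * r ^ d = t * L / n := hr ▸ ballVol_mul_scaledRadius_pow hd ht hL0 hn
  have h1 : Real.exp (-(n * (a * (ballVol d * r ^ d)) * (1 - s))) * s⁻¹ ^ k ≤
      Real.exp (-((t * a * (1 - s) + β * Real.log s) * L)) := by
    have e2 : s⁻¹ ^ k = Real.exp (-(k * Real.log s)) := by
      rw [← Real.exp_log (pow_pos (inv_pos.2 hs0) k), Real.log_pow, Real.log_inv]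
      ring_nf
    rw [e1, e2, ← Real.exp_add]
    refine Real.exp_le_exp.2 ?_
    have h2 := mul_le_mul_of_nonpos_right hk (Real.log_nonpos hs0.le hs1)
    have e3 : n * (a * (t * L / n)) * (1 - s) = t * a * (1 - s) * L := by field_simp
    rw [e3]
    linarith
  have h2 : K ≤ C * (ballVol d / t) ^ ((m : ℝ) / d) * (n : ℝ) ^ ((m : ℝ) / d) := by
    have h3 : (t / (n * ballVol d)) ^ ((m : ℝ) / d) ≤ r ^ m := by
      rw [hr, scaledRadius_pow ht hL0]
      refine Real.rpow_le_rpow (by positivity) ?_ (by positivity)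
      gcongr
      nlinarith
    have h4 : K ≤ C / r ^ m := (le_div_iff₀ (by positivity)).2 hK
    refine h4.trans ?_
    rw [mul_assoc, ← Real.mul_rpow (by positivity) hn0.le, div_le_iff₀ (by positivity)]
    have h5 : (ballVol d / t * n) ^ ((m : ℝ) / d) * (t / (n * ballVol d)) ^ ((m : ℝ) / d) = 1 := by
      rw [← Real.mul_rpow (by positivity) (by positivity)]
      have : ballVol d / t * n * (t / (n * ballVol d)) = 1 := by field_simp
      rw [this, Real.one_rpow]
    calc C = C * ((ballVol d / t * n) ^ ((m : ℝ) / d) *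
          (t / (n * ballVol d)) ^ ((m : ℝ) / d)) := by rw [h5, mul_one]
      _ ≤ C * ((ballVol d / t * n) ^ ((m : ℝ) / d) * r ^ m) := by gcongr
      _ = _ := by ring
  calc _ ≤ (C * (ballVol d / t) ^ ((m : ℝ) / d) * (n : ℝ) ^ ((m : ℝ) / d)) *
        Real.exp (-((t * a * (1 - s) + β * Real.log s) * L)) :=
        mul_le_mul h2 h1 (by positivity) (by positivity)
    _ = _ := by ring

/-- Upper bound on the coverage threshold when `k(n) ~ β log n`. -/
theorem ae_eventually_covered_of_log (hXm : ∀ i, Measurable (X i)) (hXind : iIndepFun X P)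
    (hXlaw : ∀ i, P.map (X i) = μ) (hd : 0 < d) {a₀ a₁ : ℝ} (hH : HasHeavyCovers μ A a₀ a₁)
    (ha₀ : 0 < a₀) (ha₁ : 0 < a₁) {β t : ℝ} (hβ : 0 ≤ β) (ht : 0 < t)
    (h₀ : hatH β 1 < t * a₀) (h₁ : hatH β (1 - 1 / (d : ℝ)) < t * a₁) {k : ℕ → ℕ}
    (hk : Tendsto (fun n : ℕ => (k n : ℝ) / Real.log n) atTop (𝓝 β)) :
    ∀ᵐ ω ∂P, ∀ᶠ n : ℕ in atTop, ∀ y ∈ A, k n ≤ countIn (fun l => X l ω) n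
      (Metric.closedBall y (scaledRadius d t (Real.log n) n)) := by
  have hθ := ballVol_pos d
  have hd1 : (1 : ℝ) ≤ d := by exact_mod_cast hd
  have hx₁ : 0 ≤ 1 - 1 / (d : ℝ) := by
    rw [sub_nonneg, div_le_one (by linarith)]; exact hd1
  -- The gap `t' < t` is room for the subsequence: it allows `n ≤ (t / t') N`. The entry `t / 2`
  -- only keeps `t'` positive.
  obtain ⟨t', hmax, ht't⟩ : ∃ t', max (max (hatH β 1 / a₀) (hatH β (1 - 1 / (d : ℝ)) / a₁)) (t / 2)
      < t' ∧ t' < t := by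
    refine exists_between (max_lt (max_lt ?_ ?_) (by linarith))
    · rwa [div_lt_iff₀ ha₀]
    · rwa [div_lt_iff₀ ha₁]
  have ht'0 : 0 < t' := by linarith [le_max_right (max (hatH β 1 / a₀)
    (hatH β (1 - 1 / (d : ℝ)) / a₁)) (t / 2)]
  have h₀' : hatH β 1 < t' * a₀ := by
    rw [← div_lt_iff₀ ha₀]
    exact ((le_max_left _ _).trans (le_max_left _ _)).trans_lt hmax
  have h₁' : hatH β (1 - 1 / (d : ℝ)) < t' * a₁ := by
    rw [← div_lt_iff₀ ha₁]
    exact ((le_max_right _ _).trans (le_max_left _ _)).trans_lt hmax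
  obtain ⟨s₀, hs₀, hs₀1, he₀⟩ := exists_exponent_gt hβ zero_le_one h₀'
  obtain ⟨s₁, hs₁, hs₁1, he₁⟩ := exists_exponent_gt hβ hx₁ h₁'
  -- Likewise `β < β'` gives room in the counts: the points present at time `N` must already suffice
  -- for `k n` at the later time `n`.
  obtain ⟨β', hββ', he₀, he₁⟩ : ∃ β', β < β' ∧ 1 < t' * a₀ * (1 - s₀) + β' * Real.log s₀ ∧
      1 - 1 / (d : ℝ) < t' * a₁ * (1 - s₁) + β' * Real.log s₁ := by
    have c : ∀ b s : ℝ, Tendsto (fun β' => b + β' * Real.log s) (𝓝[>] β)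
        (𝓝 (b + β * Real.log s)) := fun b s => by
      have : Continuous fun β' => b + β' * Real.log s := by fun_prop
      exact (this.tendsto β).mono_left nhdsWithin_le_nhds
    exact ((eventually_mem_nhdsWithin (a := β) (s := Set.Ioi β)).and
      (((c _ _).eventually (lt_mem_nhds he₀)).and ((c _ _).eventually (lt_mem_nhds he₁)))).exists
  obtain ⟨β'', hββ'', hβ''β'⟩ := exists_between hββ'
  set γ := min (t' * a₀ * (1 - s₀) + β' * Real.log s₀ - 1)
    (t' * a₁ * (1 - s₁) + β' * Real.log s₁ - (1 - 1 / (d : ℝ))) with hγdef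
  have hγ : 0 < γ := lt_min (by linarith) (by linarith)
  have hγ₀ : γ ≤ t' * a₀ * (1 - s₀) + β' * Real.log s₀ - 1 := min_le_left _ _
  have hγ₁ : γ ≤ t' * a₁ * (1 - s₁) + β' * Real.log s₁ - (1 - 1 / (d : ℝ)) := min_le_right _ _
  obtain ⟨C, hC, r₀, hr₀, hH⟩ := hH
  -- The threshold `⌊β' log n⌋` replaces `k n`, which need not be monotone.
  set bad : ℕ → Set Ω := fun n => {ω | ∃ y ∈ A, countIn (fun l => X l ω) n
    (Metric.closedBall y (scaledRadius d t' (Real.log n) n)) < ⌊β' * Real.log n⌋₊} with hbad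
  set C' := C * (ballVol d / t') ^ ((d : ℝ) / d) +
    C * (ballVol d / t') ^ (((d - 1 : ℕ) : ℝ) / d) with hC'
  have hbound : ∀ᶠ n : ℕ in atTop, P.real (bad n) ≤ C' * (n : ℝ) ^ (-γ) := by
    filter_upwards [(tendsto_scaledRadius (t := t') hd tendsto_log_div_natCast).eventually
      (gt_mem_nhds hr₀), tendsto_log_natCast.eventually_ge_atTop 1, eventually_ge_atTop 1]
      with n hr hL hn
    have hn0 : (0 : ℝ) < n := by exact_mod_cast hn
    have hn1 : (1 : ℝ) ≤ n := by exact_mod_cast hn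
    have hL0 : 0 < Real.log n := by linarith
    obtain ⟨s, T₀, T₁, hc₀, hc₁, hm₀, hm₁, hT⟩ := hH _ (scaledRadius_pos ht'0 hL0 hn) hr
    have hkf : ((⌊β' * Real.log n⌋₊ : ℕ) : ℝ) ≤ β' * Real.log n :=
      Nat.floor_le (mul_nonneg (hβ.trans hββ'.le) hL0.le)
    refine (measureReal_exists_countIn_lt_le hXm hXind hXlaw hm₀ hm₁ hT hs₀ hs₀1.le hs₁ hs₁1.le
      n _).trans ?_
    have hrp : ∀ x e : ℝ, γ ≤ e - x →
        (n : ℝ) ^ x * Real.exp (-(e * Real.log n)) ≤ (n : ℝ) ^ (-γ) := by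
      intro x e hxe
      have : Real.exp (-(e * Real.log n)) = (n : ℝ) ^ (-e) := by
        rw [Real.rpow_def_of_pos hn0]; ring_nf
      rw [this, ← Real.rpow_add hn0]
      exact Real.rpow_le_rpow_of_exponent_le hn1 (by linarith)
    have hd0 : (d : ℝ) ≠ 0 := by linarith
    have e0 : (d : ℝ) / d = 1 := div_self hd0
    have e1 : ((d - 1 : ℕ) : ℝ) / d = 1 - 1 / d := by
      rw [Nat.cast_sub hd]; push_cast; field_simp
    rw [hC', add_mul]
    refine add_le_add ((card_mul_chernoff_le hd ht'0 hC.le hL hn rfl hc₀ hs₀ hs₀1.le hkf).trans ?_)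
      ((card_mul_chernoff_le hd ht'0 hC.le hL hn rfl hc₁ hs₁ hs₁1.le hkf).trans ?_)
    · exact mul_le_mul_of_nonneg_left (hrp _ _ (by rw [e0]; exact hγ₀)) (by positivity)
    · exact mul_le_mul_of_nonneg_left (hrp _ _ (by rw [e1]; exact hγ₁)) (by positivity)
  have hc1 : 1 < t / t' := (one_lt_div ht'0).2 ht't
  have hkev : ∀ᶠ n : ℕ in atTop, (k n : ℝ) ≤ β'' * Real.log n := by
    filter_upwards [hk.eventually (gt_mem_nhds hββ''),
      tendsto_log_natCast.eventually_gt_atTop 0] with n h1 h2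
    exact ((div_lt_iff₀ h2).1 h1).le
  have hlogev : ∀ᶠ n : ℕ in atTop, β' * Real.log (t / t') ≤ (β' - β'') * Real.log n :=
    (tendsto_log_natCast.const_mul_atTop (sub_pos.2 hβ''β')).eventually_ge_atTop _
  filter_upwards [ae_eventually_exists_notMem_of_le_rpow (by positivity) hγ hbound hc1] with ω hω
  filter_upwards [hω, hkev, hlogev, eventually_ge_atTop 1] with n ⟨N, hNn, hnN, hωN⟩ hkn hlog hn y hy
  have hn0 : (0 : ℝ) < n := by exact_mod_cast hn
  have hN0 : (0 : ℝ) < N := by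
    by_contra hcon
    nlinarith [hn0, hc1]
  have hN1 : (1 : ℝ) ≤ N := by
    have : 0 < N := by exact_mod_cast hN0
    exact_mod_cast this
  have hNn' : (N : ℝ) ≤ n := by exact_mod_cast hNn
  have hlogN : 0 ≤ Real.log N := Real.log_natCast_nonneg N
  have hlogle : Real.log N ≤ Real.log n := Real.log_le_log hN0 hNn'
  have h1 : ⌊β' * Real.log N⌋₊ ≤ countIn (fun l => X l ω) N
      (Metric.closedBall y (scaledRadius d t' (Real.log N) N)) := by
    by_contra hcon
    exact hωN ⟨y, hy, not_le.1 hcon⟩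
  -- From `N` to `n` the radius grows and points are only added, so coverage at time `N` is
  -- inherited.
  have h2 : scaledRadius d t' (Real.log N) N ≤ scaledRadius d t (Real.log n) n := by
    unfold scaledRadius
    refine Real.rpow_le_rpow (by positivity) ?_ (by positivity)
    rw [div_le_div_iff₀ (by positivity) (by positivity)]
    have h3 : t' * n ≤ t * N := by
      have := mul_le_mul_of_nonneg_left hnN ht'0.le
      rwa [← mul_assoc, mul_div_cancel₀ _ ht'0.ne'] at this
    calc t' * Real.log N * (n * ballVol d) = (t' * n) * (Real.log N * ballVol d) := by ring
      _ ≤ (t * N) * (Real.log n * ballVol d) := by gcongr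
      _ = _ := by ring
  refine le_trans ?_ (h1.trans (countIn_mono _ hNn (Metric.closedBall_subset_closedBall h2)))
  refine Nat.le_floor ?_
  have h4 : Real.log n ≤ Real.log (t / t') + Real.log N := by
    rw [← Real.log_mul (by positivity) hN0.ne']
    exact Real.log_le_log hn0 hnN
  have h5 := mul_le_mul_of_nonneg_left h4 (hβ.trans hββ'.le)
  linarith

/-- Upper bound on the coverage threshold when `k(n) / log n → ∞`. -/
theorem ae_eventually_covered_of_atTop (hXm : ∀ i, Measurable (X i)) (hXind : iIndepFun X P)
    (hXlaw : ∀ i, P.map (X i) = μ) (hd : 0 < d) {a₀ a₁ : ℝ} (hH : HasHeavyCovers μ A a₀ a₁)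
    {t : ℝ} (ht : 0 < t) (h₀ : 1 < t * a₀) (h₁ : 1 < t * a₁) {k : ℕ → ℕ}
    (hk : Tendsto (fun n : ℕ => (k n : ℝ) / Real.log n) atTop atTop)
    (hkn : Tendsto (fun n : ℕ => (k n : ℝ) / n) atTop (𝓝 0)) :
    ∀ᵐ ω ∂P, ∀ᶠ n : ℕ in atTop, ∀ y ∈ A, k n ≤ countIn (fun l => X l ω) n
      (Metric.closedBall y (scaledRadius d t (k n) n)) := by
  have hθ := ballVol_pos d
  -- With `k n` as the scale, `β = 1` and `x = 0`: any mean above `k n` gives a positive exponent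
  -- per unit of `k n`.
  rw [← hatH_one_zero] at h₀ h₁
  obtain ⟨s₀, hs₀, hs₀1, he₀⟩ := exists_exponent_gt zero_le_one le_rfl h₀
  obtain ⟨s₁, hs₁, hs₁1, he₁⟩ := exists_exponent_gt zero_le_one le_rfl h₁
  obtain ⟨C, hC, r₀, hr₀, hH⟩ := hH
  set C' := C * (ballVol d / t) ^ ((d : ℝ) / d) +
    C * (ballVol d / t) ^ (((d - 1 : ℕ) : ℝ) / d) with hC'
  have hsum : Summable fun n : ℕ => C' * (n : ℝ) ^ (-2 : ℝ) :=
    (Real.summable_nat_rpow.2 (by norm_num)).mul_left _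
  -- The Chernoff factor is at most `n^{-3}`, against at most order `n` balls. The result is
  -- summable without a subsequence.
  have hexp : ∀ e : ℝ, 0 < e → ∀ᶠ n : ℕ in atTop, 3 * Real.log n ≤ e * k n := by
    intro e he
    filter_upwards [hk.eventually_ge_atTop (3 / e),
      tendsto_log_natCast.eventually_gt_atTop 0] with n h1 h2
    rw [le_div_iff₀ h2] at h1
    have := mul_le_mul_of_nonneg_left h1 he.le
    calc _ = e * (3 / e * Real.log n) := by field_simp
      _ ≤ _ := this
  have hbound : ∀ᶠ n : ℕ in atTop, P.real {ω | ∃ y ∈ A, countIn (fun l => X l ω) n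
      (Metric.closedBall y (scaledRadius d t (k n) n)) < k n} ≤ C' * (n : ℝ) ^ (-2 : ℝ) := by
    filter_upwards [(tendsto_scaledRadius (t := t) hd hkn).eventually (gt_mem_nhds hr₀),
      hexp 1 one_pos, hexp _ he₀, hexp _ he₁, tendsto_log_natCast.eventually_ge_atTop 1,
      eventually_ge_atTop 1] with n hr hk1 hk₀ hk₁ hlog hn
    have hn0 : (0 : ℝ) < n := by exact_mod_cast hn
    have hn1 : (1 : ℝ) ≤ n := by exact_mod_cast hn
    have hL : (1 : ℝ) ≤ k n := by linarith
    obtain ⟨s, T₀, T₁, hc₀, hc₁, hm₀, hm₁, hT⟩ := hH _ (scaledRadius_pos ht (by linarith) hn) hr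
    refine (measureReal_exists_countIn_lt_le hXm hXind hXlaw hm₀ hm₁ hT hs₀ hs₀1.le hs₁ hs₁1.le
      n _).trans ?_
    have hrp : ∀ x e : ℝ, x ≤ 1 → 3 * Real.log n ≤ e * k n →
        (n : ℝ) ^ x * Real.exp (-(e * k n)) ≤ (n : ℝ) ^ (-2 : ℝ) := by
      intro x e hx he
      have h1 : Real.exp (-(e * k n)) ≤ (n : ℝ) ^ (-3 : ℝ) := by
        rw [Real.rpow_def_of_pos hn0]
        exact Real.exp_le_exp.2 (by linarith)
      have h2 : (n : ℝ) ^ x ≤ (n : ℝ) ^ (1 : ℝ) := Real.rpow_le_rpow_of_exponent_le hn1 hx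
      refine (mul_le_mul h2 h1 (Real.exp_pos _).le (by positivity)).trans (le_of_eq ?_)
      rw [← Real.rpow_add hn0]
      norm_num
    have hx : ∀ m : ℕ, m ≤ d → (m : ℝ) / d ≤ 1 := fun m hm =>
      div_le_one_of_le₀ (by exact_mod_cast hm) (by positivity)
    rw [hC', add_mul]
    refine add_le_add ((card_mul_chernoff_le hd ht hC.le hL hn rfl hc₀ hs₀ hs₀1.le
      (one_mul _).ge).trans ?_) ((card_mul_chernoff_le hd ht hC.le hL hn rfl hc₁ hs₁ hs₁1.le
      (one_mul _).ge).trans ?_)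
    · exact mul_le_mul_of_nonneg_left (hrp _ _ (hx d le_rfl) hk₀) (by positivity)
    · exact mul_le_mul_of_nonneg_left (hrp _ _ (hx _ (Nat.sub_le d 1)) hk₁) (by positivity)
  filter_upwards [ae_eventually_notMem_of_summable hsum hbound] with ω hω
  filter_upwards [hω] with n hn y hy
  by_contra hcon
  exact hn ⟨y, hy, not_le.1 hcon⟩

/-- Lower bound on the coverage threshold when `k(n) ~ β log n`. -/
theorem ae_eventually_not_covered_of_log (hXm : ∀ i, Measurable (X i)) (hXind : iIndepFun X P)
    (hXlaw : ∀ i, P.map (X i) = μ) {a : ℝ} {m : ℕ} (hm : 0 < m) (hmd : m ≤ d)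
    (hH : HasLightBalls μ A a m) {β t : ℝ} (hβ : 0 ≤ β) (ht : 0 < t)
    (h : t * a < hatH β ((m : ℝ) / d)) {k : ℕ → ℕ} (hk1 : ∀ᶠ n in atTop, 1 ≤ k n)
    (hk : Tendsto (fun n : ℕ => (k n : ℝ) / Real.log n) atTop (𝓝 β)) :
    ∀ᵐ ω ∂P, ∀ᶠ n : ℕ in atTop, ∃ y ∈ A, countIn (fun l => X l ω) n
      (Metric.closedBall y (scaledRadius d t (Real.log n) n)) < k n := by
  have hθ := ballVol_pos d
  have hd : 0 < d := hm.trans_le hmd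
  set x : ℝ := (m : ℝ) / d with hx
  have hx0 : 0 < x := by positivity
  have hx1 : x ≤ 1 := div_le_one_of_le₀ (by exact_mod_cast hmd) (by positivity)
  obtain ⟨b, hab, hβb, hbx⟩ := exists_exponent_lt hβ hx0 h
  obtain ⟨γ, hγ, hγx⟩ := exists_between hbx
  have hb0 : 0 < b := hβ.trans_lt hβb
  obtain ⟨c, hc, r₀, hr₀, hH⟩ := hH
  have hp : Tendsto (fun n : ℕ => b * Real.log n / n) atTop (𝓝 0) := by
    simpa [mul_div_assoc] using tendsto_log_div_natCast.const_mul b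
  set c' := c * (ballVol d / t) ^ x with hc'
  have hc'0 : 0 < c' := by positivity
  -- The expected number of deficient balls is at least of order `n^{x-γ} / log n`, which eventually
  -- exceeds `2 log n`.
  have hgrow : ∀ᶠ n : ℕ in atTop, 2 * Real.log n ^ (2 : ℝ) ≤ c' * (n : ℝ) ^ (x - γ) := by
    have h1 := (isLittleO_log_rpow_rpow_atTop 2 (sub_pos.2 hγx)).def (half_pos hc'0)
    filter_upwards [tendsto_natCast_atTop_atTop.eventually h1] with n hn
    rw [Real.norm_of_nonneg (Real.rpow_nonneg (Real.log_natCast_nonneg n) _),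
      Real.norm_of_nonneg (by positivity)] at hn
    linarith
  have hsum : Summable fun n : ℕ => (n : ℝ) ^ (-2 : ℝ) := Real.summable_nat_rpow.2 (by norm_num)
  have hbound : ∀ᶠ n : ℕ in atTop, P.real {ω | ∀ y ∈ A, k n ≤ countIn (fun l => X l ω) n
      (Metric.closedBall y (scaledRadius d t (Real.log n) n))} ≤ (n : ℝ) ^ (-2 : ℝ) := by
    filter_upwards [(tendsto_scaledRadius (t := t) hd tendsto_log_div_natCast).eventually
      (gt_mem_nhds hr₀), tendsto_log_natCast.eventually_ge_atTop 1, eventually_ge_atTop 1,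
      hp.eventually (gt_mem_nhds (one_pos : (0 : ℝ) < 1)), hgrow,
      eventually_rpow_le_one_sub_binTail hβ hβb hγ hk1 hk] with n hr hL hn hp1 hgr hq
    have hn0 : (0 : ℝ) < n := by exact_mod_cast hn
    have hL0 : 0 < Real.log n := by linarith
    obtain ⟨T, hTA, hcard, hdisj, hTp⟩ := hH _ (scaledRadius_pos ht hL0 hn) hr
    set p := b * Real.log n / n with hpdef
    have hp0 : 0 ≤ p := by positivity
    have hTp' : ∀ z ∈ T, μ.real (Metric.closedBall z (scaledRadius d t (Real.log n) n)) ≤ p := by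
      intro z hz
      refine (hTp z hz).trans ?_
      rw [ballVol_mul_scaledRadius_pow hd ht hL0 hn, hpdef, ← mul_div_assoc, ← mul_assoc]
      gcongr
      linarith
    refine (measureReal_forall_le_countIn_le_pow hXm hXind hXlaw hTA hdisj hTp' hp1.le n
      (k n)).trans ?_
    set q := binTail p n (k n) with hqdef
    have hq0 : 0 ≤ q := binTail_nonneg hp0 hp1.le n (k n)
    -- Thus `q ^ T.card ≤ exp (-(T.card (1 - q)))`, where `T.card (1 - q)` bounds the expected
    -- number of deficient balls from below.
    have h1 : q ≤ Real.exp (-(1 - q)) := by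
      have := Real.add_one_le_exp (-(1 - q)); linarith
    have hcard' : c' * (n : ℝ) ^ x / Real.log n ≤ T.card := by
      rw [scaledRadius_pow ht hL0, ← hx] at hcard
      have e1 : t * Real.log n / (n * ballVol d) = (ballVol d / t * n)⁻¹ * Real.log n := by
        field_simp
      rw [e1, Real.mul_rpow (by positivity) hL0.le, Real.inv_rpow (by positivity),
        Real.mul_rpow (by positivity) hn0.le] at hcard
      have h2 : Real.log n ^ x ≤ Real.log n := by
        have := Real.rpow_le_rpow_of_exponent_le hL hx1
        rwa [Real.rpow_one] at this
      set u := (ballVol d / t) ^ x * (n : ℝ) ^ x with hu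
      have hu0 : 0 < u := by positivity
      have h3 : c ≤ T.card * (u⁻¹ * Real.log n) := hcard.trans (by gcongr)
      rw [div_le_iff₀ hL0, hc', mul_assoc]
      calc c * u ≤ T.card * (u⁻¹ * Real.log n) * u := by gcongr
        _ = _ := by field_simp
    have h4 : 2 * Real.log n ≤ T.card * (1 - q) := by
      have h5 : c' * (n : ℝ) ^ x / Real.log n * (n : ℝ) ^ (-γ) ≤ T.card * (1 - q) :=
        mul_le_mul hcard' hq (by positivity) (by positivity)
      refine le_trans ?_ h5
      rw [div_mul_eq_mul_div, le_div_iff₀ hL0, mul_assoc c', ← Real.rpow_add hn0, ← sub_eq_add_neg]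
      rw [Real.rpow_two] at hgr
      linarith
    calc q ^ T.card ≤ Real.exp (-(1 - q)) ^ T.card := pow_le_pow_left₀ hq0 h1 _
      _ = Real.exp (-(T.card * (1 - q))) := by rw [← Real.exp_nat_mul]; ring_nf
      _ ≤ Real.exp (Real.log n * -2) := Real.exp_le_exp.2 (by linarith)
      _ = _ := by rw [Real.rpow_def_of_pos hn0]
  filter_upwards [ae_eventually_notMem_of_summable hsum hbound] with ω hω
  filter_upwards [hω] with n hn
  by_contra hcon
  push Not at hcon
  exact hn hcon

/-- Lower bound on the coverage threshold when `k(n) / log n → ∞`. -/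
theorem ae_eventually_not_covered_of_atTop (hXm : ∀ i, Measurable (X i)) (hXind : iIndepFun X P)
    (hXlaw : ∀ i, P.map (X i) = μ) (hd : 0 < d) {a : ℝ} {m : ℕ}
    (hH : HasLightBalls μ A a m) {t : ℝ} (ht : 0 < t) (ha : 0 < a) (h : t * a < 1) {k : ℕ → ℕ}
    (hk : Tendsto (fun n : ℕ => (k n : ℝ) / Real.log n) atTop atTop)
    (hkn : Tendsto (fun n : ℕ => (k n : ℝ) / n) atTop (𝓝 0)) :
    ∀ᵐ ω ∂P, ∀ᶠ n : ℕ in atTop, ∃ y ∈ A, countIn (fun l => X l ω) n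
      (Metric.closedBall y (scaledRadius d t (k n) n)) < k n := by
  obtain ⟨c, hc, r₀, hr₀, hH⟩ := hH
  set b := t * a with hb
  have hb0 : 0 < b := by positivity
  set e := b - 1 - Real.log b with he
  have he0 : 0 < e := by
    have := Real.log_lt_sub_one_of_pos hb0 h.ne
    linarith
  have hexp : ∀ᶠ n : ℕ in atTop, 2 * Real.log n ≤ e * k n := by
    filter_upwards [hk.eventually_ge_atTop (2 / e),
      tendsto_log_natCast.eventually_gt_atTop 0] with n h1 h2
    rw [le_div_iff₀ h2] at h1
    have := mul_le_mul_of_nonneg_left h1 he0.le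
    calc _ = e * (2 / e * Real.log n) := by field_simp
      _ ≤ _ := this
  have hsum : Summable fun n : ℕ => (n : ℝ) ^ (-2 : ℝ) := Real.summable_nat_rpow.2 (by norm_num)
  have hbound : ∀ᶠ n : ℕ in atTop, P.real {ω | ∀ y ∈ A, k n ≤ countIn (fun l => X l ω) n
      (Metric.closedBall y (scaledRadius d t (k n) n))} ≤ (n : ℝ) ^ (-2 : ℝ) := by
    filter_upwards [(tendsto_scaledRadius (t := t) hd hkn).eventually (gt_mem_nhds hr₀),
      hexp, hkn.eventually (gt_mem_nhds (one_pos : (0 : ℝ) < 1)),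
      tendsto_log_natCast.eventually_ge_atTop 1, eventually_ge_atTop 1] with n hr hkl hkn1 hL hn
    have hn0 : (0 : ℝ) < n := by exact_mod_cast hn
    have hk0 : (0 : ℝ) < k n := by
      by_contra hcon
      nlinarith
    obtain ⟨T, hTA, hcard, hdisj, hTp⟩ := hH _ (scaledRadius_pos ht hk0 hn) hr
    -- One light ball is enough here: the cost `exp (-e k)` of filling it beats every power of `n`.
    have hT : 1 ≤ T.card := by
      by_contra hcon
      have : T.card = 0 := by omega
      rw [this, Nat.cast_zero, zero_mul] at hcard
      linarith
    set p := b * k n / n with hpdef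
    have hp0 : 0 ≤ p := by positivity
    have hp1 : p ≤ 1 := by
      rw [hpdef, mul_div_assoc]
      nlinarith [div_pos hk0 hn0]
    have hTp' : ∀ z ∈ T, μ.real (Metric.closedBall z (scaledRadius d t (k n) n)) ≤ p := by
      intro z hz
      refine (hTp z hz).trans (le_of_eq ?_)
      rw [ballVol_mul_scaledRadius_pow hd ht hk0 hn, hpdef, hb]
      ring
    refine (measureReal_forall_le_countIn_le_pow hXm hXind hXlaw hTA hdisj hTp' hp1 n
      (k n)).trans ?_
    have hq0 : 0 ≤ binTail p n (k n) := binTail_nonneg hp0 hp1 n (k n)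
    have hq1 : binTail p n (k n) ≤ 1 := by
      have := binTail_antitone hp0 hp1 n (Nat.zero_le (k n))
      rwa [binTail_zero_right] at this
    refine (pow_le_of_le_one hq0 hq1 (by omega)).trans ?_
    -- The parameter `s = 1 / b` is optimal for mean `b k` and gives the exponent `e = b - 1 - log
    -- b`.
    refine (binTail_le_exp hp0 hp1 ((one_le_inv₀ hb0).2 h.le) n (k n)).trans ?_
    have e2 : (b⁻¹)⁻¹ ^ k n = Real.exp (k n * Real.log b) := by
      rw [inv_inv, ← Real.exp_log (pow_pos hb0 _), Real.log_pow]
    have e3 : n * p * (b⁻¹ - 1) = k n * (1 - b) := by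
      rw [hpdef]; field_simp
    rw [e2, e3, ← Real.exp_add, Real.rpow_def_of_pos hn0]
    refine Real.exp_le_exp.2 ?_
    rw [he] at hkl
    linarith
  filter_upwards [ae_eventually_notMem_of_summable hsum hbound] with ω hω
  filter_upwards [hω] with n hn
  by_contra hcon
  push Not at hcon
  exact hn hcon

end Probability

/-! ### From fixed radii to the threshold -/

section Threshold

theorem coverThreshold_le {E : Type*} [PseudoMetricSpace E] {B : Set E} {x : ℕ → E} {n k : ℕ}
    {r : ℝ} (hr : 0 < r) (h : ∀ y ∈ B, k ≤ countIn x n (Metric.closedBall y r)) :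
    coverThreshold B x n k ≤ ENNReal.ofReal r :=
  sInf_le ⟨r, hr, h, rfl⟩

theorem le_coverThreshold {E : Type*} [PseudoMetricSpace E] {B : Set E} {x : ℕ → E} {n k : ℕ}
    {r : ℝ} (h : ∃ y ∈ B, countIn x n (Metric.closedBall y r) < k) :
    ENNReal.ofReal r ≤ coverThreshold B x n k := by
  refine le_sInf ?_
  rintro _ ⟨s, -, hs, rfl⟩
  obtain ⟨y, hy, hlt⟩ := h
  refine ENNReal.ofReal_le_ofReal (le_of_not_ge fun hsr => ?_)
  exact absurd ((hs y hy).trans (countIn_mono x le_rfl (Metric.closedBall_subset_closedBall hsr)))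
    (not_le.2 hlt)

theorem mul_ofReal_scaledRadius_pow_div {d n : ℕ} {t L : ℝ} (hd : 0 < d) (ht : 0 < t) (hL : 0 < L)
    (hn : 1 ≤ n) :
    (n : ℝ≥0∞) * ENNReal.ofReal (ballVol d) * ENNReal.ofReal (scaledRadius d t L n) ^ d /
      ENNReal.ofReal L = ENNReal.ofReal t := by
  have hn0 : (0 : ℝ) < n := by exact_mod_cast hn
  have hθ := ballVol_pos d
  have hr := scaledRadius_pos (d := d) ht hL hn
  rw [← ENNReal.ofReal_natCast, ← ENNReal.ofReal_pow hr.le, ← ENNReal.ofReal_mul hn0.le,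
    ← ENNReal.ofReal_mul (by positivity), ← ENNReal.ofReal_div_of_pos hL, mul_assoc,
    ballVol_mul_scaledRadius_pow hd ht hL hn]
  congr 1
  field_simp

/-- Contraposition covers `F = 0` and `F = ∞` without separate cases. -/
theorem lt_ofReal_div_of_ofReal_lt_div {F : ℝ≥0∞} {h t : ℝ} (hh : 0 < h) (ht : 0 < t)
    (hlt : ENNReal.ofReal t < ENNReal.ofReal h / F) : F < ENNReal.ofReal (h / t) := by
  by_contra hcon
  refine absurd hlt (not_lt.2 ((ENNReal.div_le_div_left (not_lt.1 hcon) _).trans ?_))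
  rw [← ENNReal.ofReal_div_of_pos (div_pos hh ht)]
  exact ENNReal.ofReal_le_ofReal (le_of_eq (by field_simp))

theorem ofReal_div_lt_of_div_lt_ofReal {F : ℝ≥0∞} {h t : ℝ} (hh : 0 < h) (ht : 0 < t)
    (hlt : ENNReal.ofReal h / F < ENNReal.ofReal t) : ENNReal.ofReal (h / t) < F := by
  by_contra hcon
  refine absurd hlt (not_lt.2 (le_trans ?_ (ENNReal.div_le_div_left (not_lt.1 hcon) _)))
  rw [← ENNReal.ofReal_div_of_pos (div_pos hh ht)]
  exact ENNReal.ofReal_le_ofReal (le_of_eq (by field_simp))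

/-- Rational `t` suffice, so only countably many null sets are discarded. If `M = ∞`, the upper
condition is vacuous. -/
theorem ae_tendsto_of_forall_ofReal {Ω : Type*} [MeasurableSpace Ω] {P : Measure Ω}
    {Q : ℕ → Ω → ℝ≥0∞} {M : ℝ≥0∞}
    (hlow : ∀ t : ℝ, 0 < t → ENNReal.ofReal t < M →
      ∀ᵐ ω ∂P, ∀ᶠ n in atTop, ENNReal.ofReal t ≤ Q n ω)
    (hup : ∀ t : ℝ, 0 < t → M < ENNReal.ofReal t →
      ∀ᵐ ω ∂P, ∀ᶠ n in atTop, Q n ω ≤ ENNReal.ofReal t) :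
    ∀ᵐ ω ∂P, Tendsto (fun n => Q n ω) atTop (𝓝 M) := by
  have h1 : ∀ᵐ ω ∂P, ∀ q : ℚ, (0 < (q : ℝ) → ENNReal.ofReal q < M →
      ∀ᶠ n in atTop, ENNReal.ofReal q ≤ Q n ω) ∧ (0 < (q : ℝ) → M < ENNReal.ofReal q →
      ∀ᶠ n in atTop, Q n ω ≤ ENNReal.ofReal q) := by
    refine ae_all_iff.2 fun q => ?_
    by_cases hq : 0 < (q : ℝ)
    · have hl : ∀ᵐ ω ∂P, ENNReal.ofReal q < M → ∀ᶠ n in atTop, ENNReal.ofReal q ≤ Q n ω := by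
        by_cases h : ENNReal.ofReal q < M
        · filter_upwards [hlow q hq h] with ω hω _ using hω
        · exact Eventually.of_forall fun ω h' => absurd h' h
      have hu : ∀ᵐ ω ∂P, M < ENNReal.ofReal q → ∀ᶠ n in atTop, Q n ω ≤ ENNReal.ofReal q := by
        by_cases h : M < ENNReal.ofReal q
        · filter_upwards [hup q hq h] with ω hω _ using hω
        · exact Eventually.of_forall fun ω h' => absurd h' h
      filter_upwards [hl, hu] with ω h2 h3 using ⟨fun _ => h2, fun _ => h3⟩
    · exact Eventually.of_forall fun ω => ⟨fun h => absurd h hq, fun h => absurd h hq⟩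
  filter_upwards [h1] with ω hω
  refine tendsto_order.2 ⟨fun a ha => ?_, fun a ha => ?_⟩
  · obtain ⟨q, -, hq1, hq2⟩ := ENNReal.lt_iff_exists_rat_btwn.1 ha
    have hq0 : 0 < (q : ℝ) := ENNReal.ofReal_pos.1 (hq1.trans_le' zero_le)
    filter_upwards [(hω q).1 hq0 hq2] with n hn using hq1.trans_le hn
  · obtain ⟨q, -, hq1, hq2⟩ := ENNReal.lt_iff_exists_rat_btwn.1 ha
    have hq0 : 0 < (q : ℝ) := ENNReal.ofReal_pos.1 (hq1.trans_le' zero_le)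
    filter_upwards [(hω q).2 hq0 hq1] with n hn using hn.trans_lt hq2

theorem tendsto_div_log_of_ne_top {k : ℕ → ℕ} {β : ℝ≥0∞} (hβ : β ≠ ⊤)
    (hk : Tendsto (fun n : ℕ => (k n : ℝ≥0∞) / ENNReal.ofReal (Real.log n)) atTop (𝓝 β)) :
    Tendsto (fun n : ℕ => (k n : ℝ) / Real.log n) atTop (𝓝 β.toReal) := by
  refine ((ENNReal.tendsto_toReal hβ).comp hk).congr fun n => ?_
  simp [ENNReal.toReal_div, ENNReal.toReal_ofReal (Real.log_natCast_nonneg n)]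

theorem tendsto_div_log_of_top {k : ℕ → ℕ}
    (hk : Tendsto (fun n : ℕ => (k n : ℝ≥0∞) / ENNReal.ofReal (Real.log n)) atTop (𝓝 ⊤)) :
    Tendsto (fun n : ℕ => (k n : ℝ) / Real.log n) atTop atTop := by
  rw [← ENNReal.tendsto_ofReal_nhds_top]
  refine hk.congr' ?_
  filter_upwards [tendsto_log_natCast.eventually_gt_atTop 0] with n hn
  rw [ENNReal.ofReal_div_of_pos hn, ENNReal.ofReal_natCast]

end Threshold

/-! ### Identification of the limit -/

section Limit

variable {d : ℕ} {A : Set (EuclideanSpace ℝ (Fin d))} {f : EuclideanSpace ℝ (Fin d) → ℝ}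
  {μ : Measure (EuclideanSpace ℝ (Fin d))} {Ω : Type*} [MeasurableSpace Ω] {P : Measure Ω}
  {X : ℕ → Ω → EuclideanSpace ℝ (Fin d)}

/-- The limit of the scaled coverage threshold, from coverage and non-coverage at the radii
`scaledRadius d t (L n) n`. -/
theorem ae_tendsto_coverThreshold [IsProbabilityMeasure μ] (hd : 2 ≤ d) (hA : IsCompact A)
    (hAreg : A ⊆ closure (interior A)) (hC2 : HasC2Boundary A) (hfm : Measurable f)
    (hf0 : ∀ x ∈ A, 0 ≤ f x) (hfc : ∀ x ∈ frontier A, ContinuousWithinAt f A x)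
    (hμ : μ = (volume.restrict A).withDensity fun x => ENNReal.ofReal (f x))
    {k : ℕ → ℕ} {L : ℕ → ℝ} (hL : ∀ᶠ n in atTop, 0 < L n) {h₀ h₁ : ℝ} (hh₀ : 0 < h₀)
    (hh₁ : 0 < h₁)
    (hcov : ∀ a₀ a₁ t : ℝ, HasHeavyCovers μ A a₀ a₁ → 0 < a₀ → 0 < a₁ → 0 < t → h₀ < t * a₀ →
      h₁ < t * a₁ → ∀ᵐ ω ∂P, ∀ᶠ n : ℕ in atTop, ∀ y ∈ A, k n ≤ countIn (fun l => X l ω) n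
        (Metric.closedBall y (scaledRadius d t (L n) n)))
    (hunc₀ : ∀ a t : ℝ, HasLightBalls μ A a d → 0 < a → 0 < t → t * a < h₀ →
      ∀ᵐ ω ∂P, ∀ᶠ n : ℕ in atTop, ∃ y ∈ A, countIn (fun l => X l ω) n
        (Metric.closedBall y (scaledRadius d t (L n) n)) < k n)
    (hunc₁ : ∀ a t : ℝ, HasLightBalls μ A a (d - 1) → 0 < a → 0 < t → t * a < h₁ →
      ∀ᵐ ω ∂P, ∀ᶠ n : ℕ in atTop, ∃ y ∈ A, countIn (fun l => X l ω) n
        (Metric.closedBall y (scaledRadius d t (L n) n)) < k n) :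
    ∀ᵐ ω ∂P, Tendsto (fun n : ℕ => (n : ℝ≥0∞) * ENNReal.ofReal (ballVol d) *
        coverThreshold A (fun i => X i ω) n (k n) ^ d / ENNReal.ofReal (L n)) atTop
      (𝓝 (max (ENNReal.ofReal h₀ / essInfOn f A)
        (ENNReal.ofReal (2 * h₁) / infBoundary f A))) := by
  have hd0 : 0 < d := by omega
  refine ae_tendsto_of_forall_ofReal (fun t ht hlt => ?_) fun t ht hlt => ?_
  · have hkey : ∀ᵐ ω ∂P, ∀ᶠ n : ℕ in atTop, ∃ y ∈ A, countIn (fun l => X l ω) n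
        (Metric.closedBall y (scaledRadius d t (L n) n)) < k n := by
      -- Below the maximum, either the bulk or the boundary alone prevents coverage; above it, both
      -- must be controlled at once.
      rcases lt_max_iff.1 hlt with hlt | hlt
      · obtain ⟨a, ha0, ha1, ha2⟩ := ENNReal.lt_iff_exists_real_btwn.1
          (lt_ofReal_div_of_ofReal_lt_div hh₀ ht hlt)
        have ha : 0 < a := ENNReal.ofReal_pos.1 (ha1.trans_le' zero_le)
        rw [ENNReal.ofReal_lt_ofReal_iff_of_nonneg ha.le, lt_div_iff₀ ht] at ha2
        exact hunc₀ a t (hasLightBalls_of_essInfOn_lt hA hfm hμ ha1) ha ht (by linarith)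
      · obtain ⟨a, ha0, ha1, ha2⟩ := ENNReal.lt_iff_exists_real_btwn.1
          (lt_ofReal_div_of_ofReal_lt_div (by positivity) ht hlt)
        have ha : 0 < a := ENNReal.ofReal_pos.1 (ha1.trans_le' zero_le)
        rw [ENNReal.ofReal_lt_ofReal_iff_of_nonneg ha.le, lt_div_iff₀ ht] at ha2
        -- The factor `2` in the boundary term is the halved mass: `a < 2 h₁ / t` says `t (a / 2) <
        -- h₁`.
        exact hunc₁ (a / 2) t (hasLightBalls_of_infBoundary_lt hA hAreg hC2 hf0 hfc hμ ha1)
          (by positivity) ht (by linarith)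
    filter_upwards [hkey] with ω hω
    filter_upwards [hω, hL, eventually_ge_atTop 1] with n hn hLn hn1
    rw [← mul_ofReal_scaledRadius_pow_div hd0 ht hLn hn1]
    have := le_coverThreshold hn
    gcongr
  · have hlt₀ := ofReal_div_lt_of_div_lt_ofReal hh₀ ht ((le_max_left _ _).trans_lt hlt)
    have hlt₁ := ofReal_div_lt_of_div_lt_ofReal (by positivity) ht
      ((le_max_right _ _).trans_lt hlt)
    obtain ⟨a₀, -, ha₀, ha₀f⟩ := ENNReal.lt_iff_exists_real_btwn.1 hlt₀
    obtain ⟨a₁, -, ha₁, ha₁f⟩ := ENNReal.lt_iff_exists_real_btwn.1 hlt₁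
    rw [ENNReal.ofReal_lt_ofReal_iff_of_nonneg (by positivity)] at ha₀ ha₁
    have hpos₀ : 0 < a₀ := lt_trans (by positivity) ha₀
    have hpos₁ : 0 < a₁ := lt_trans (by positivity) ha₁
    rw [div_lt_iff₀ ht] at ha₀ ha₁
    filter_upwards [hcov a₀ (a₁ / 2) t (hasHeavyCovers hA hAreg hC2 hfc hμ hpos₀ hpos₁ ha₀f ha₁f)
      hpos₀ (by positivity) ht (by linarith) (by linarith)] with ω hω
    filter_upwards [hω, hL, eventually_ge_atTop 1] with n hn hLn hn1
    rw [← mul_ofReal_scaledRadius_pow_div hd0 ht hLn hn1]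
    have := coverThreshold_le (scaledRadius_pos ht hLn hn1) hn
    gcongr

end Limit

end Coverage

/-! ### The theorem -/

theorem mainTheorem4 {d : ℕ} (hd : 2 ≤ d)
    (A : Set (EuclideanSpace ℝ (Fin d))) (hA : IsCompact A)
    (hAreg : A ⊆ closure (interior A)) (hC2 : Coverage.HasC2Boundary A)
    (f : EuclideanSpace ℝ (Fin d) → ℝ) (hfm : Measurable f) (hf0 : ∀ x ∈ A, 0 ≤ f x)
    (hfc : ∀ x ∈ frontier A, ContinuousWithinAt f A x)
    (μ : Measure (EuclideanSpace ℝ (Fin d))) [IsProbabilityMeasure μ]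
    (hμ : μ = (volume.restrict A).withDensity fun x => ENNReal.ofReal (f x))
    {Ω : Type*} [MeasurableSpace Ω] (P : Measure Ω) [IsProbabilityMeasure P]
    (X : ℕ → Ω → EuclideanSpace ℝ (Fin d)) (hXm : ∀ i, Measurable (X i))
    (hXind : iIndepFun X P) (hXlaw : ∀ i, P.map (X i) = μ) :
    (∀ (k : ℕ → ℕ) (β : ℝ≥0∞), (∀ n, 1 ≤ n → 1 ≤ k n) →
      Tendsto (fun n : ℕ => (k n : ℝ≥0∞) / ENNReal.ofReal (Real.log n)) atTop (𝓝 β) →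
      Tendsto (fun n : ℕ => (k n : ℝ) / (n : ℝ)) atTop (𝓝 0) →
      (β = ⊤ → ∀ᵐ ω ∂P,
        Tendsto (fun n : ℕ => (n : ℝ≥0∞) * ENNReal.ofReal (Coverage.ballVol d) *
            Coverage.coverThreshold A (fun i => X i ω) n (k n) ^ d / (k n : ℝ≥0∞)) atTop
          (𝓝 (max (1 / Coverage.essInfOn f A) (2 / Coverage.infBoundary f A)))) ∧
      (β ≠ ⊤ → ∀ᵐ ω ∂P,
        Tendsto (fun n : ℕ => (n : ℝ≥0∞) * ENNReal.ofReal (Coverage.ballVol d) *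
            Coverage.coverThreshold A (fun i => X i ω) n (k n) ^ d /
              ENNReal.ofReal (Real.log n)) atTop
          (𝓝 (max (ENNReal.ofReal (Coverage.hatH β.toReal 1) / Coverage.essInfOn f A)
            (ENNReal.ofReal (2 * Coverage.hatH β.toReal (1 - 1 / (d : ℝ))) /
              Coverage.infBoundary f A))))) ∧
    (∀ k : ℕ, 1 ≤ k → ∀ᵐ ω ∂P,
      Tendsto (fun n : ℕ => (n : ℝ≥0∞) * ENNReal.ofReal (Coverage.ballVol d) *
          Coverage.coverThreshold A (fun i => X i ω) n k ^ d /
            ENNReal.ofReal (Real.log n)) atTop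
        (𝓝 (max (1 / Coverage.essInfOn f A)
          (ENNReal.ofReal (2 - 2 / (d : ℝ)) / Coverage.infBoundary f A)))) := by
  have hd0 : 0 < d := by omega
  have hd2 : (2 : ℝ) ≤ d := by exact_mod_cast hd
  have hx₁ : 0 < 1 - 1 / (d : ℝ) := by
    rw [sub_pos, div_lt_one (by linarith)]; linarith
  have e0 : (d : ℝ) / d = 1 := div_self (by linarith)
  have e1 : ((d - 1 : ℕ) : ℝ) / d = 1 - 1 / d := by
    rw [Nat.cast_sub hd0]; push_cast; field_simp
  have hfinite : ∀ (k : ℕ → ℕ) (β : ℝ), 0 ≤ β → (∀ n, 1 ≤ n → 1 ≤ k n) →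
      Tendsto (fun n : ℕ => (k n : ℝ) / Real.log n) atTop (𝓝 β) → ∀ᵐ ω ∂P,
        Tendsto (fun n : ℕ => (n : ℝ≥0∞) * ENNReal.ofReal (Coverage.ballVol d) *
            Coverage.coverThreshold A (fun i => X i ω) n (k n) ^ d /
              ENNReal.ofReal (Real.log n)) atTop
          (𝓝 (max (ENNReal.ofReal (Coverage.hatH β 1) / Coverage.essInfOn f A)
            (ENNReal.ofReal (2 * Coverage.hatH β (1 - 1 / (d : ℝ))) /
              Coverage.infBoundary f A))) := by
    intro k β hβ hk1 hk
    have hk1' : ∀ᶠ n in atTop, 1 ≤ k n := (eventually_ge_atTop 1).mono hk1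
    refine Coverage.ae_tendsto_coverThreshold hd hA hAreg hC2 hfm hf0 hfc hμ
      (Coverage.tendsto_log_natCast.eventually_gt_atTop 0) (Coverage.hatH_pos hβ one_pos)
      (Coverage.hatH_pos hβ hx₁) ?_ ?_ ?_
    · intro a₀ a₁ t hH ha₀ ha₁ ht h₀ h₁
      exact Coverage.ae_eventually_covered_of_log hXm hXind hXlaw hd0 hH ha₀ ha₁ hβ ht h₀ h₁ hk
    · intro a t hH ha ht h
      exact Coverage.ae_eventually_not_covered_of_log hXm hXind hXlaw hd0 le_rfl hH hβ ht
        (by rwa [e0]) hk1' hk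
    · intro a t hH ha ht h
      exact Coverage.ae_eventually_not_covered_of_log hXm hXind hXlaw (by omega)
        (Nat.sub_le d 1) hH hβ ht (by rwa [e1]) hk1' hk
  refine ⟨fun k β hk1 hk hkn => ⟨fun hβ => ?_, fun hβ => ?_⟩, fun k hk => ?_⟩
  · subst hβ
    have hk' := Coverage.tendsto_div_log_of_top hk
    have hkpos : ∀ᶠ n : ℕ in atTop, (0 : ℝ) < k n := by
      filter_upwards [eventually_ge_atTop 1] with n hn
      exact_mod_cast hk1 n hn
    have := Coverage.ae_tendsto_coverThreshold hd hA hAreg hC2 hfm hf0 hfc hμ (P := P) (X := X)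
      (k := k) hkpos one_pos one_pos
      (fun a₀ a₁ t hH ha₀ ha₁ ht h₀ h₁ => Coverage.ae_eventually_covered_of_atTop hXm hXind hXlaw
        hd0 hH ht h₀ h₁ hk' hkn)
      (fun a t hH ha ht h => Coverage.ae_eventually_not_covered_of_atTop hXm hXind hXlaw hd0 hH ht
        ha h hk' hkn)
      (fun a t hH ha ht h => Coverage.ae_eventually_not_covered_of_atTop hXm hXind hXlaw hd0 hH ht
        ha h hk' hkn)
    simpa using this
  · exact hfinite k β.toReal ENNReal.toReal_nonneg hk1 (Coverage.tendsto_div_log_of_ne_top hβ hk)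
  -- A constant `k` falls under `β = 0`, where `hatH 0 x = x`.
  · have hk0 : Tendsto (fun n : ℕ => (k : ℝ) / Real.log n) atTop (𝓝 0) :=
      Coverage.tendsto_log_natCast.const_div_atTop k
    have := hfinite (fun _ => k) 0 le_rfl (fun _ _ => hk) hk0
    rw [Coverage.hatH_zero_left zero_le_one, Coverage.hatH_zero_left hx₁.le, ENNReal.ofReal_one]
      at this
    have e2 : 2 * (1 - 1 / (d : ℝ)) = 2 - 2 / d := by ring
    rwa [e2] at this
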